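/- **Setting.** Let $k\ge 2$, $a<b$, $T_e>0$, $\sigma>0$, and real constants $\tilde\alpha_1,\tilde\beta_1,\tilde\beta_2$ be given. Let $a=x_{1/2}<x_{3/2}<\dots<x_{N+1/2}=b$ be a mesh with cells $I_j=(x_{j-1/2},x_{j+1/2})$, $h_j=x_{j+1/2}-x_{j-1/2}$, $h=\max_j h_j$, $h/\min_j h_j<\sigma$, cell indices being taken cyclically (periodicity). $V_h^k$ is the space of functions that are complex polynomials of degree $\le k$ on each $I_j$; at $x_{j+1/2}$ let $v^-$, $v^+$ be the values from $I_j$, $I_{j+1}$, $[v]=v^+-v^-$, $\{v\}=\frac12(v^++v^-)$. With $\alpha_1=\tilde\alpha_1$, $\beta_1=\tilde\beta_1h^{-1}$, $\beta_2=\tilde\beta_2h$ (scale invariant flux) put $$\hat v=\{v\}-\alpha_1[v]+\beta_2[v_x],\qquad \widetilde{v_x}=\{v_x\}+\alpha_1[v_x]+\beta_1[v].$$ Let $u$ be a sufficiently smooth solution of $iu_t+u_{xx}=0$ on $[a,b]\times[0,T_e]$, periodic in $x$. The ultra-weak DG solution $u_h(t)\in V_h^k$ satisfies, for all $v\in V_h^k$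 and all $j$, $$\int_{I_j}(u_h)_t v\,dx-i\Big(\int_{I_j}u_hv_{xx}\,dx-\hat u_hv_x^-|_{j+\frac12}+\hat u_hv_x^+|_{j-\frac12}+\widetilde{(u_h)_x}v^-|_{j+\frac12}-\widetilde{(u_h)_x}v^+|_{j-\frac12}\Big)=0 .$$ $P_h^\star u\in V_h^k$ is defined by $\int_{I_j}P_h^\star u\,v\,dx=\int_{I_j}u\,v\,dx$ for all polynomials $v$ of degree $\le k-2$, and $\widehat{P_h^\star u}=u$, $\widetilde{(P_h^\star u)_x}=u_x$ at all $x_{j+1/2}$. Put $w_0=u-P_h^\star u$ and, for $1\le q\le\lfloor\frac{k-1}2\rfloor$, let $w_q\in V_h^k$ be defined by $\int_{I_j}w_qv_{xx}\,dx=-i\int_{I_j}(w_{q-1})_tv\,dx$ for all polynomials $v$ with $2\le\deg v\le k$, and $\widehat{w_q}=0$, $\widetilde{(w_q)_x}=0$ at all $x_{j+1/2}$. Let $u_I=P_h^\star u-\sum_{q=1}^{\lfloor (k-1)/2\rfloor}w_q$ (so $u_I=P_h^\star u$ if $k=2$) and $\zeta_h=u_I-u_h$. Let $\Gamma_j=\beta_1+\frac{\beta_2}{h_j^2}k^2(k^2-1)-\frac{2k^2}{h_j}(\alpha_1^2+\beta_1\beta_2+\frac14)$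 and $\Lambda_j=-\frac{2k}{h_j}(\alpha_1^2+\beta_1\beta_2-\frac14)$; the subscript is dropped on uniform meshes. Consider the assumptions * A1: $\alpha_1^2+\beta_1\beta_2=\frac14$ and $\Gamma_j\ne0$ for all $j$; * A2: the mesh is uniform, $\alpha_1^2+\beta_1\beta_2\neq\frac14$ and $|\Gamma/\Lambda|>1$; * A3: the mesh is uniform, $\alpha_1^2+\beta_1\beta_2\neq\frac14$, and either $|\Gamma/\Lambda|=1$, $N$ is odd and $((-1)^{k+1}\Gamma/\Lambda)^N\ne1$, or $|\Gamma/\Lambda|<1$ and $\lambda^N\neq1$ with $\lambda=(-1)^{k+1}\Gamma/\Lambda+\sqrt{(\Gamma/\Lambda)^2-1}$. Let $\delta>0$ be a margin in the conditions $\Gamma_j\ne0$ and $\lambda^N\neq1$, that is, assume $h_j|\Gamma_j|\ge\delta$ for all $j$ in case A1, and $|\lambda^N-1|\ge\delta$ in case A3 with $|\Gamma/\Lambda|<1$. For $m,n\ge0$ let $M_{m,n}$ denote $\sup_{t\in[0,T_e]}$ of $|u(\cdot,t)|_{W^{k+1+m+2n,\infty}}$ in cases A1 and A2, of $\|u(\cdot,t)\|_{W^{k+3+m+3n,\infty}}$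 in case A3 with $|\Gamma/\Lambda|<1$, and of $\|u(\cdot,t)\|_{W^{k+4+m+4n,\infty}}$ in case A3 with $|\Gamma/\Lambda|=1$, where $u(\cdot,t)$ is assumed to have that many continuous derivatives, and let $M_m=M_{m,0}$. **Theorem.** There is a constant $C$ that depends only on $k,a,b,T_e,\sigma,\delta,\tilde\alpha_1,\tilde\beta_1,\tilde\beta_2$ (not on $u$ or the mesh) such that, if $u_h|_{t=0}=u_I|_{t=0}$, then for all $t\in(0,T_e]$ $$\|\zeta_h(t)\|_{L^2}\le\begin{cases}C\,M_{2,\frac{k-1}2}\,h^{2k}&\text{if }k\text{ is odd and A1, A2 or A3 holds},\\[2pt]\Big(C\,M_{k+2}^2\,h^{4k}+\sum_{I_j\in I^{NU}}C\,M_k^2\,h^{4k-1}\Big)^{1/2}&\text{if }k\text{ is even and A1 or A2 holds},\\[2pt]C\,M_{2,\frac{k-2}2}\,h^{2k-1}&\text{if }k\text{ is even and A3 holds},\end{cases}$$ where $I^{NU}$ is the set of cells whose length differs from that of at least one of their two (cyclic) neighbours. -/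

import Mathlib

noncomputable section

namespace UWDG

open Polynomial

/-- A mesh `a = x_{1/2} < x_{3/2} < ⋯ < x_{N+1/2} = b` of `[a, b]` with `N` cells.
The cells are indexed by `Fin N`; the index arithmetic `j + 1`, `j - 1` in `Fin N` is cyclic,
which encodes the periodic boundary condition. -/
structure Mesh (a b : ℝ) (N : ℕ) where
  node : Fin (N + 1) → ℝ
  strictMono : StrictMono node
  node_zero : node 0 = a
  node_last : node (Fin.last N) = b

/-- Constants `α̃₁, β̃₁, β̃₂` of a scale invariant flux: on a mesh of size `h` the flux parameters
are `α₁ = α̃₁`, `β₁ = β̃₁ / h`, `β₂ = β̃₂ h`. -/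
structure Flux where
  α₁ : ℝ
  β₁ : ℝ
  β₂ : ℝ

section Mesh

variable {a b : ℝ} {N : ℕ}

/-- Left end point of the cell `j`. -/
def Mesh.xL (𝓜 : Mesh a b N) (j : Fin N) : ℝ := 𝓜.node j.castSucc

/-- Right end point of the cell `j`. -/
def Mesh.xR (𝓜 : Mesh a b N) (j : Fin N) : ℝ := 𝓜.node j.succ

/-- Length `h_j` of the cell `j`. -/
def Mesh.len (𝓜 : Mesh a b N) (j : Fin N) : ℝ := 𝓜.xR j - 𝓜.xL j

/-- Mesh size `h = max_j h_j`. -/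
def Mesh.size (𝓜 : Mesh a b N) : ℝ := ⨆ j, 𝓜.len j

/-- Mesh regularity `h / min_j h_j < σ`. -/
def Mesh.Regular (𝓜 : Mesh a b N) (σ : ℝ) : Prop := ∀ j, 𝓜.size / 𝓜.len j < σ

def Mesh.Uniform (𝓜 : Mesh a b N) : Prop := ∀ j, 𝓜.len j = 𝓜.size

open Classical in
/-- The cells whose length differs from that of at least one of their two (cyclic) neighbours. -/
def Mesh.nonuniformCells [NeZero N] (𝓜 : Mesh a b N) : Finset (Fin N) :=
  Finset.univ.filter fun j => 𝓜.len j ≠ 𝓜.len (j + 1) ∨ 𝓜.len j ≠ 𝓜.len (j - 1)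

/-- The space `V_h^k`: one complex polynomial (in the variable `x`) of degree at most `k`
on each cell. -/
def Vh (N k : ℕ) : Set (Fin N → ℂ[X]) := {v | ∀ j, (v j).natDegree ≤ k}

/-- The piecewise function given by a family of polynomials. -/
def toFun (v : Fin N → ℂ[X]) : Fin N → ℝ → ℂ := fun j x => (v j).eval (x : ℂ)

/-- Piecewise derivative in `x`. -/
def dx (v : Fin N → ℂ[X]) : Fin N → ℂ[X] := fun j => derivative (v j)

/-- Time derivative, on `[0, T]`, of a time dependent piecewise function. -/
def dt (T : ℝ) (W : ℝ → Fin N → ℝ → ℂ) (t : ℝ) : Fin N → ℝ → ℂ :=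
  fun j x => derivWithin (fun τ => W τ j x) (Set.Icc 0 T) t

/-- The `L²` norm of a piecewise polynomial. -/
def l2norm (𝓜 : Mesh a b N) (v : Fin N → ℂ[X]) : ℝ :=
  Real.sqrt (∑ j, ∫ x in (𝓜.xL j)..(𝓜.xR j), ‖toFun v j x‖ ^ 2)

end Mesh

section Scheme

variable {a b : ℝ} {N : ℕ} [NeZero N]

/-- The value `v⁻` at the right end point of the cell `j` (interface `j + 1/2`). -/
def vMinus (𝓜 : Mesh a b N) (v : Fin N → ℂ[X]) (j : Fin N) : ℂ := (v j).eval (𝓜.xR j : ℂ)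

/-- The value `v⁺` at the interface `j + 1/2`, taken from the next cell. -/
def vPlus (𝓜 : Mesh a b N) (v : Fin N → ℂ[X]) (j : Fin N) : ℂ :=
  (v (j + 1)).eval (𝓜.xL (j + 1) : ℂ)

def avg (𝓜 : Mesh a b N) (v : Fin N → ℂ[X]) (j : Fin N) : ℂ :=
  (vPlus 𝓜 v j + vMinus 𝓜 v j) / 2

def jump (𝓜 : Mesh a b N) (v : Fin N → ℂ[X]) (j : Fin N) : ℂ :=
  vPlus 𝓜 v j - vMinus 𝓜 v j

/-- The numerical flux `v̂ = {v} - α₁ [v] + β₂ [v_x]` at the interface `j + 1/2`. -/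
def hatFlux (F : Flux) (𝓜 : Mesh a b N) (v : Fin N → ℂ[X]) (j : Fin N) : ℂ :=
  avg 𝓜 v j - (F.α₁ : ℂ) * jump 𝓜 v j + ((F.β₂ * 𝓜.size : ℝ) : ℂ) * jump 𝓜 (dx v) j

/-- The numerical flux `{v_x} + α₁ [v_x] + β₁ [v]` for the derivative at the interface
`j + 1/2`. -/
def tildeFlux (F : Flux) (𝓜 : Mesh a b N) (v : Fin N → ℂ[X]) (j : Fin N) : ℂ :=
  avg 𝓜 (dx v) j + (F.α₁ : ℂ) * jump 𝓜 (dx v) j + ((F.β₁ / 𝓜.size : ℝ) : ℂ) * jump 𝓜 v j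

/-- The ultra-weak spatial discretization `A_j(u_h, v_h)` of the second derivative. The interface
`j + 1/2` is number `j`, the interface `j - 1/2` is number `j - 1`. -/
def bilinA (F : Flux) (𝓜 : Mesh a b N) (w v : Fin N → ℂ[X]) (j : Fin N) : ℂ :=
  (∫ x in (𝓜.xL j)..(𝓜.xR j), toFun w j x * toFun (dx (dx v)) j x)
    - hatFlux F 𝓜 w j * vMinus 𝓜 (dx v) j
    + hatFlux F 𝓜 w (j - 1) * vPlus 𝓜 (dx v) (j - 1)
    + tildeFlux F 𝓜 w j * vMinus 𝓜 v j
    - tildeFlux F 𝓜 w (j - 1) * vPlus 𝓜 v (j - 1)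

/-- `uh` solves the semi-discrete scheme on `[0, T]`. -/
structure IsUWDGSolution (k : ℕ) (F : Flux) (𝓜 : Mesh a b N) (T : ℝ)
    (uh : ℝ → Fin N → ℂ[X]) : Prop where
  mem : ∀ t ∈ Set.Icc 0 T, uh t ∈ Vh N k
  differentiable : ∀ j x, DifferentiableOn ℝ (fun t => toFun (uh t) j x) (Set.Icc 0 T)
  scheme : ∀ t ∈ Set.Icc 0 T, ∀ v ∈ Vh N k, ∀ j,
    (∫ x in (𝓜.xL j)..(𝓜.xR j), dt T (fun τ => toFun (uh τ)) t j x * toFun v j x)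
      - Complex.I * bilinA F 𝓜 (uh t) v j = 0

/-- The conditions that define the projection `P*_h f` of a periodic function `f`. -/
structure IsPstar (k : ℕ) (F : Flux) (𝓜 : Mesh a b N) (f : ℝ → ℂ) (p : Fin N → ℂ[X]) :
    Prop where
  mem : p ∈ Vh N k
  moments : ∀ j, ∀ q : ℂ[X], q.natDegree ≤ k - 2 →
    (∫ x in (𝓜.xL j)..(𝓜.xR j), toFun p j x * q.eval (x : ℂ))
      = ∫ x in (𝓜.xL j)..(𝓜.xR j), f x * q.eval (x : ℂ)
  hat_eq : ∀ j, hatFlux F 𝓜 p j = f (𝓜.xR j)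
  tilde_eq : ∀ j, tildeFlux F 𝓜 p j = deriv f (𝓜.xR j)

/-- The projection `P*_h f`. -/
def Pstar (k : ℕ) (F : Flux) (𝓜 : Mesh a b N) (f : ℝ → ℂ) : Fin N → ℂ[X] :=
  Classical.epsilon (IsPstar k F 𝓜 f)

/-- The conditions that define the correction `w_q`, where `g` is the time derivative of
`w_{q-1}`. -/
structure IsCorrection (k : ℕ) (F : Flux) (𝓜 : Mesh a b N) (g : Fin N → ℝ → ℂ)
    (w : Fin N → ℂ[X]) : Prop where
  mem : w ∈ Vh N k
  moments : ∀ j, ∀ v : ℂ[X], v.natDegree ≤ k → 2 ≤ v.natDegree →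
    (∫ x in (𝓜.xL j)..(𝓜.xR j), toFun w j x * (derivative (derivative v)).eval (x : ℂ))
      = -Complex.I * ∫ x in (𝓜.xL j)..(𝓜.xR j), g j x * v.eval (x : ℂ)
  hat_eq : ∀ j, hatFlux F 𝓜 w j = 0
  tilde_eq : ∀ j, tildeFlux F 𝓜 w j = 0

/-- The function `w_q` determined by the time dependent piecewise function `W = w_{q-1}`. -/
def nextCorrection (k : ℕ) (F : Flux) (𝓜 : Mesh a b N) (T : ℝ) (W : ℝ → Fin N → ℝ → ℂ)
    (t : ℝ) : Fin N → ℂ[X] :=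
  Classical.epsilon (IsCorrection k F 𝓜 (dt T W t))

/-- `correction … q` is `w_{q+1}`; the recursion starts from `w_0 = u - P*_h u`. -/
def correction (k : ℕ) (F : Flux) (𝓜 : Mesh a b N) (T : ℝ) (u : ℝ → ℝ → ℂ) :
    ℕ → ℝ → Fin N → ℂ[X]
  | 0 => nextCorrection k F 𝓜 T fun t j x => u t x - toFun (Pstar k F 𝓜 (u t)) j x
  | q + 1 => nextCorrection k F 𝓜 T fun t => toFun (correction k F 𝓜 T u q t)

/-- `u_I = P*_h u - (w_1 + ⋯ + w_{⌊(k-1)/2⌋})`; the sum is empty for `k = 2`. -/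
def uI (k : ℕ) (F : Flux) (𝓜 : Mesh a b N) (T : ℝ) (u : ℝ → ℝ → ℂ) (t : ℝ) : Fin N → ℂ[X] :=
  Pstar k F 𝓜 (u t) - ∑ q ∈ Finset.range ((k - 1) / 2), correction k F 𝓜 T u q t

end Scheme

section Assumptions

variable {a b : ℝ} {N : ℕ}

/-- `Γ_j = β₁ + β₂ k²(k²-1) / h_j² - (2k²/h_j)(α₁² + β₁β₂ + 1/4)`. -/
def Gam (k : ℕ) (F : Flux) (𝓜 : Mesh a b N) (hj : ℝ) : ℝ :=
  F.β₁ / 𝓜.size + F.β₂ * 𝓜.size / hj ^ 2 * ((k : ℝ) ^ 2 * ((k : ℝ) ^ 2 - 1))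
    - 2 * (k : ℝ) ^ 2 / hj * (F.α₁ ^ 2 + F.β₁ * F.β₂ + 1 / 4)

/-- `Λ_j = -(2k/h_j)(α₁² + β₁β₂ - 1/4)`. -/
def Lam (k : ℕ) (F : Flux) (hj : ℝ) : ℝ :=
  -(2 * (k : ℝ) / hj) * (F.α₁ ^ 2 + F.β₁ * F.β₂ - 1 / 4)

/-- The quotient `Γ / Λ` on a uniform mesh. -/
def ratio (k : ℕ) (F : Flux) (𝓜 : Mesh a b N) : ℝ :=
  Gam k F 𝓜 𝓜.size / Lam k F 𝓜.size

/-- `(-1)^{k+1} Γ/Λ + √((Γ/Λ)² - 1)` for `|Γ/Λ| ≤ 1`, a complex number of modulus one. -/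
def lam (k : ℕ) (F : Flux) (𝓜 : Mesh a b N) : ℂ :=
  (((-1) ^ (k + 1) * ratio k F 𝓜 : ℝ) : ℂ)
    + Complex.I * (Real.sqrt (1 - ratio k F 𝓜 ^ 2) : ℂ)

/-- Local projection. -/
def AssumptionA1 (k : ℕ) (F : Flux) (𝓜 : Mesh a b N) : Prop :=
  F.α₁ ^ 2 + F.β₁ * F.β₂ = 1 / 4 ∧ ∀ j, Gam k F 𝓜 (𝓜.len j) ≠ 0

/-- Global projection, `|Γ/Λ| > 1`. -/
def AssumptionA2 (k : ℕ) (F : Flux) (𝓜 : Mesh a b N) : Prop :=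
  𝓜.Uniform ∧ F.α₁ ^ 2 + F.β₁ * F.β₂ ≠ 1 / 4 ∧ 1 < |ratio k F 𝓜|

/-- Global projection, `|Γ/Λ| < 1`. -/
def AssumptionA3lt (k : ℕ) (F : Flux) (𝓜 : Mesh a b N) : Prop :=
  𝓜.Uniform ∧ F.α₁ ^ 2 + F.β₁ * F.β₂ ≠ 1 / 4 ∧ |ratio k F 𝓜| < 1 ∧ lam k F 𝓜 ^ N ≠ 1

/-- Global projection, `|Γ/Λ| = 1`. -/
def AssumptionA3eq (k : ℕ) (F : Flux) (𝓜 : Mesh a b N) : Prop :=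
  𝓜.Uniform ∧ F.α₁ ^ 2 + F.β₁ * F.β₂ ≠ 1 / 4 ∧ |ratio k F 𝓜| = 1 ∧
    ((-1) ^ (k + 1) * ratio k F 𝓜) ^ N ≠ 1 ∧ Odd N

def AssumptionA3 (k : ℕ) (F : Flux) (𝓜 : Mesh a b N) : Prop :=
  AssumptionA3lt k F 𝓜 ∨ AssumptionA3eq k F 𝓜

/-- The non-degeneracy conditions `Γ_j ≠ 0` and `λ^N ≠ 1` hold with margin `δ`. The first one is
made scale invariant by the factor `h_j`. Every single mesh has a margin `δ > 0`; a family of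
meshes admits mesh independent constants only if it has a common one. -/
def Margin (k : ℕ) (F : Flux) (𝓜 : Mesh a b N) (δ : ℝ) : Prop :=
  (AssumptionA1 k F 𝓜 → ∀ j, δ ≤ 𝓜.len j * |Gam k F 𝓜 (𝓜.len j)|) ∧
  (AssumptionA3lt k F 𝓜 → δ ≤ ‖lam k F 𝓜 ^ N - 1‖)

end Assumptions

section Exact

/-- `u t x` is a classical solution on `[0, T]` of `i u_t + u_xx = 0` that is periodic in `x` with
period `b - a`. -/
structure IsExactSolution (a b T : ℝ) (u : ℝ → ℝ → ℂ) : Prop where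
  periodic : ∀ t ∈ Set.Icc 0 T, Function.Periodic (u t) (b - a)
  contDiff : ∀ t ∈ Set.Icc 0 T, ContDiff ℝ 2 (u t)
  differentiable : ∀ x, DifferentiableOn ℝ (fun t => u t x) (Set.Icc 0 T)
  eqn : ∀ t ∈ Set.Icc 0 T, ∀ x,
    Complex.I * derivWithin (fun τ => u τ x) (Set.Icc 0 T) t + iteratedDeriv 2 (u t) x = 0

/-- `u(·, t)` is of class `C^s` with seminorm `|u(·, t)|_{W^{s,∞}} ≤ M` for all `t ∈ [0, T]`. -/
def SeminormLE (T : ℝ) (s : ℕ) (u : ℝ → ℝ → ℂ) (M : ℝ) : Prop :=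
  ∀ t ∈ Set.Icc 0 T, ContDiff ℝ s (u t) ∧ ∀ x, ‖iteratedDeriv s (u t) x‖ ≤ M

/-- `u(·, t)` is of class `C^s` with norm `‖u(·, t)‖_{W^{s,∞}} ≤ M` for all `t ∈ [0, T]`. -/
def NormLE (T : ℝ) (s : ℕ) (u : ℝ → ℝ → ℂ) (M : ℝ) : Prop :=
  ∀ t ∈ Set.Icc 0 T, ContDiff ℝ s (u t) ∧ ∀ i ≤ s, ∀ x, ‖iteratedDeriv i (u t) x‖ ≤ M

/-- `M` bounds the (semi)norm of `u` on which the constant `C_{m,n}` is allowed to depend. -/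
def RegularityLE {a b : ℝ} {N : ℕ} (k : ℕ) (F : Flux) (𝓜 : Mesh a b N) (T : ℝ) (m n : ℕ)
    (u : ℝ → ℝ → ℂ) (M : ℝ) : Prop :=
  ((AssumptionA1 k F 𝓜 ∨ AssumptionA2 k F 𝓜) ∧ SeminormLE T (k + 1 + m + 2 * n) u M) ∨
  (AssumptionA3lt k F 𝓜 ∧ NormLE T (k + 3 + m + 3 * n) u M) ∨
  (AssumptionA3eq k F 𝓜 ∧ NormLE T (k + 4 + m + 4 * n) u M)

end Exact

end UWDG

end

open UWDG

noncomputable section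

open Polynomial intervalIntegral MeasureTheory

namespace UWDG

/-! Every cell is pulled back to [0,1], where the two numerical fluxes become the dimensionless
forms `fl1` and `fl2`. A polynomial of degree ≤ k on each cell is determined by its Legendre moments
of order < k - 1, which are local, and by the two fluxes at each interface, which then fix the
coefficients of the two highest Legendre modes. All dependence on the flux parameters is thereby
reduced to `Stable`: these coefficients are bounded by their fluxes, uniformly in the mesh.

Under A1 the matrices that the fluxes apply to the two one-sided traces are complementary
projections, so the system splits into one 2×2 block per cell, with determinant ∓2 ρ_j (h_j Γ_j),
ρ_j = h / h_j. On a uniform mesh, elimination leaves the recurrence x_{j+2} + τ x_{j+1} + x_j with τ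
= 2(-1)^k Γ/Λ. It is diagonally dominant under A2. Under A3 its characteristic roots lie on the unit
circle, and inverting it naively costs a factor N ~ 1/h per root. This loss is repaired by
differences of the data from cell to cell: one for two simple roots, two for the double root -1. The
predicate `Bd` keeps track of such differences. For smooth data each of them is worth a factor h and
costs one derivative of u, which is why A3 needs stronger norms.

Since u_t = i u_xx, the time derivative of w_q is i times the correction of order q of u_xx. The
corrections thus obey a recursion in space only (`IsW`), each stage gains h² (`exists_bd_isW`), and
in u_I the contributions telescope: u_I solves the scheme up to the residual -i W, where W is the
correction of order n = ⌊(k-1)/2⌋ of u_xx, of size h^{k+1+2n} (`Good.evol_uI`). The spatial form is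
symmetric with real coefficients, so it drops out of the energy balance
(`Evol.hasDerivWithinAt_nsq`), and Gronwall gives h^{2k} for odd k and h^{2k-1} for even k
(`exists_l2norm_le`).

For even k under A1 or A2 a further power of h comes from the residual having mean zero on every
cell. Two integrations by parts write its pairing with v as A(z, v) with z = O(h²) relative to the
residual, plus jumps of first moments at the interfaces (`exists_representation`). In the first term
symmetry and the error equation trade A for ζ_t, which is as small as the residual
(`Evol.nsq_deriv_le`). The jumps gain an additional h between neighbours of equal length, by
smoothness of u; the other interfaces produce the sum over the nonuniform cells
(`Evol.nsq_le_of_mean_zero`). -/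

/-- A complex polynomial as a function of a real variable. -/
def pf (p : ℂ[X]) : ℝ → ℂ := fun ξ => p.eval (ξ : ℂ)

@[simp] lemma pf_add (p q : ℂ[X]) (ξ : ℝ) : pf (p + q) ξ = pf p ξ + pf q ξ := by simp [pf]
@[simp] lemma pf_sub (p q : ℂ[X]) (ξ : ℝ) : pf (p - q) ξ = pf p ξ - pf q ξ := by simp [pf]
@[simp] lemma pf_mul (p q : ℂ[X]) (ξ : ℝ) : pf (p * q) ξ = pf p ξ * pf q ξ := by simp [pf]
@[simp] lemma pf_C (c : ℂ) (ξ : ℝ) : pf (C c) ξ = c := by simp [pf]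
@[simp] lemma pf_zero (ξ : ℝ) : pf 0 ξ = 0 := by simp [pf]
@[simp] lemma pf_one (ξ : ℝ) : pf 1 ξ = 1 := by simp [pf]
@[simp] lemma pf_X (ξ : ℝ) : pf X ξ = ξ := by simp [pf]

lemma pf_sum {ι : Type*} (t : Finset ι) (p : ι → ℂ[X]) (ξ : ℝ) :
    pf (∑ i ∈ t, p i) ξ = ∑ i ∈ t, pf (p i) ξ := by
  simp [pf, eval_finsetSum]

lemma continuous_pf (p : ℂ[X]) : Continuous (pf p) :=
  p.continuous.comp Complex.continuous_ofReal

lemma hasDerivAt_pf (p : ℂ[X]) (ξ : ℝ) : HasDerivAt (pf p) (pf (derivative p) ξ) ξ :=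
  (p.hasDerivAt (ξ : ℂ)).comp_ofReal

lemma deriv_pf (p : ℂ[X]) (ξ : ℝ) : deriv (pf p) ξ = pf (derivative p) ξ :=
  (hasDerivAt_pf p ξ).deriv

lemma contDiff_pf (p : ℂ[X]) (n : WithTop ℕ∞) : ContDiff ℝ n (pf p) := by
  have h : ContDiff ℝ n fun z : ℂ => p.eval z := by
    have := (p.contDiff_aeval (𝕜 := ℂ) n)
    simpa using this.restrict_scalars ℝ
  exact h.comp Complex.ofRealCLM.contDiff

/-- A polynomial vanishing on a set with many points is zero; here the set is `[0, 1]`. -/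
lemma eq_zero_of_pf_eq_zero {p : ℂ[X]} (h : ∀ ξ ∈ Set.Icc (0 : ℝ) 1, pf p ξ = 0) : p = 0 := by
  refine p.eq_zero_of_infinite_isRoot ?_
  refine Set.Infinite.mono (s := (fun ξ : ℝ => (ξ : ℂ)) '' Set.Icc 0 1) ?_ ?_
  · rintro _ ⟨ξ, hξ, rfl⟩
    exact h ξ hξ
  · exact (Set.Icc_infinite zero_lt_one).image Complex.ofReal_injective.injOn

/-- Integration by parts against a polynomial. -/
lemma integral_mul_pf_derivative {φ φ' : ℝ → ℂ} {a b : ℝ} (h : ∀ x, HasDerivAt φ (φ' x) x)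
    (h' : Continuous φ') (q : ℂ[X]) :
    ∫ x in a..b, φ x * pf (derivative q) x
      = φ b * pf q b - φ a * pf q a - ∫ x in a..b, φ' x * pf q x :=
  integral_mul_deriv_eq_deriv_mul (fun x _ => h x) (fun x _ => hasDerivAt_pf q x)
    (h'.intervalIntegrable _ _) ((continuous_pf _).intervalIntegrable _ _)

/-! ### Legendre polynomials on the reference cell. -/

/-- The bump `xⁿ(1-x)ⁿ` of Rodrigues' formula. -/
def bump (n : ℕ) : ℂ[X] := X ^ n * (1 - X) ^ n

/-- The Legendre polynomial of degree `n` on `[0, 1]`. -/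
def leg (n : ℕ) : ℂ[X] := (shiftedLegendre n).map (Int.castRingHom ℂ)

/-- The real valued function given by the Legendre polynomial. -/
def legR (n : ℕ) (ξ : ℝ) : ℝ := ((shiftedLegendre n).map (Int.castRingHom ℝ)).eval ξ

lemma pf_leg (n : ℕ) (ξ : ℝ) : pf (leg n) ξ = (legR n ξ : ℂ) := by
  have h := Polynomial.hom_eval₂ (shiftedLegendre n) (Int.castRingHom ℝ) Complex.ofRealHom ξ
  rw [pf, leg, legR, eval_map, eval_map]
  simp only [Complex.ofRealHom_eq_coe] at h
  rw [h]
  congr 1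

lemma continuous_legR (n : ℕ) : Continuous (legR n) := Polynomial.continuous _

lemma natDegree_leg (n : ℕ) : (leg n).natDegree = n := by
  rw [leg, natDegree_map_eq_of_injective (RingHom.injective_int _), natDegree_shiftedLegendre]

lemma leg_ne_zero (n : ℕ) : leg n ≠ 0 := by
  intro h
  have := congrArg (fun p => p.coeff n) h
  simp only [leg, coeff_map, coeff_shiftedLegendre, coeff_zero] at this
  simp [(Nat.choose_pos (show n ≤ n + n by simp)).ne'] at this

lemma factorial_mul_leg (n : ℕ) : (n.factorial : ℂ[X]) * leg n = derivative^[n] (bump n) := by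
  have h := congrArg (Polynomial.map (Int.castRingHom ℂ)) (factorial_mul_shiftedLegendre_eq n)
  simp only [Polynomial.map_mul, Polynomial.map_natCast, ← Polynomial.iterate_derivative_map] at h
  simpa [bump, leg] using h

/-- Both end points are zeros of order n, and each derivative lowers the order by one. Hence no
boundary terms appear in the first n integrations by parts. -/
lemma pf_iterate_derivative_bump {n m : ℕ} (hm : m < n) :
    pf (derivative^[m] (bump n)) 0 = 0 ∧ pf (derivative^[m] (bump n)) 1 = 0 := by
  constructor
  · have h := Polynomial.pow_sub_dvd_iterate_derivative_of_pow_dvd m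
      (show (X : ℂ[X]) ^ n ∣ bump n from dvd_mul_right _ _)
    obtain ⟨q, hq⟩ := h
    rw [hq]
    simp [pf, Nat.sub_ne_zero_of_lt hm]
  · have h := Polynomial.pow_sub_dvd_iterate_derivative_of_pow_dvd m
      (show (1 - X : ℂ[X]) ^ n ∣ bump n from dvd_mul_left _ _)
    obtain ⟨q, hq⟩ := h
    rw [hq]
    simp [pf, Nat.sub_ne_zero_of_lt hm]

lemma integral_iterate_derivative_bump (n m : ℕ) (hm : m ≤ n) (q : ℂ[X]) :
    ∫ ξ in (0 : ℝ)..1, pf (derivative^[m] (bump n)) ξ * pf q ξ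
      = (-1) ^ m * ∫ ξ in (0 : ℝ)..1, pf (bump n) ξ * pf (derivative^[m] q) ξ := by
  induction m generalizing q with
  | zero => simp
  | succ m ih =>
    have h := integral_mul_pf_derivative (a := 0) (b := 1)
      (hasDerivAt_pf (derivative^[m] (bump n))) (continuous_pf _) q
    obtain ⟨h0, h1⟩ := pf_iterate_derivative_bump (Nat.lt_of_succ_le hm)
    rw [h0, h1, ih (by omega)] at h
    rw [Function.iterate_succ_apply', Function.iterate_succ_apply, pow_succ]
    linear_combination h

/-- The moment of order `n` on the reference cell. -/
def mom (n : ℕ) (φ : ℝ → ℂ) : ℂ := ∫ ξ in (0 : ℝ)..1, φ ξ * pf (leg n) ξ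

/-- By Rodrigues' formula, n integrations by parts move all derivatives onto q, whose n-th
derivative vanishes. -/
lemma mom_pf_eq_zero {n : ℕ} {q : ℂ[X]} (hq : q.natDegree < n) : mom n (pf q) = 0 := by
  have h := integral_iterate_derivative_bump n n le_rfl q
  rw [iterate_derivative_eq_zero hq, ← factorial_mul_leg] at h
  have h2 : ∫ ξ in (0 : ℝ)..1, pf ((n.factorial : ℂ[X]) * leg n) ξ * pf q ξ
      = (n.factorial : ℂ) * mom n (pf q) := by
    rw [mom, ← intervalIntegral.integral_const_mul]
    congr 1
    ext ξ
    simp [pf]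
    ring
  rw [h2] at h
  simpa [n.factorial_ne_zero] using h

/-- The squared norm of the Legendre polynomial. -/
def nrm (n : ℕ) : ℝ := ∫ ξ in (0 : ℝ)..1, legR n ξ ^ 2

lemma nrm_pos (n : ℕ) : 0 < nrm n := by
  have hc : Continuous fun ξ => legR n ξ ^ 2 := (continuous_legR n).pow 2
  refine intervalIntegral.integral_pos zero_lt_one hc.continuousOn (fun x _ => sq_nonneg _) ?_
  by_contra hcon
  push Not at hcon
  refine leg_ne_zero n (eq_zero_of_pf_eq_zero fun ξ hξ => ?_)
  have := hcon ξ hξ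
  have h0 : legR n ξ = 0 := by nlinarith [sq_nonneg (legR n ξ)]
  rw [pf_leg, h0, Complex.ofReal_zero]

lemma mom_leg (n : ℕ) : mom n (pf (leg n)) = nrm n := by
  rw [mom, nrm, ← intervalIntegral.integral_ofReal]
  congr 1
  ext ξ
  rw [pf_leg]
  push_cast
  ring

lemma mom_leg_of_ne {m n : ℕ} (h : m ≠ n) : mom n (pf (leg m)) = 0 := by
  rcases lt_or_gt_of_ne h with h | h
  · exact mom_pf_eq_zero (by rwa [natDegree_leg])
  · have : mom m (pf (leg n)) = 0 := mom_pf_eq_zero (by rwa [natDegree_leg])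
    rw [← this, mom, mom]
    congr 1
    ext ξ
    ring

lemma mom_add {n : ℕ} {φ ψ : ℝ → ℂ} (hφ : Continuous φ) (hψ : Continuous ψ) :
    mom n (fun ξ => φ ξ + ψ ξ) = mom n φ + mom n ψ := by
  rw [mom, mom, mom, ← intervalIntegral.integral_add]
  · simp only [add_mul]
  · exact (hφ.mul (continuous_pf _)).intervalIntegrable _ _
  · exact (hψ.mul (continuous_pf _)).intervalIntegrable _ _

lemma mom_const_mul (n : ℕ) (c : ℂ) (φ : ℝ → ℂ) :
    mom n (fun ξ => c * φ ξ) = c * mom n φ := by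
  rw [mom, mom, ← intervalIntegral.integral_const_mul]
  simp only [mul_assoc]

/-- The Legendre coefficients of a polynomial. -/
def lcoef (p : ℂ[X]) (i : ℕ) : ℂ := mom i (pf p) / nrm i

lemma lcoef_add (p q : ℂ[X]) (i : ℕ) : lcoef (p + q) i = lcoef p i + lcoef q i := by
  rw [lcoef, lcoef, lcoef, ← add_div, ← mom_add (continuous_pf _) (continuous_pf _)]
  congr 2
  ext ξ
  simp

lemma lcoef_C_mul (c : ℂ) (p : ℂ[X]) (i : ℕ) : lcoef (C c * p) i = c * lcoef p i := by
  rw [lcoef, lcoef, mul_div_assoc', ← mom_const_mul]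
  congr 2
  ext ξ
  simp

lemma lcoef_leg (m n : ℕ) : lcoef (leg m) n = if m = n then 1 else 0 := by
  have := (nrm_pos n).ne'
  split_ifs with h
  · subst h
    rw [lcoef, mom_leg, div_self (by exact_mod_cast this)]
  · rw [lcoef, mom_leg_of_ne h, zero_div]

/-- Legendre expansion. -/
lemma eq_sum_leg {k : ℕ} {p : ℂ[X]} (hp : p.natDegree ≤ k) :
    p = ∑ i ∈ Finset.range (k + 1), C (lcoef p i) * leg i := by
  -- Removing the leading term with a multiple of `leg (k + 1)` gives some expansion; orthogonality
  -- identifies its coefficients afterwards.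
  have key : ∃ c : ℕ → ℂ, p = ∑ i ∈ Finset.range (k + 1), C (c i) * leg i := by
    induction k generalizing p with
    | zero =>
      refine ⟨fun _ => p.coeff 0, ?_⟩
      have h1 : leg 0 = 1 := by simp [leg, shiftedLegendre]
      have := eq_C_of_natDegree_le_zero hp
      simpa [h1] using this
    | succ k ih =>
      have hl : (leg (k + 1)).leadingCoeff ≠ 0 := leadingCoeff_ne_zero.2 (leg_ne_zero _)
      set a := p.coeff (k + 1) / (leg (k + 1)).leadingCoeff with ha
      have hq : (p - C a * leg (k + 1)).natDegree ≤ k := by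
        refine natDegree_le_iff_coeff_eq_zero.2 fun n hn => ?_
        rcases (Nat.succ_le_of_lt hn).eq_or_lt with h | h
        · subst h
          have : (leg (k + 1)).coeff (k + 1) = (leg (k + 1)).leadingCoeff := by
            rw [leadingCoeff, natDegree_leg]
          rw [coeff_sub, coeff_C_mul, Nat.succ_eq_add_one, this, ha, div_mul_cancel₀ _ hl, sub_self]
        · rw [coeff_sub, coeff_C_mul, coeff_eq_zero_of_natDegree_lt (p := p) (by omega),
            coeff_eq_zero_of_natDegree_lt (by rw [natDegree_leg]; omega)]
          simp
      obtain ⟨c, hc⟩ := ih hq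
      refine ⟨fun i => if i = k + 1 then a else c i, ?_⟩
      dsimp only
      rw [Finset.sum_range_succ, if_pos rfl, ← sub_eq_iff_eq_add, hc]
      refine Finset.sum_congr rfl fun i hi => ?_
      rw [if_neg (Finset.mem_range.1 hi).ne]
  obtain ⟨c, hc⟩ := key
  have hcoef : ∀ n ∈ Finset.range (k + 1), lcoef p n = c n := by
    intro n hn
    let L : ℂ[X] →ₗ[ℂ] ℂ :=
      { toFun := fun q => lcoef q n
        map_add' := fun q r => lcoef_add q r n
        map_smul' := fun a q => by rw [smul_eq_C_mul, lcoef_C_mul]; rfl }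
    have h1 : lcoef p n = L p := rfl
    rw [h1, hc, map_sum]
    have h2 : ∀ i, L (C (c i) * leg i) = c i * if i = n then 1 else 0 := by
      intro i
      rw [← lcoef_leg i n, ← lcoef_C_mul]
      rfl
    simp only [h2]
    simp
    intro h
    exact absurd (Finset.mem_range.1 hn) (by omega)
  nth_rewrite 1 [hc]
  exact Finset.sum_congr rfl fun i hi => by rw [hcoef i hi]

/-- Complex conjugation of the coefficients. -/
def cj (p : ℂ[X]) : ℂ[X] := p.map (starRingEnd ℂ)

lemma pf_cj (p : ℂ[X]) (ξ : ℝ) : pf (cj p) ξ = (starRingEnd ℂ) (pf p ξ) := by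
  have h := Polynomial.eval_map_apply (f := starRingEnd ℂ) (p := p) (ξ : ℂ)
  rw [Complex.conj_ofReal] at h
  exact h

lemma cj_cj (p : ℂ[X]) : cj (cj p) = p := by
  rw [cj, cj, Polynomial.map_map]
  simp

lemma natDegree_cj (p : ℂ[X]) : (cj p).natDegree = p.natDegree :=
  natDegree_map _

lemma derivative_cj (p : ℂ[X]) : derivative (cj p) = cj (derivative p) :=
  derivative_map p (starRingEnd ℂ)

lemma integral_conj' (φ : ℝ → ℂ) (a b : ℝ) :
    ∫ x in a..b, (starRingEnd ℂ) (φ x) = (starRingEnd ℂ) (∫ x in a..b, φ x) := by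
  rw [intervalIntegral, intervalIntegral, integral_conj, integral_conj, map_sub]

lemma lcoef_cj (p : ℂ[X]) (i : ℕ) : lcoef (cj p) i = (starRingEnd ℂ) (lcoef p i) := by
  rw [lcoef, lcoef, map_div₀, Complex.conj_ofReal, mom, mom, ← integral_conj']
  congr 2
  ext ξ
  rw [map_mul, pf_cj, pf_leg, Complex.conj_ofReal]

/-- Bilinear Parseval identity on the reference cell. -/
lemma integral_pf_mul_pf {k : ℕ} {p q : ℂ[X]} (hp : p.natDegree ≤ k) :
    ∫ ξ in (0 : ℝ)..1, pf p ξ * pf q ξ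
      = ∑ i ∈ Finset.range (k + 1), (nrm i : ℂ) * lcoef p i * lcoef q i := by
  have h : ∀ ξ, pf p ξ * pf q ξ
      = ∑ i ∈ Finset.range (k + 1), lcoef p i * (pf q ξ * pf (leg i) ξ) := by
    intro ξ
    conv_lhs => rw [eq_sum_leg hp]
    rw [pf_sum, Finset.sum_mul]
    refine Finset.sum_congr rfl fun i _ => ?_
    rw [pf_mul, pf_C]
    ring
  simp only [h]
  rw [intervalIntegral.integral_finsetSum]
  · refine Finset.sum_congr rfl fun i _ => ?_
    rw [intervalIntegral.integral_const_mul, lcoef, lcoef, mom, mom]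
    have := (nrm_pos i).ne'
    have h' : (nrm i : ℂ) ≠ 0 := by exact_mod_cast this
    field_simp
  · intro i _
    exact (continuous_const.mul ((continuous_pf _).mul (continuous_pf _))).intervalIntegrable _ _

lemma integral_norm_sq_pf {k : ℕ} {p : ℂ[X]} (hp : p.natDegree ≤ k) :
    ∫ ξ in (0 : ℝ)..1, ‖pf p ξ‖ ^ 2
      = ∑ i ∈ Finset.range (k + 1), nrm i * ‖lcoef p i‖ ^ 2 := by
  have h := integral_pf_mul_pf (q := cj p) hp
  simp only [pf_cj, lcoef_cj, mul_assoc, Complex.mul_conj, Complex.normSq_eq_norm_sq] at h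
  rw [intervalIntegral.integral_ofReal] at h
  exact_mod_cast h

/-- Polynomials have polynomial antiderivatives. -/
lemma exists_derivative_eq (q : ℂ[X]) :
    ∃ S : ℂ[X], derivative S = q ∧ S.natDegree ≤ q.natDegree + 1 := by
  refine ⟨∑ i ∈ Finset.range (q.natDegree + 1), C (q.coeff i / (i + 1)) * X ^ (i + 1), ?_, ?_⟩
  · conv_rhs => rw [q.as_sum_range_C_mul_X_pow]
    rw [derivative_sum]
    refine Finset.sum_congr rfl fun i _ => ?_
    have : (i : ℂ) + 1 ≠ 0 := by exact_mod_cast Nat.succ_ne_zero i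
    rw [derivative_C_mul_X_pow]
    push_cast
    rw [div_mul_cancel₀ _ this]
  · refine natDegree_sum_le_of_forall_le _ _ fun i hi => ?_
    have := Finset.mem_range.1 hi
    exact (natDegree_C_mul_X_pow_le _ _).trans (by omega)

lemma exists_derivative_derivative_eq (p : ℂ[X]) :
    ∃ S : ℂ[X], derivative (derivative S) = p ∧ S.natDegree ≤ p.natDegree + 2 := by
  obtain ⟨S₁, h₁, d₁⟩ := exists_derivative_eq p
  obtain ⟨S₂, h₂, d₂⟩ := exists_derivative_eq S₁
  exact ⟨S₂, by rw [h₂, h₁], by omega⟩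

/-- End point values of the Legendre polynomials. -/
lemma pf_leg_zero (n : ℕ) : pf (leg n) 0 = 1 := by
  rw [pf, Complex.ofReal_zero, ← coeff_zero_eq_eval_zero, leg, coeff_map, coeff_shiftedLegendre]
  simp

/-- Reflection in the midpoint of the cell; it carries end point values from 0 to 1. -/
lemma leg_comp (n : ℕ) : leg n = (-1) ^ n * (leg n).comp (1 - X) := by
  have h := congrArg (Polynomial.map (Int.castRingHom ℂ))
    (neg_one_pow_mul_shiftedLegendre_comp_one_sub_X_eq n)
  simp only [Polynomial.map_mul, Polynomial.map_pow, Polynomial.map_comp, Polynomial.map_neg,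
    Polynomial.map_one, Polynomial.map_sub, Polynomial.map_X] at h
  exact h.symm

lemma pf_leg_one (n : ℕ) : pf (leg n) 1 = (-1) ^ n := by
  rw [leg_comp]
  have := pf_leg_zero n
  simp only [pf, Complex.ofReal_zero] at this
  simp [pf, eval_comp, this]

lemma pf_derivative_leg_zero (n : ℕ) : pf (derivative (leg n)) 0 = -(n * (n + 1)) := by
  rw [pf, Complex.ofReal_zero, ← coeff_zero_eq_eval_zero, coeff_derivative, leg, coeff_map,
    coeff_shiftedLegendre]
  rw [Nat.choose_symm_add]
  simp

lemma pf_derivative_leg_one (n : ℕ) : pf (derivative (leg n)) 1 = (-1) ^ n * (n * (n + 1)) := by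
  have := pf_derivative_leg_zero n
  simp only [pf, Complex.ofReal_zero] at this
  rw [leg_comp, derivative_mul, derivative_comp]
  have h0 : derivative ((-1 : ℂ[X]) ^ n) = 0 := by
    rw [show (-1 : ℂ[X]) ^ n = C ((-1) ^ n) by simp, derivative_C]
  simp [pf, eval_comp, this, h0]

/-! ### Dimensionless fluxes and bounds on repeated differences between cells. -/

variable {ι : Type}

/-- Dimensionless form of the flux `v̂` for a family of functions on the reference cell, `ρ j` being
the ratio of the mesh size to the length of the cell `j` and `s j` the cell following `j`. -/
def fl1 (F : Flux) (ρ : ι → ℝ) (s : ι → ι) (φ : ι → ℝ → ℂ) (j : ι) : ℂ :=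
  (1 / 2 + F.α₁) * φ j 1 - F.β₂ * (ρ j * deriv (φ j) 1)
    + (1 / 2 - F.α₁) * φ (s j) 0 + F.β₂ * (ρ (s j) * deriv (φ (s j)) 0)

/-- Dimensionless form of the flux for the derivative. -/
def fl2 (F : Flux) (ρ : ι → ℝ) (s : ι → ι) (φ : ι → ℝ → ℂ) (j : ι) : ℂ :=
  -F.β₁ * φ j 1 + (1 / 2 - F.α₁) * (ρ j * deriv (φ j) 1)
    + F.β₁ * φ (s j) 0 + (1 / 2 + F.α₁) * (ρ (s j) * deriv (φ (s j)) 0)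

/-- The coefficients may vary from cell to cell as long as they are constant along the coupling `s`,
because they then factor out of both traces. This is needed for powers of the cell length. -/
lemma fl1_add (F : Flux) (ρ : ι → ℝ) (s : ι → ι) {φ ψ : ι → ℝ → ℂ} (hφ : ∀ j, Differentiable ℝ (φ j))
    (hψ : ∀ j, Differentiable ℝ (ψ j)) (c d : ι → ℂ) (hc : ∀ j, c (s j) = c j)
    (hd : ∀ j, d (s j) = d j) (j : ι) :
    fl1 F ρ s (fun j ξ => c j * φ j ξ + d j * ψ j ξ) j
      = c j * fl1 F ρ s φ j + d j * fl1 F ρ s ψ j := by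
  have h : ∀ j x, deriv (fun ξ => c j * φ j ξ + d j * ψ j ξ) x
      = c j * deriv (φ j) x + d j * deriv (ψ j) x := fun j x =>
    (((hφ j x).hasDerivAt.const_mul (c j)).add ((hψ j x).hasDerivAt.const_mul (d j))).deriv
  simp only [fl1, h]
  simp only [hc, hd]
  ring

lemma fl2_add (F : Flux) (ρ : ι → ℝ) (s : ι → ι) {φ ψ : ι → ℝ → ℂ} (hφ : ∀ j, Differentiable ℝ (φ j))
    (hψ : ∀ j, Differentiable ℝ (ψ j)) (c d : ι → ℂ) (hc : ∀ j, c (s j) = c j)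
    (hd : ∀ j, d (s j) = d j) (j : ι) :
    fl2 F ρ s (fun j ξ => c j * φ j ξ + d j * ψ j ξ) j
      = c j * fl2 F ρ s φ j + d j * fl2 F ρ s ψ j := by
  have h : ∀ j x, deriv (fun ξ => c j * φ j ξ + d j * ψ j ξ) x
      = c j * deriv (φ j) x + d j * deriv (ψ j) x := fun j x =>
    (((hφ j x).hasDerivAt.const_mul (c j)).add ((hψ j x).hasDerivAt.const_mul (d j))).deriv
  simp only [fl2, h]
  simp only [hc, hd]
  ring

lemma differentiable_pf (p : ℂ[X]) : Differentiable ℝ (pf p) := fun x =>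
  (hasDerivAt_pf p x).differentiableAt

/-- `φ` is bounded by `R` and its differences along `π` up to order `l` by `R`, `h R`, `h² R`, …. -/
def Bd (π : ι → ι) (h : ℝ) : ℕ → ℝ → (ι → ℂ) → Prop
  | 0, R, φ => ∀ j, ‖φ j‖ ≤ R
  | l + 1, R, φ => (∀ j, ‖φ j‖ ≤ R) ∧ Bd π h l (h * R) (fun j => φ (π j) - φ j)

section Bd

variable {π : ι → ι} {h : ℝ} {l : ℕ} {R R' : ℝ} {φ ψ : ι → ℂ}

lemma Bd.norm_le (H : Bd π h l R φ) (j : ι) : ‖φ j‖ ≤ R := by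
  cases l with
  | zero => exact H j
  | succ l => exact H.1 j

lemma Bd.mono (h0 : 0 ≤ h) (H : Bd π h l R φ) (hR : R ≤ R') : Bd π h l R' φ := by
  induction l generalizing R R' φ with
  | zero => exact fun j => (H j).trans hR
  | succ l ih => exact ⟨fun j => (H.1 j).trans hR, ih H.2 (mul_le_mul_of_nonneg_left hR h0)⟩

lemma Bd.of_le {l' : ℕ} (hl : l' ≤ l) (H : Bd π h l R φ) : Bd π h l' R φ := by
  induction l' generalizing R φ l with
  | zero => exact H.norm_le
  | succ l' ih =>
    obtain ⟨m, rfl⟩ : ∃ m, l = m + 1 := ⟨l - 1, by omega⟩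
    exact ⟨H.1, ih (by omega) H.2⟩

lemma Bd.add (H : Bd π h l R φ) (H' : Bd π h l R' ψ) : Bd π h l (R + R') (fun j => φ j + ψ j) := by
  induction l generalizing R R' φ ψ with
  | zero => exact fun j => (norm_add_le _ _).trans (add_le_add (H j) (H' j))
  | succ l ih =>
    refine ⟨fun j => (norm_add_le _ _).trans (add_le_add (H.1 j) (H'.1 j)), ?_⟩
    have := ih H.2 H'.2
    rw [mul_add]
    convert this using 2 with j
    ring

/-- Invariance of `c` under `π` removes the second term of the discrete product rule, so no
differences of `c` occur. -/
lemma Bd.mul {c : ι → ℂ} {K : ℝ} (hc : ∀ j, ‖c j‖ ≤ K) (hπ : ∀ j, c (π j) = c j)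
    (H : Bd π h l R φ) : Bd π h l (K * R) (fun j => c j * φ j) := by
  induction l generalizing R φ with
  | zero =>
    intro j
    rw [norm_mul]
    exact mul_le_mul (hc j) (H j) (norm_nonneg _) ((norm_nonneg _).trans (hc j))
  | succ l ih =>
    refine ⟨fun j => ?_, ?_⟩
    · rw [norm_mul]
      exact mul_le_mul (hc j) (H.1 j) (norm_nonneg _) ((norm_nonneg _).trans (hc j))
    · have := ih H.2
      rw [mul_left_comm]
      convert this using 2 with j
      dsimp only
      rw [hπ]
      ring

lemma Bd.const_mul {c : ℂ} {K : ℝ} (hc : ‖c‖ ≤ K) (H : Bd π h l R φ) :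
    Bd π h l (K * R) (fun j => c * φ j) := H.mul (fun _ => hc) fun _ => rfl

lemma Bd.neg (H : Bd π h l R φ) : Bd π h l R (fun j => -φ j) := by
  have := H.const_mul (c := -1) (K := 1) (by simp)
  simpa using this

lemma Bd.sub (H : Bd π h l R φ) (H' : Bd π h l R' ψ) : Bd π h l (R + R') (fun j => φ j - ψ j) := by
  simpa only [sub_eq_add_neg] using H.add H'.neg

lemma Bd.comp {s : ι → ι} (hs : ∀ j, π (s j) = s (π j)) (H : Bd π h l R φ) :
    Bd π h l R (fun j => φ (s j)) := by
  induction l generalizing R φ with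
  | zero => exact fun j => H (s j)
  | succ l ih =>
    refine ⟨fun j => H.1 (s j), ?_⟩
    have := ih H.2
    simpa only [hs] using this

lemma Bd.zero (h0 : 0 ≤ h) (hR : 0 ≤ R) : Bd π h l R (fun _ => 0) := by
  induction l generalizing R with
  | zero => exact fun j => by simpa using hR
  | succ l ih => exact ⟨fun j => by simpa using hR, by simpa using ih (mul_nonneg h0 hR)⟩

lemma Bd.sum (h0 : 0 ≤ h) (n : ℕ) {Φ : ℕ → ι → ℂ} (H : ∀ i < n, Bd π h l R (Φ i)) :
    Bd π h l (n * R) (fun j => ∑ i ∈ Finset.range n, Φ i j) := by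
  induction n with
  | zero => simpa using Bd.zero h0 le_rfl
  | succ n ih =>
    have := (ih fun i hi => H i (by omega)).add (H n (by omega))
    simp only [Finset.sum_range_succ]
    push_cast
    rwa [add_mul, one_mul]

lemma Bd.integral {Φ : ι → ℝ → ℂ} (hc : ∀ j, Continuous (Φ j)) {q : ℝ → ℂ} (hq : Continuous q)
    {K : ℝ} (hK : ∀ ξ ∈ Set.Icc (0 : ℝ) 1, ‖q ξ‖ ≤ K)
    (H : ∀ ξ ∈ Set.Icc (0 : ℝ) 1, Bd π h l R (fun j => Φ j ξ)) :
    Bd π h l (K * R) (fun j => ∫ ξ in (0 : ℝ)..1, Φ j ξ * q ξ) := by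
  have key : ∀ {R : ℝ} {Φ : ι → ℝ → ℂ}, (∀ ξ ∈ Set.Icc (0 : ℝ) 1, ∀ j, ‖Φ j ξ‖ ≤ R) → ∀ j,
      ‖∫ ξ in (0 : ℝ)..1, Φ j ξ * q ξ‖ ≤ K * R := by
    intro R Φ H j
    have := intervalIntegral.norm_integral_le_of_norm_le_const (a := (0 : ℝ)) (b := 1)
      (f := fun ξ => Φ j ξ * q ξ) (C := K * R) (fun ξ hξ => by
        rw [Set.uIoc_of_le zero_le_one] at hξ
        have hξ' : ξ ∈ Set.Icc (0 : ℝ) 1 := ⟨hξ.1.le, hξ.2⟩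
        rw [norm_mul, mul_comm]
        exact mul_le_mul (hK ξ hξ') (H ξ hξ' j) (norm_nonneg _)
          ((norm_nonneg _).trans (hK ξ hξ')))
    simpa using this
  induction l generalizing R Φ with
  | zero => exact key H
  | succ l ih =>
    refine ⟨key fun ξ hξ => (H ξ hξ).1, ?_⟩
    have := ih (fun j => (hc (π j)).sub (hc j)) (fun ξ hξ => (H ξ hξ).2)
    rw [mul_left_comm]
    convert this using 2 with j
    rw [← intervalIntegral.integral_sub]
    · simp [sub_mul]
    · exact ((hc _).mul hq).intervalIntegrable _ _
    · exact ((hc _).mul hq).intervalIntegrable _ _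

end Bd

/-- The index map `π` is a symmetry of the scheme. -/
structure Compat (π s : ι → ι) (ρ : ι → ℝ) : Prop where
  comm : ∀ j, π (s j) = s (π j)
  ratio : ∀ j, ρ (π j) = ρ j

/-- A constant for the flux operators. -/
def fluxK (F : Flux) (σ : ℝ) : ℝ := 4 * ((1 + |F.α₁| + |F.β₁| + |F.β₂|) * (1 + σ))

lemma fluxK_nonneg (F : Flux) {σ : ℝ} (hσ : 0 ≤ σ) : 0 ≤ fluxK F σ := by
  unfold fluxK; positivity

lemma norm_flux_coef_le (F : Flux) :
    ‖(1 / 2 + F.α₁ : ℂ)‖ ≤ 1 + |F.α₁| + |F.β₁| + |F.β₂| ∧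
    ‖(1 / 2 - F.α₁ : ℂ)‖ ≤ 1 + |F.α₁| + |F.β₁| + |F.β₂| ∧
    ‖(F.β₁ : ℂ)‖ ≤ 1 + |F.α₁| + |F.β₁| + |F.β₂| ∧
    ‖(F.β₂ : ℂ)‖ ≤ 1 + |F.α₁| + |F.β₁| + |F.β₂| := by
  set A := 1 + |F.α₁| + |F.β₁| + |F.β₂| with hA
  have e1 := abs_nonneg F.α₁
  have e2 := abs_nonneg F.β₁
  have e3 := abs_nonneg F.β₂
  have n1 : ‖(1 / 2 + F.α₁ : ℂ)‖ ≤ A := by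
    have : (1 / 2 + F.α₁ : ℂ) = ((1 / 2 + F.α₁ : ℝ) : ℂ) := by push_cast; ring
    rw [this, Complex.norm_real, Real.norm_eq_abs]
    refine (abs_add_le _ _).trans ?_
    rw [abs_of_pos (by norm_num : (0 : ℝ) < 1 / 2)]
    linarith
  have n2 : ‖(1 / 2 - F.α₁ : ℂ)‖ ≤ A := by
    have : (1 / 2 - F.α₁ : ℂ) = ((1 / 2 - F.α₁ : ℝ) : ℂ) := by push_cast; ring
    rw [this, Complex.norm_real, Real.norm_eq_abs]
    refine (abs_sub _ _).trans ?_
    rw [abs_of_pos (by norm_num : (0 : ℝ) < 1 / 2)]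
    linarith
  have n3 : ‖(F.β₁ : ℂ)‖ ≤ A := by
    rw [Complex.norm_real, Real.norm_eq_abs]
    linarith
  have n4 : ‖(F.β₂ : ℂ)‖ ≤ A := by
    rw [Complex.norm_real, Real.norm_eq_abs]
    linarith
  exact ⟨n1, n2, n3, n4⟩

lemma Bd.flux {F : Flux} {ρ : ι → ℝ} {π s : ι → ι} {σ h R : ℝ} {l : ℕ} {φ : ι → ℝ → ℂ}
    (hσ : 0 ≤ σ) (hρ : ∀ j, |ρ j| ≤ σ) (hπ : Compat π s ρ) (h0 : 0 ≤ h) (hR : 0 ≤ R)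
    (a1 : Bd π h l R fun j => φ j 1) (a2 : Bd π h l R fun j => deriv (φ j) 1)
    (a3 : Bd π h l R fun j => φ j 0) (a4 : Bd π h l R fun j => deriv (φ j) 0) :
    Bd π h l (fluxK F σ * R) (fl1 F ρ s φ) ∧ Bd π h l (fluxK F σ * R) (fl2 F ρ s φ) := by
  set A := 1 + |F.α₁| + |F.β₁| + |F.β₂| with hA
  have hA0 : 0 ≤ A := by positivity
  obtain ⟨n1, n2, n3, n4⟩ := norm_flux_coef_le F
  have n3' : ‖(-F.β₁ : ℂ)‖ ≤ A := by rwa [norm_neg]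
  have hρ' : ∀ j, ‖(ρ j : ℂ)‖ ≤ 1 + σ := fun j => by
    rw [Complex.norm_real, Real.norm_eq_abs]
    linarith [hρ j]
  have hρπ : ∀ j, (ρ (π j) : ℂ) = ρ j := fun j => by rw [hπ.ratio]
  have b2 := a2.mul hρ' hρπ
  have b4 := a4.mul hρ' hρπ
  have le1 : A * R ≤ A * ((1 + σ) * R) :=
    mul_le_mul_of_nonneg_left (le_mul_of_one_le_left hR (by linarith)) hA0
  have tot : fluxK F σ * R = A * ((1 + σ) * R) + A * ((1 + σ) * R) + A * ((1 + σ) * R)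
      + A * ((1 + σ) * R) := by
    rw [fluxK, ← hA]; ring
  rw [tot]
  constructor
  · exact ((((a1.const_mul n1).mono h0 le1).sub (b2.const_mul n4)).add
      (((a3.comp hπ.comm).const_mul n2).mono h0 le1)).add ((b4.comp hπ.comm).const_mul n4)
  · exact ((((a1.const_mul n3').mono h0 le1).add (b2.const_mul n2)).add
      (((a3.comp hπ.comm).const_mul n3).mono h0 le1)).add ((b4.comp hπ.comm).const_mul n1)

/-! ### Stability of the two highest modes and unique solvability. -/

/-- The two highest Legendre modes with coefficients `x`, `y`. -/
def topMode (k : ℕ) (x y : ι → ℂ) (j : ι) : ℝ → ℂ :=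
  pf (C (x j) * leg (k - 1) + C (y j) * leg k)

/-- The two highest modes are controlled by their fluxes, at the cost of `p` differences. -/
def Stable (k : ℕ) (F : Flux) (ρ : ι → ℝ) (s π : ι → ι) (h : ℝ) (p : ℕ) (K : ℝ) : Prop :=
  ∀ (x y : ι → ℂ) (R : ℝ), Bd π h p R (fl1 F ρ s (topMode k x y)) →
    Bd π h p R (fl2 F ρ s (topMode k x y)) → ∀ j, ‖x j‖ ≤ K * R ∧ ‖y j‖ ≤ K * R

/-- Because `π` commutes with the coupling and preserves the length ratios, differencing along `π`
commutes with the flux operators. -/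
lemma flux_topMode_diff {F : Flux} {ρ : ι → ℝ} {s π : ι → ι} (hπ : Compat π s ρ) (k : ℕ)
    (x y : ι → ℂ) (j : ι) :
    fl1 F ρ s (topMode k (fun j => x (π j) - x j) fun j => y (π j) - y j) j
      = fl1 F ρ s (topMode k x y) (π j) - fl1 F ρ s (topMode k x y) j ∧
    fl2 F ρ s (topMode k (fun j => x (π j) - x j) fun j => y (π j) - y j) j
      = fl2 F ρ s (topMode k x y) (π j) - fl2 F ρ s (topMode k x y) j := by
  constructor
  · simp only [fl1, topMode, deriv_pf, hπ.ratio, ← hπ.comm]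
    simp
    ring
  · simp only [fl2, topMode, deriv_pf, hπ.ratio, ← hπ.comm]
    simp
    ring

/-- Differenced modes solve the same flux equations with differenced data, so stability applies to
them again. Of the `p + e` differences available for the data, `p` are spent on stability and `e`
survive for the modes. -/
lemma Stable.bd {k : ℕ} {F : Flux} {ρ : ι → ℝ} {s π : ι → ι} {h : ℝ} {p : ℕ} {K : ℝ}
    (hS : Stable k F ρ s π h p K) (hπ : Compat π s ρ) (e : ℕ) {x y : ι → ℂ} {R : ℝ}
    (H1 : Bd π h (p + e) R (fl1 F ρ s (topMode k x y)))
    (H2 : Bd π h (p + e) R (fl2 F ρ s (topMode k x y))) :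
    Bd π h e (K * R) x ∧ Bd π h e (K * R) y := by
  induction e generalizing x y R with
  | zero => exact ⟨fun j => (hS x y R H1 H2 j).1, fun j => (hS x y R H1 H2 j).2⟩
  | succ e ih =>
    have hb := hS x y R (H1.of_le (by omega)) (H2.of_le (by omega))
    have key := ih (x := fun j => x (π j) - x j) (y := fun j => y (π j) - y j) (R := h * R)
      (by
        have := H1.2
        rwa [← funext fun j => (flux_topMode_diff hπ k x y j).1] at this)
      (by
        have := H2.2
        rwa [← funext fun j => (flux_topMode_diff hπ k x y j).2] at this)
    rw [mul_left_comm] at key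
    exact ⟨⟨fun j => (hb j).1, key.1⟩, ⟨fun j => (hb j).2, key.2⟩⟩

/-- Common bounds for finitely many Legendre polynomials. -/
lemma exists_leg_bound (k : ℕ) : ∃ B : ℝ, 1 ≤ B ∧ (∀ i ≤ k, ∀ ξ ∈ Set.Icc (0 : ℝ) 1,
    ‖pf (leg i) ξ‖ ≤ B ∧ ‖pf (derivative (leg i)) ξ‖ ≤ B) ∧ ∀ i ≤ k, (nrm i)⁻¹ ≤ B := by
  have one : ∀ i, ∃ B : ℝ, 1 ≤ B ∧ (∀ ξ ∈ Set.Icc (0 : ℝ) 1,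
      ‖pf (leg i) ξ‖ ≤ B ∧ ‖pf (derivative (leg i)) ξ‖ ≤ B) ∧ (nrm i)⁻¹ ≤ B := by
    intro i
    obtain ⟨B1, h1⟩ := isCompact_Icc.exists_bound_of_continuousOn (s := Set.Icc (0 : ℝ) 1)
      (continuous_pf (leg i)).continuousOn
    obtain ⟨B2, h2⟩ := isCompact_Icc.exists_bound_of_continuousOn (s := Set.Icc (0 : ℝ) 1)
      (continuous_pf (derivative (leg i))).continuousOn
    refine ⟨max 1 (max (max B1 B2) (nrm i)⁻¹), le_max_left _ _, fun ξ hξ => ⟨?_, ?_⟩, ?_⟩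
    · exact (h1 ξ hξ).trans (by simp)
    · exact (h2 ξ hξ).trans (by simp)
    · simp
  choose B hB1 hB2 hB3 using one
  have hle : ∀ i ≤ k, B i ≤ ∑ i ∈ Finset.range (k + 1), B i := fun i hi =>
    Finset.single_le_sum (f := B) (fun i _ => zero_le_one.trans (hB1 i))
      (Finset.mem_range.2 (by omega))
  exact ⟨∑ i ∈ Finset.range (k + 1), B i, (hB1 0).trans (hle 0 (by omega)), fun i hi ξ hξ =>
    ⟨(hB2 i ξ hξ).1.trans (hle i hi), (hB2 i ξ hξ).2.trans (hle i hi)⟩,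
    fun i hi => (hB3 i).trans (hle i hi)⟩

/-- A piecewise polynomial is controlled by its moments of order `< k - 1` and its fluxes. -/
lemma exists_solve_bound {k : ℕ} (hk : 2 ≤ k) (F : Flux) {σ : ℝ} (hσ : 0 ≤ σ) {K : ℝ}
    (hK : 0 ≤ K) :
    ∃ K' : ℝ, 0 ≤ K' ∧ ∀ {ι : Type} (ρ : ι → ℝ) (s π : ι → ι) (h : ℝ) (p e : ℕ), 0 ≤ h →
      (∀ j, |ρ j| ≤ σ) → Compat π s ρ → Stable k F ρ s π h p K →
      ∀ (P : ι → ℂ[X]) (R : ℝ), 0 ≤ R → (∀ j, (P j).natDegree ≤ k) →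
        (∀ i < k - 1, Bd π h (p + e) R fun j => mom i (pf (P j))) →
        Bd π h (p + e) R (fl1 F ρ s fun j => pf (P j)) →
        Bd π h (p + e) R (fl2 F ρ s fun j => pf (P j)) →
        ∀ ξ ∈ Set.Icc (0 : ℝ) 1, Bd π h e (K' * R) fun j => pf (P j) ξ := by
  obtain ⟨B, hB1, hB, hBn⟩ := exists_leg_bound k
  have hB0 : 0 ≤ B := zero_le_one.trans hB1
  set Q : ℝ := (k - 1 : ℕ) * (B * B) with hQ
  have hQ0 : 0 ≤ Q := by positivity
  set Z : ℝ := K * (1 + fluxK F σ * Q) with hZ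
  have hf := fluxK_nonneg F hσ
  have hZ0 : 0 ≤ Z := by positivity
  refine ⟨Q + B * Z + B * Z, by positivity, ?_⟩
  intro ι ρ s π h p e h0 hρ hπ hS P R hR hdeg hmom hf1 hf2 ξ hξ
  -- The moments control the modes below k - 1. The fluxes of the top modes are then the given
  -- fluxes minus those of the low part, and stability bounds the top coefficients.
  set low : ι → ℂ[X] := fun j => ∑ i ∈ Finset.range (k - 1), C (lcoef (P j) i) * leg i with hlow
  set x : ι → ℂ := fun j => lcoef (P j) (k - 1) with hx
  set y : ι → ℂ := fun j => lcoef (P j) k with hy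
  have hP : ∀ j, P j = low j + (C (x j) * leg (k - 1) + C (y j) * leg k) := by
    intro j
    conv_lhs => rw [eq_sum_leg (hdeg j)]
    obtain ⟨m, rfl⟩ : ∃ m, k = m + 2 := ⟨k - 2, by omega⟩
    rw [Finset.sum_range_succ, Finset.sum_range_succ, add_assoc]
    rfl
  have hcoef : ∀ i < k - 1, Bd π h (p + e) (B * R) fun j => lcoef (P j) i := by
    intro i hi
    have h1 : ‖((nrm i : ℂ))⁻¹‖ ≤ B := by
      rw [norm_inv, Complex.norm_real, Real.norm_of_nonneg (nrm_pos i).le]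
      exact hBn i (by omega)
    have := (hmom i hi).const_mul h1
    simpa only [lcoef, div_eq_inv_mul] using this
  have hlowpt : ∀ D : ℕ → ℂ, (∀ i ≤ k, ‖D i‖ ≤ B) → Bd π h (p + e) (Q * R)
      fun j => ∑ i ∈ Finset.range (k - 1), D i * lcoef (P j) i := by
    intro D hD
    have := Bd.sum h0 (R := B * (B * R)) (k - 1)
      (Φ := fun i j => D i * lcoef (P j) i)
      (fun i hi => (hcoef i hi).const_mul (hD i (by omega)))
    rw [hQ]
    convert this using 1
    ring
  have hlowval : ∀ t ∈ Set.Icc (0 : ℝ) 1, Bd π h (p + e) (Q * R) (fun j => pf (low j) t) := by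
    intro t ht
    have := hlowpt (fun i => pf (leg i) t) (fun i hi => (hB i hi t ht).1)
    simpa only [hlow, pf_sum, pf_mul, pf_C, mul_comm] using this
  have hlowder : ∀ t ∈ Set.Icc (0 : ℝ) 1,
      Bd π h (p + e) (Q * R) (fun j => deriv (pf (low j)) t) := by
    intro t ht
    have := hlowpt (fun i => pf (derivative (leg i)) t) (fun i hi => (hB i hi t ht).2)
    have e1 : ∀ j, deriv (pf (low j)) t
        = ∑ i ∈ Finset.range (k - 1), pf (derivative (leg i)) t * lcoef (P j) i := by
      intro j
      simp only [hlow, deriv_pf, derivative_sum, derivative_C_mul, pf_sum, pf_mul, pf_C]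
      exact Finset.sum_congr rfl fun i _ => mul_comm _ _
    simpa only [e1] using this
  have m0 : (0 : ℝ) ∈ Set.Icc (0 : ℝ) 1 := by simp
  have m1 : (1 : ℝ) ∈ Set.Icc (0 : ℝ) 1 := by simp
  obtain ⟨l1, l2⟩ := Bd.flux (F := F) (φ := fun j => pf (low j)) hσ hρ hπ h0
    (by positivity : 0 ≤ Q * R) (hlowval 1 m1) (hlowder 1 m1) (hlowval 0 m0) (hlowder 0 m0)
  have t1 : fl1 F ρ s (topMode k x y)
      = fun j => fl1 F ρ s (fun j => pf (P j)) j - fl1 F ρ s (fun j => pf (low j)) j := by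
    funext j
    simp only [fl1, topMode, deriv_pf, hP]
    simp
    ring
  have t2 : fl2 F ρ s (topMode k x y)
      = fun j => fl2 F ρ s (fun j => pf (P j)) j - fl2 F ρ s (fun j => pf (low j)) j := by
    funext j
    simp only [fl2, topMode, deriv_pf, hP]
    simp
    ring
  have htop := hS.bd hπ e (x := x) (y := y) (R := R + fluxK F σ * (Q * R))
    (by rw [t1]; exact hf1.sub l1) (by rw [t2]; exact hf2.sub l2)
  have hZR : K * (R + fluxK F σ * (Q * R)) = Z * R := by rw [hZ]; ring
  rw [hZR] at htop
  have := (((hlowval ξ hξ).of_le (Nat.le_add_left e p)).add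
    (htop.1.const_mul (hB (k - 1) (by omega) ξ hξ).1)).add
    (htop.2.const_mul (hB k le_rfl ξ hξ).1)
  have e1 : (Q + B * Z + B * Z) * R = Q * R + B * (Z * R) + B * (Z * R) := by ring
  rw [e1]
  convert this using 2 with j
  rw [hP]
  simp
  ring

/-- The fluxes of the two highest modes as a linear operator. -/
def topFluxL (k : ℕ) (F : Flux) (ρ : ι → ℝ) (s : ι → ι) :
    ((ι → ℂ) × (ι → ℂ)) →ₗ[ℂ] ((ι → ℂ) × (ι → ℂ)) where
  toFun := fun v => (fl1 F ρ s (topMode k v.1 v.2), fl2 F ρ s (topMode k v.1 v.2))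
  map_add' := by
    intro v w
    ext j
    · change fl1 F ρ s (topMode k (v.1 + w.1) (v.2 + w.2)) j
        = fl1 F ρ s (topMode k v.1 v.2) j + fl1 F ρ s (topMode k w.1 w.2) j
      simp only [fl1, topMode, deriv_pf]
      simp
      ring
    · change fl2 F ρ s (topMode k (v.1 + w.1) (v.2 + w.2)) j
        = fl2 F ρ s (topMode k v.1 v.2) j + fl2 F ρ s (topMode k w.1 w.2) j
      simp only [fl2, topMode, deriv_pf]
      simp
      ring
  map_smul' := by
    intro c v
    ext j
    · change fl1 F ρ s (topMode k (c • v.1) (c • v.2)) j = c * fl1 F ρ s (topMode k v.1 v.2) j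
      simp only [fl1, topMode, deriv_pf]
      simp
      ring
    · change fl2 F ρ s (topMode k (c • v.1) (c • v.2)) j = c * fl2 F ρ s (topMode k v.1 v.2) j
      simp only [fl2, topMode, deriv_pf]
      simp
      ring

/-- Stability with zero data and R = 0 leaves only the zero modes. -/
lemma Stable.injective {k : ℕ} {F : Flux} {ρ : ι → ℝ} {s π : ι → ι} {h : ℝ} {p : ℕ} {K : ℝ}
    (h0 : 0 ≤ h) (hS : Stable k F ρ s π h p K) : Function.Injective (topFluxL k F ρ s) := by
  rw [← LinearMap.ker_eq_bot, LinearMap.ker_eq_bot']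
  intro v hv
  have h1 : fl1 F ρ s (topMode k v.1 v.2) = fun _ => 0 := congrArg Prod.fst hv
  have h2 : fl2 F ρ s (topMode k v.1 v.2) = fun _ => 0 := congrArg Prod.snd hv
  have := hS v.1 v.2 0 (by rw [h1]; exact Bd.zero h0 le_rfl) (by rw [h2]; exact Bd.zero h0 le_rfl)
  ext j
  · simpa using (this j).1
  · simpa using (this j).2

/-- On a fixed finite family no differences are needed. -/
lemma Stable.exists_zero [Finite ι] {k : ℕ} {F : Flux} {ρ : ι → ℝ} {s π : ι → ι} {h : ℝ} {p : ℕ}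
    {K : ℝ} (h0 : 0 ≤ h) (hS : Stable k F ρ s π h p K) :
    ∃ K' : ℝ, 0 ≤ K' ∧ Stable k F ρ s id 1 0 K' := by
  have := Fintype.ofFinite ι
  -- An injective linear map on a finite dimensional space is bounded below. The constant depends on
  -- the family, so it can serve qualitative purposes only.
  obtain ⟨K', -, hK'⟩ := (topFluxL k F ρ s).exists_antilipschitzWith
    (LinearMap.ker_eq_bot.2 (hS.injective h0))
  refine ⟨K', K'.2, fun x y R h1 h2 j => ?_⟩
  have hR : 0 ≤ R := (norm_nonneg _).trans (h1 j)
  have e1 := hK'.le_mul_dist (x, y) 0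
  rw [map_zero, dist_zero_right, dist_zero_right] at e1
  have e2 : ‖topFluxL k F ρ s (x, y)‖ ≤ R :=
    max_le ((pi_norm_le_iff_of_nonneg hR).2 h1) ((pi_norm_le_iff_of_nonneg hR).2 h2)
  have e3 : ‖(x, y)‖ ≤ K' * R := e1.trans (mul_le_mul_of_nonneg_left e2 K'.2)
  exact ⟨(norm_le_pi_norm x j).trans ((le_max_left _ _).trans e3),
    (norm_le_pi_norm y j).trans ((le_max_right _ _).trans e3)⟩

/-- Unique solvability: moments of order `< k - 1` and fluxes can be prescribed. -/
lemma exists_solve [Finite ι] {k : ℕ} (hk : 2 ≤ k) {F : Flux} {ρ : ι → ℝ} {s π : ι → ι} {h : ℝ}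
    {p : ℕ} {K : ℝ} (h0 : 0 ≤ h) (hS : Stable k F ρ s π h p K) (ψ : ι → ℕ → ℂ) (r₁ r₂ : ι → ℂ) :
    ∃ P : ι → ℂ[X], (∀ j, (P j).natDegree ≤ k) ∧
      (∀ j, ∀ i < k - 1, mom i (pf (P j)) = ψ j i) ∧
      (∀ j, fl1 F ρ s (fun j => pf (P j)) j = r₁ j) ∧
      ∀ j, fl2 F ρ s (fun j => pf (P j)) j = r₂ j := by
  have hsurj : Function.Surjective (topFluxL k F ρ s) :=
    LinearMap.injective_iff_surjective.1 (hS.injective h0)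
  set low : ι → ℂ[X] := fun j => ∑ i ∈ Finset.range (k - 1), C (ψ j i / nrm i) * leg i with hlow
  obtain ⟨v, hv⟩ := hsurj (fun j => r₁ j - fl1 F ρ s (fun j => pf (low j)) j,
    fun j => r₂ j - fl2 F ρ s (fun j => pf (low j)) j)
  have h1 : ∀ j, fl1 F ρ s (topMode k v.1 v.2) j = r₁ j - fl1 F ρ s (fun j => pf (low j)) j :=
    fun j => congrFun (congrArg Prod.fst hv) j
  have h2 : ∀ j, fl2 F ρ s (topMode k v.1 v.2) j = r₂ j - fl2 F ρ s (fun j => pf (low j)) j :=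
    fun j => congrFun (congrArg Prod.snd hv) j
  refine ⟨fun j => low j + (C (v.1 j) * leg (k - 1) + C (v.2 j) * leg k), ?_, ?_, ?_, ?_⟩
  · intro j
    refine natDegree_add_le_of_degree_le (natDegree_sum_le_of_forall_le _ _ fun i hi => ?_)
      (natDegree_add_le_of_degree_le ?_ ?_)
    · have := Finset.mem_range.1 hi
      exact (natDegree_C_mul_le _ _).trans (by rw [natDegree_leg]; omega)
    · exact (natDegree_C_mul_le _ _).trans (by rw [natDegree_leg]; omega)
    · exact (natDegree_C_mul_le _ _).trans (by rw [natDegree_leg])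
  · intro j i hi
    let M : ℂ[X] →ₗ[ℂ] ℂ :=
      { toFun := fun q => lcoef q i
        map_add' := fun q r => lcoef_add q r i
        map_smul' := fun a q => by rw [smul_eq_C_mul, lcoef_C_mul]; rfl }
    have hM : ∀ c n, M (C c * leg n) = c * if n = i then 1 else 0 := by
      intro c n
      rw [← lcoef_leg n i, ← lcoef_C_mul]
      rfl
    have hn : (nrm i : ℂ) ≠ 0 := by exact_mod_cast (nrm_pos i).ne'
    have : M (low j + (C (v.1 j) * leg (k - 1) + C (v.2 j) * leg k)) = ψ j i / nrm i := by
      rw [map_add, map_add, hM, hM, hlow, map_sum]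
      simp only [hM]
      rw [if_neg (by omega), if_neg (by omega)]
      simp [hi]
    change mom i _ / (nrm i : ℂ) = _ at this
    rwa [div_left_inj' hn] at this
  · intro j
    have : fl1 F ρ s (fun j => pf (low j + (C (v.1 j) * leg (k - 1) + C (v.2 j) * leg k))) j
        = fl1 F ρ s (topMode k v.1 v.2) j + fl1 F ρ s (fun j => pf (low j)) j := by
      simp only [fl1, topMode, deriv_pf]
      simp
      ring
    rw [this, h1]
    ring
  · intro j
    have : fl2 F ρ s (fun j => pf (low j + (C (v.1 j) * leg (k - 1) + C (v.2 j) * leg k))) j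
        = fl2 F ρ s (topMode k v.1 v.2) j + fl2 F ρ s (fun j => pf (low j)) j := by
      simp only [fl2, topMode, deriv_pf]
      simp
      ring
    rw [this, h2]
    ring

/-! ### The corrections w_q on the reference cell. -/

variable {ι : Type}

lemma intervalIntegrable_mul_pf {φ : ℝ → ℂ} (hφ : Continuous φ) (v : ℂ[X]) (a b : ℝ) :
    IntervalIntegrable (fun ξ => φ ξ * pf v ξ) volume a b :=
  (hφ.mul (continuous_pf v)).intervalIntegrable _ _

/-- Integration against a continuous function as a functional on polynomials. -/
def intL (φ : ℝ → ℂ) (hφ : Continuous φ) : ℂ[X] →ₗ[ℂ] ℂ where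
  toFun v := ∫ ξ in (0 : ℝ)..1, φ ξ * pf v ξ
  map_add' v w := by
    rw [← intervalIntegral.integral_add (intervalIntegrable_mul_pf hφ v 0 1)
      (intervalIntegrable_mul_pf hφ w 0 1)]
    simp only [pf_add, mul_add]
  map_smul' c v := by
    rw [smul_eq_C_mul, RingHom.id_apply, smul_eq_mul, ← intervalIntegral.integral_const_mul]
    simp only [pf_mul, pf_C, mul_left_comm]

lemma natDegree_le_one_of_derivative {v : ℂ[X]} (h : derivative (derivative v) = 0) :
    v.natDegree ≤ 1 := by
  have h1 := derivative_eq_zero.1 h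
  have h2 : derivative (v - C ((derivative v).coeff 0) * X) = 0 := by
    rw [derivative_sub, derivative_C_mul, derivative_X, mul_one,
      ← eq_C_of_natDegree_eq_zero h1, sub_self]
  have h3 := derivative_eq_zero.1 h2
  have h4 : v = C ((v - C ((derivative v).coeff 0) * X).coeff 0)
      + C ((derivative v).coeff 0) * X := by
    rw [← eq_C_of_natDegree_eq_zero h3, sub_add_cancel]
  rw [h4, add_comm]
  exact natDegree_linear_le

lemma natDegree_derivative_derivative_le {k : ℕ} {v : ℂ[X]} (h : v.natDegree ≤ k) :
    (derivative (derivative v)).natDegree ≤ k - 2 := by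
  have h1 := natDegree_derivative_le v
  have h2 := natDegree_derivative_le (derivative v)
  omega

lemma derivative_derivative_eq_zero {v : ℂ[X]} (hv : v.natDegree ≤ 1) :
    derivative (derivative v) = 0 := by
  have h1 : (derivative v).natDegree = 0 := by
    have := natDegree_derivative_le v
    omega
  rw [eq_C_of_natDegree_eq_zero h1, derivative_C]

/-- A functional on polynomials of degree `≤ k` that annihilates linear functions is determined by
its values on second antiderivatives of Legendre polynomials. -/
lemma functional_eq_sum {k : ℕ} {S : ℕ → ℂ[X]} (hS : ∀ i, derivative (derivative (S i)) = leg i)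
    {ψ : ℂ[X] →ₗ[ℂ] ℂ} (hψ : ∀ v : ℂ[X], v.natDegree ≤ 1 → ψ v = 0) {v : ℂ[X]}
    (hv : v.natDegree ≤ k) :
    ψ v = ∑ i ∈ Finset.range (k - 2 + 1), lcoef (derivative (derivative v)) i * ψ (S i) := by
  have h1 := eq_sum_leg (natDegree_derivative_derivative_le hv)
  -- The argument has vanishing second derivative, hence is linear and is annihilated by `ψ`.
  have h2 : ψ (v - ∑ i ∈ Finset.range (k - 2 + 1), C (lcoef (derivative (derivative v)) i) * S i)
      = 0 := by
    refine hψ _ (natDegree_le_one_of_derivative ?_)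
    rw [derivative_sub, derivative_sub, derivative_sum, derivative_sum, sub_eq_zero]
    simp only [derivative_C_mul, hS]
    exact h1
  rw [map_sub, sub_eq_zero, map_sum] at h2
  rw [h2]
  refine Finset.sum_congr rfl fun i _ => ?_
  rw [← smul_eq_C_mul, map_smul, smul_eq_mul]

/-- As v runs through degree ≤ k, v'' runs through degree ≤ k - 2, so these conditions fix exactly
the moments of order < k - 1. They are compatible because `ψ j` vanishes where v'' does. -/
lemma exists_solve_functional [Finite ι] {k : ℕ} (hk : 2 ≤ k) {F : Flux} {ρ : ι → ℝ}
    {s π : ι → ι} {h : ℝ} {p : ℕ} {K : ℝ} (h0 : 0 ≤ h) (hS : Stable k F ρ s π h p K)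
    (ψ : ι → ℂ[X] →ₗ[ℂ] ℂ) (hψ : ∀ j, ∀ v : ℂ[X], v.natDegree ≤ 1 → ψ j v = 0) (r₁ r₂ : ι → ℂ) :
    ∃ P : ι → ℂ[X], (∀ j, (P j).natDegree ≤ k) ∧
      (∀ j, ∀ v : ℂ[X], v.natDegree ≤ k →
        ∫ ξ in (0 : ℝ)..1, pf (P j) ξ * pf (derivative (derivative v)) ξ = ψ j v) ∧
      (∀ j, fl1 F ρ s (fun j => pf (P j)) j = r₁ j) ∧
      ∀ j, fl2 F ρ s (fun j => pf (P j)) j = r₂ j := by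
  choose S hS2 _ using fun i => exists_derivative_derivative_eq (leg i)
  obtain ⟨P, h1, h2, h3, h4⟩ := exists_solve hk h0 hS (fun j i => ψ j (S i)) r₁ r₂
  refine ⟨P, h1, fun j v hv => ?_, h3, h4⟩
  rw [functional_eq_sum hS2 (hψ j) hv]
  have := integral_pf_mul_pf (p := derivative (derivative v)) (q := P j)
    (natDegree_derivative_derivative_le hv)
  simp only [mul_comm (pf (derivative (derivative v)) _)] at this
  rw [this]
  refine Finset.sum_congr rfl fun i hi => ?_
  have hi' := Finset.mem_range.1 hi
  have hn : (nrm i : ℂ) ≠ 0 := by exact_mod_cast (nrm_pos i).ne'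
  rw [lcoef.eq_1 (P j), ← h2 j i (by omega)]
  field_simp

/-- `w` is the correction of order `q` of the family `g` of functions on the reference cell: for
`q = 0` it is the projection error, and afterwards it arises from the correction of order `q - 1`
of the second derivative of `g`. -/
def IsW (k : ℕ) (F : Flux) (ρ : ι → ℝ) (s : ι → ι) :
    ℕ → (ι → ℝ → ℂ) → (ι → ℝ → ℂ) → Prop
  | 0, g, w => (∃ P : ι → ℂ[X], (∀ j, (P j).natDegree ≤ k) ∧ ∀ j, w j = fun ξ => g j ξ - pf (P j) ξ) ∧
      (∀ j, ∀ v : ℂ[X], v.natDegree ≤ k →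
        ∫ ξ in (0 : ℝ)..1, w j ξ * pf (derivative (derivative v)) ξ = 0) ∧
      (∀ j, fl1 F ρ s w j = 0) ∧ ∀ j, fl2 F ρ s w j = 0
  | q + 1, g, w => (∃ P : ι → ℂ[X], (∀ j, (P j).natDegree ≤ k) ∧ ∀ j, w j = pf (P j)) ∧
      (∃ w', IsW k F ρ s q (fun j => deriv (deriv (g j))) w' ∧ ∀ j, ∀ v : ℂ[X], v.natDegree ≤ k →
        ∫ ξ in (0 : ℝ)..1, w j ξ * pf (derivative (derivative v)) ξ
          = ∫ ξ in (0 : ℝ)..1, w' j ξ * pf v ξ) ∧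
      (∀ j, fl1 F ρ s w j = 0) ∧ ∀ j, fl2 F ρ s w j = 0

section IsW

variable {k : ℕ} {F : Flux} {ρ : ι → ℝ} {s : ι → ι} {q : ℕ} {g w : ι → ℝ → ℂ}

lemma IsW.flux (H : IsW k F ρ s q g w) (j : ι) : fl1 F ρ s w j = 0 ∧ fl2 F ρ s w j = 0 := by
  cases q with
  | zero => exact ⟨H.2.2.1 j, H.2.2.2 j⟩
  | succ q => exact ⟨H.2.2.1 j, H.2.2.2 j⟩

lemma IsW.contDiff (H : IsW k F ρ s q g w) (hg : ∀ j, ContDiff ℝ 1 (g j)) (j : ι) :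
    ContDiff ℝ 1 (w j) := by
  cases q with
  | zero =>
    obtain ⟨⟨P, _, hP⟩, _⟩ := H
    rw [hP]
    exact (hg j).sub (contDiff_pf _ _)
  | succ q =>
    obtain ⟨⟨P, _, hP⟩, _⟩ := H
    rw [hP]
    exact contDiff_pf _ _

lemma contDiff_deriv_deriv {f : ℝ → ℂ} {n : ℕ} (hf : ContDiff ℝ (n + 2 : ℕ) f) :
    ContDiff ℝ n (deriv (deriv f)) := by
  have h1 : ContDiff ℝ (n + 1 : ℕ) (deriv f) :=
    (contDiff_succ_iff_deriv (n := ((n + 1 : ℕ) : WithTop ℕ∞))).1 (by exact_mod_cast hf) |>.2.2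
  exact (contDiff_succ_iff_deriv (n := ((n : ℕ) : WithTop ℕ∞))).1 (by exact_mod_cast h1) |>.2.2

lemma contDiff_one_of {f : ℝ → ℂ} {n : ℕ} (hf : ContDiff ℝ n f) (hn : 1 ≤ n) : ContDiff ℝ 1 f :=
  hf.of_le (by exact_mod_cast hn)

/-- A correction of order `q` is orthogonal to polynomials of degree `≤ k - 2 - 2 q`. -/
lemma IsW.orth (H : IsW k F ρ s q g w) (j : ι) {v : ℂ[X]} (hv : 2 * q + 2 + v.natDegree ≤ k) :
    ∫ ξ in (0 : ℝ)..1, w j ξ * pf v ξ = 0 := by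
  induction q generalizing g w v with
  | zero =>
    obtain ⟨S, hS, hd⟩ := exists_derivative_derivative_eq v
    have := H.2.1 j S (by omega)
    rwa [hS] at this
  | succ q ih =>
    obtain ⟨_, ⟨w', hw', hm⟩, _⟩ := H
    obtain ⟨S, hS, hd⟩ := exists_derivative_derivative_eq v
    have := hm j S (by omega)
    rw [hS] at this
    rw [this, ih hw' (by omega)]

/-- At each stage the right-hand side has to annihilate linear polynomials. This is the
orthogonality `IsW.orth` of the preceding correction, and it is what limits the number of
corrections through 2q + 1 ≤ k. -/
lemma exists_isW [Finite ι] (hk : 2 ≤ k) {π : ι → ι} {h : ℝ} {p : ℕ} {K : ℝ} (h0 : 0 ≤ h)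
    (hS : Stable k F ρ s π h p K) (hq : 2 * q + 1 ≤ k)
    (hg : ∀ j, ContDiff ℝ (2 * q + 1 : ℕ) (g j)) : ∃ w, IsW k F ρ s q g w := by
  induction q generalizing g with
  | zero =>
    have hc : ∀ j, Continuous (g j) := fun j => (hg j).continuous
    have hd : ∀ j, Differentiable ℝ (g j) := fun j =>
      (contDiff_one_of (hg j) (by omega)).differentiable (by simp)
    obtain ⟨P, h1, h2, h3, h4⟩ := exists_solve_functional hk h0 hS
      (fun j => (intL (g j) (hc j)).comp (derivative.comp derivative)) (fun j v hv => by
        simp [derivative_derivative_eq_zero hv]) (fl1 F ρ s g) (fl2 F ρ s g)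
    refine ⟨fun j ξ => g j ξ - pf (P j) ξ, ⟨P, h1, fun j => rfl⟩, fun j v hv => ?_,
      fun j => ?_, fun j => ?_⟩
    · have := h2 j v hv
      simp only [sub_mul]
      rw [intervalIntegral.integral_sub (intervalIntegrable_mul_pf (hc j) _ _ _)
        (intervalIntegrable_mul_pf (continuous_pf _) _ _ _), this]
      exact sub_self _
    · have := fl1_add F ρ s hd (fun j => differentiable_pf (P j)) (fun _ => 1) (fun _ => -1)
        (fun _ => rfl) (fun _ => rfl) j
      simp only [one_mul, neg_one_mul, ← sub_eq_add_neg] at this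
      rw [this, h3, sub_self]
    · have := fl2_add F ρ s hd (fun j => differentiable_pf (P j)) (fun _ => 1) (fun _ => -1)
        (fun _ => rfl) (fun _ => rfl) j
      simp only [one_mul, neg_one_mul, ← sub_eq_add_neg] at this
      rw [this, h4, sub_self]
  | succ q ih =>
    have hg2 : ∀ j, ContDiff ℝ (2 * q + 1 : ℕ) (deriv (deriv (g j))) := fun j =>
      contDiff_deriv_deriv (by have := hg j; rwa [show 2 * (q + 1) + 1 = 2 * q + 1 + 2 by ring] at this)
    obtain ⟨w', hw'⟩ := ih (by omega) hg2
    have hc : ∀ j, Continuous (w' j) := fun j =>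
      (hw'.contDiff (fun j => contDiff_one_of (hg2 j) (by omega)) j).continuous
    obtain ⟨P, h1, h2, h3, h4⟩ := exists_solve_functional hk h0 hS
      (fun j => intL (w' j) (hc j)) (fun j v hv => hw'.orth j (by omega))
      (fun _ => 0) (fun _ => 0)
    exact ⟨fun j => pf (P j), ⟨P, h1, fun j => rfl⟩, ⟨w', hw', h2⟩, h3, h4⟩

/-- Linearity, with coefficients that may depend on the cell. -/
lemma IsW.add {g' w' : ι → ℝ → ℂ} (H : IsW k F ρ s q g w) (H' : IsW k F ρ s q g' w')
    (hg : ∀ j, ContDiff ℝ (2 * q + 1 : ℕ) (g j)) (hg' : ∀ j, ContDiff ℝ (2 * q + 1 : ℕ) (g' j))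
    (c d : ι → ℂ) (hc : ∀ j, c (s j) = c j) (hd : ∀ j, d (s j) = d j) :
    IsW k F ρ s q (fun j ξ => c j * g j ξ + d j * g' j ξ)
      (fun j ξ => c j * w j ξ + d j * w' j ξ) := by
  have int : ∀ (φ ψ : ℝ → ℂ), Continuous φ → Continuous ψ → ∀ (a b : ℂ) (v : ℂ[X]),
      ∫ ξ in (0 : ℝ)..1, (a * φ ξ + b * ψ ξ) * pf v ξ
        = a * (∫ ξ in (0 : ℝ)..1, φ ξ * pf v ξ) + b * (∫ ξ in (0 : ℝ)..1, ψ ξ * pf v ξ) := by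
    intro φ ψ hφ hψ a b v
    rw [← intervalIntegral.integral_const_mul, ← intervalIntegral.integral_const_mul,
      ← intervalIntegral.integral_add]
    · congr 1
      ext ξ
      ring
    · exact (intervalIntegrable_mul_pf hφ v 0 1).const_mul _
    · exact (intervalIntegrable_mul_pf hψ v 0 1).const_mul _
  have deg : ∀ (P P' : ι → ℂ[X]), (∀ j, (P j).natDegree ≤ k) → (∀ j, (P' j).natDegree ≤ k) →
      ∀ j, (C (c j) * P j + C (d j) * P' j).natDegree ≤ k := fun P P' h h' j =>
    natDegree_add_le_of_degree_le ((natDegree_C_mul_le _ _).trans (h j))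
      ((natDegree_C_mul_le _ _).trans (h' j))
  have dif : ∀ {φ : ι → ℝ → ℂ}, (∀ j, ContDiff ℝ 1 (φ j)) → ∀ j, Differentiable ℝ (φ j) :=
    fun h j => (h j).differentiable (by simp)
  have hw1 := H.contDiff fun j => contDiff_one_of (hg j) (by omega)
  have hw1' := H'.contDiff fun j => contDiff_one_of (hg' j) (by omega)
  have flux : ∀ j, fl1 F ρ s (fun j ξ => c j * w j ξ + d j * w' j ξ) j = 0 ∧
      fl2 F ρ s (fun j ξ => c j * w j ξ + d j * w' j ξ) j = 0 := by
    intro j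
    rw [fl1_add F ρ s (dif hw1) (dif hw1') c d hc hd, fl2_add F ρ s (dif hw1) (dif hw1') c d hc hd,
      (H.flux j).1, (H.flux j).2, (H'.flux j).1, (H'.flux j).2]
    simp
  induction q generalizing g w g' w' with
  | zero =>
    obtain ⟨⟨P, hP, hPw⟩, hm, _⟩ := H
    obtain ⟨⟨P', hP', hPw'⟩, hm', _⟩ := H'
    refine ⟨⟨fun j => C (c j) * P j + C (d j) * P' j, deg P P' hP hP', fun j => ?_⟩,
      fun j v hv => ?_, fun j => (flux j).1, fun j => (flux j).2⟩
    · ext ξ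
      dsimp only
      rw [hPw, hPw']
      simp
      ring
    · rw [int _ _ (hw1 j).continuous (hw1' j).continuous, hm j v hv, hm' j v hv]
      simp
  | succ q ih =>
    obtain ⟨⟨P, hP, hPw⟩, ⟨W, hW, hm⟩, _⟩ := H
    obtain ⟨⟨P', hP', hPw'⟩, ⟨W', hW', hm'⟩, _⟩ := H'
    have e : 2 * (q + 1) + 1 = 2 * q + 1 + 2 := by ring
    have hg2 : ∀ j, ContDiff ℝ (2 * q + 1 : ℕ) (deriv (deriv (g j))) := fun j =>
      contDiff_deriv_deriv (by have := hg j; rwa [e] at this)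
    have hg2' : ∀ j, ContDiff ℝ (2 * q + 1 : ℕ) (deriv (deriv (g' j))) := fun j =>
      contDiff_deriv_deriv (by have := hg' j; rwa [e] at this)
    have hW1 := hW.contDiff fun j => contDiff_one_of (hg2 j) (by omega)
    have hW1' := hW'.contDiff fun j => contDiff_one_of (hg2' j) (by omega)
    refine ⟨⟨fun j => C (c j) * P j + C (d j) * P' j, deg P P' hP hP', fun j => ?_⟩,
      ⟨fun j ξ => c j * W j ξ + d j * W' j ξ, ?_, fun j v hv => ?_⟩,
      fun j => (flux j).1, fun j => (flux j).2⟩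
    · ext ξ
      dsimp only
      rw [hPw, hPw']
      simp
    · have hh : ∀ j, deriv (deriv fun ξ => c j * g j ξ + d j * g' j ξ)
          = fun ξ => c j * deriv (deriv (g j)) ξ + d j * deriv (deriv (g' j)) ξ := by
        intro j
        have d1 : ∀ {f : ℝ → ℂ}, ContDiff ℝ (2 * (q + 1) + 1 : ℕ) f → Differentiable ℝ f :=
          fun hf => (contDiff_one_of hf (by omega)).differentiable (by simp)
        have d2 : ∀ {f : ℝ → ℂ}, ContDiff ℝ (2 * (q + 1) + 1 : ℕ) f →
            Differentiable ℝ (deriv f) := by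
          intro f hf
          have : ContDiff ℝ (2 * (q + 1) : ℕ) (deriv f) :=
            (contDiff_succ_iff_deriv (n := ((2 * (q + 1) : ℕ) : WithTop ℕ∞))).1
              (by exact_mod_cast hf) |>.2.2
          exact (contDiff_one_of this (by omega)).differentiable (by simp)
        have e1 : deriv (fun ξ => c j * g j ξ + d j * g' j ξ)
            = fun ξ => c j * deriv (g j) ξ + d j * deriv (g' j) ξ := funext fun x =>
          (((d1 (hg j) x).hasDerivAt.const_mul (c j)).add
            ((d1 (hg' j) x).hasDerivAt.const_mul (d j))).deriv
        rw [e1]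
        exact funext fun x => (((d2 (hg j) x).hasDerivAt.const_mul (c j)).add
            ((d2 (hg' j) x).hasDerivAt.const_mul (d j))).deriv
      simp only [hh]
      refine ih hW hW' hg2 hg2' hW1 hW1' fun j => ?_
      rw [fl1_add F ρ s (dif hW1) (dif hW1') c d hc hd,
        fl2_add F ρ s (dif hW1) (dif hW1') c d hc hd,
        (hW.flux j).1, (hW.flux j).2, (hW'.flux j).1, (hW'.flux j).2]
      simp
    · rw [int _ _ (hw1 j).continuous (hw1' j).continuous, hm j v hv, hm' j v hv,
        int _ _ (hW1 j).continuous (hW1' j).continuous]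

/-- Write φ_j(ξ) as the integral of ξ φ_j'(tξ) over t in [0,1]. The weight is the same for all
cells, so differences pass under the integral. -/
lemma Bd.of_deriv {π : ι → ι} {h R : ℝ} {l : ℕ} {φ : ι → ℝ → ℂ} (hφ : ∀ j, ContDiff ℝ 1 (φ j))
    (h0 : ∀ j, φ j 0 = 0) (H : ∀ ξ ∈ Set.Icc (0 : ℝ) 1, Bd π h l R fun j => deriv (φ j) ξ) :
    ∀ ξ ∈ Set.Icc (0 : ℝ) 1, Bd π h l R fun j => φ j ξ := by
  intro ξ hξ
  have hc : ∀ j, Continuous (deriv (φ j)) := fun j => (hφ j).continuous_deriv le_rfl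
  have key : ∀ j, φ j ξ = ∫ t in (0 : ℝ)..1, deriv (φ j) (t * ξ) * (ξ : ℂ) := by
    intro j
    have hd : ∀ t ∈ Set.uIcc (0 : ℝ) 1, HasDerivAt (fun t => φ j (t * ξ))
        (deriv (φ j) (t * ξ) * (ξ : ℂ)) t := by
      intro t _
      have h1 : HasDerivAt (φ j) (deriv (φ j) (t * ξ)) (t * ξ) :=
        ((hφ j).differentiable (by simp) _).hasDerivAt
      have h2 : HasDerivAt (fun t : ℝ => t * ξ) ξ t := by
        simpa using (hasDerivAt_id t).mul_const ξ
      have := h1.scomp t h2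
      rw [mul_comm]
      rwa [Complex.real_smul] at this
    rw [intervalIntegral.integral_eq_sub_of_hasDerivAt hd]
    · simp [h0]
    · exact (((hc j).comp (continuous_mul_const ξ)).mul continuous_const).intervalIntegrable _ _
  have := Bd.integral (π := π) (h := h) (l := l) (R := R) (Φ := fun j t => deriv (φ j) (t * ξ))
    (fun j => (hc j).comp (continuous_mul_const ξ)) (q := fun _ => (ξ : ℂ)) continuous_const
    (K := 1) (fun _ _ => by
      rw [Complex.norm_real, Real.norm_of_nonneg hξ.1]
      exact hξ.2)
    (fun t ht => H _ ⟨mul_nonneg ht.1 hξ.1, mul_le_one₀ ht.2 hξ.1 hξ.2⟩)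
  rw [one_mul] at this
  simpa only [key] using this

/-- Taylor polynomials at the left end point, with the remainder of a whole family under control. -/
lemma exists_taylor (m : ℕ) (g : ι → ℝ → ℂ) (hg : ∀ j, ContDiff ℝ (m + 1 : ℕ) (g j)) :
    ∃ T : ι → ℂ[X], (∀ j, (T j).natDegree ≤ m) ∧ ∀ (π : ι → ι) (h R : ℝ) (l : ℕ),
      (∀ ξ ∈ Set.Icc (0 : ℝ) 1, Bd π h l R fun j => iteratedDeriv (m + 1) (g j) ξ) →
      (∀ ξ ∈ Set.Icc (0 : ℝ) 1, Bd π h l R fun j => g j ξ - pf (T j) ξ) ∧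
      (∀ ξ ∈ Set.Icc (0 : ℝ) 1, Bd π h l R fun j => deriv (fun t => g j t - pf (T j) t) ξ) := by
  have hd : ∀ j, Differentiable ℝ (g j) := fun j =>
    (contDiff_one_of (hg j) (by omega)).differentiable (by simp)
  have hsub : ∀ (p : ℂ[X]) j ξ, deriv (fun t => g j t - pf p t) ξ
      = deriv (g j) ξ - pf (derivative p) ξ := fun p j ξ =>
    ((hd j ξ).hasDerivAt.sub (hasDerivAt_pf p ξ)).deriv
  induction m generalizing g with
  | zero =>
    refine ⟨fun j => C (g j 0), fun j => by simp, fun π h R l H => ?_⟩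
    have h2 : ∀ ξ ∈ Set.Icc (0 : ℝ) 1,
        Bd π h l R fun j => deriv (fun t => g j t - pf (C (g j 0)) t) ξ := by
      intro ξ hξ
      simpa [hsub, iteratedDeriv_one] using H ξ hξ
    refine ⟨Bd.of_deriv (φ := fun j t => g j t - pf (C (g j 0)) t) (fun j => ?_) (fun j => ?_) h2, h2⟩
    · exact (contDiff_one_of (hg j) (by omega)).sub (contDiff_pf _ _)
    · simp
  | succ m ih =>
    have hg' : ∀ j, ContDiff ℝ (m + 1 : ℕ) (deriv (g j)) := fun j =>
      (contDiff_succ_iff_deriv (n := ((m + 1 : ℕ) : WithTop ℕ∞))).1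
        (by exact_mod_cast hg j) |>.2.2
    have hd' : ∀ j, Differentiable ℝ (deriv (g j)) := fun j =>
      (contDiff_one_of (hg' j) (by omega)).differentiable (by simp)
    obtain ⟨T', hT', hB⟩ := ih (fun j => deriv (g j)) hg' hd' fun p j ξ =>
      ((hd' j ξ).hasDerivAt.sub (hasDerivAt_pf p ξ)).deriv
    choose A hA hAd using fun j => exists_derivative_eq (T' j)
    -- Integrate the Taylor polynomial of the derivative; the additive constant makes the remainder
    -- vanish at 0, as `Bd.of_deriv` requires.
    refine ⟨fun j => A j + C (g j 0 - pf (A j) 0), fun j => ?_, fun π h R l H => ?_⟩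
    · exact natDegree_add_le_of_degree_le ((hAd j).trans (by have := hT' j; omega)) (by simp)
    have h2 : ∀ ξ ∈ Set.Icc (0 : ℝ) 1,
        Bd π h l R fun j => deriv (fun t => g j t - pf (A j + C (g j 0 - pf (A j) 0)) t) ξ := by
      intro ξ hξ
      have := (hB π h R l fun ξ hξ => by
        have := H ξ hξ
        simpa only [iteratedDeriv_succ' (n := m + 1)] using this).1 ξ hξ
      simp only [hsub]
      simpa [hA] using this
    refine ⟨Bd.of_deriv (φ := fun j t => g j t - pf (A j + C (g j 0 - pf (A j) 0)) t)
      (fun j => ?_) (fun j => ?_) h2, h2⟩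
    · exact (contDiff_one_of (hg j) (by omega)).sub (contDiff_pf _ _)
    · simp

lemma exists_common_bound (S : ℕ → ℂ[X]) (n : ℕ) :
    ∃ B : ℝ, 0 ≤ B ∧ ∀ i < n, ∀ ξ ∈ Set.Icc (0 : ℝ) 1, ‖pf (S i) ξ‖ ≤ B := by
  choose b hb using fun i => isCompact_Icc.exists_bound_of_continuousOn (s := Set.Icc (0 : ℝ) 1)
    (continuous_pf (S i)).continuousOn
  have hb0 : ∀ i, 0 ≤ b i := fun i => (norm_nonneg _).trans (hb i 0 (by simp))
  exact ⟨∑ i ∈ Finset.range n, b i, Finset.sum_nonneg fun i _ => hb0 i, fun i hi ξ hξ =>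
    (hb i ξ hξ).trans (Finset.single_le_sum (f := b) (fun i _ => hb0 i) (Finset.mem_range.2 hi))⟩

/-- Bound for the corrections by the derivatives of order `k + 1 + 2 q`. -/
lemma exists_isW_bound (hk : 2 ≤ k) (F : Flux) {σ : ℝ} (hσ : 0 ≤ σ) {K : ℝ} (hK : 0 ≤ K) (q : ℕ) :
    ∃ K' : ℝ, 0 ≤ K' ∧ ∀ {ι : Type} (ρ : ι → ℝ) (s π : ι → ι) (h : ℝ) (p : ℕ), 0 ≤ h →
      (∀ j, |ρ j| ≤ σ) → Compat π s ρ → Stable k F ρ s π h p K →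
      ∀ (e : ℕ) (g w : ι → ℝ → ℂ) (R : ℝ), 0 ≤ R →
        (∀ j, ContDiff ℝ (k + 1 + 2 * q : ℕ) (g j)) → IsW k F ρ s q g w →
        (∀ ξ ∈ Set.Icc (0 : ℝ) 1, Bd π h (p * (q + 1) + e) R
          fun j => iteratedDeriv (k + 1 + 2 * q) (g j) ξ) →
        ∀ ξ ∈ Set.Icc (0 : ℝ) 1, Bd π h e (K' * R) fun j => w j ξ := by
  obtain ⟨B, hB1, hB, -⟩ := exists_leg_bound k
  obtain ⟨K₁, hK₁, hsolve⟩ := exists_solve_bound hk F hσ hK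
  choose S hS2 hSd using fun i => exists_derivative_derivative_eq (leg i)
  simp only [natDegree_leg] at hSd
  have hf := fluxK_nonneg F hσ
  have m0 : (0 : ℝ) ∈ Set.Icc (0 : ℝ) 1 := by simp
  have m1 : (1 : ℝ) ∈ Set.Icc (0 : ℝ) 1 := by simp
  induction q with
  | zero =>
    refine ⟨1 + K₁ * (B + fluxK F σ), by positivity, ?_⟩
    intro ι ρ s π h p h0 hρ hπ hS e g w R hR hg hw hb ξ hξ
    have hg1 : ∀ j, ContDiff ℝ 1 (g j) := fun j => contDiff_one_of (hg j) (by omega)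
    have hgd : ∀ j, Differentiable ℝ (g j) := fun j => (hg1 j).differentiable (by simp)
    have hw1 := hw.contDiff hg1
    have hwd : ∀ j, Differentiable ℝ (w j) := fun j => (hw1 j).differentiable (by simp)
    -- Polynomials of degree ≤ k are reproduced, so P - T is the projection of g - T and only the
    -- Taylor remainder, controlled by derivatives of order k + 1, has to be bounded.
    obtain ⟨T, hT, hTB⟩ := exists_taylor k g (by simpa using hg)
    obtain ⟨b1, b2⟩ := hTB π h R (p + e) (by simpa using hb)
    have hed : ∀ j, Differentiable ℝ (fun ξ => g j ξ - pf (T j) ξ) := fun j =>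
      (hgd j).sub (differentiable_pf _)
    obtain ⟨f1, f2⟩ := Bd.flux (F := F) (φ := fun j ξ => g j ξ - pf (T j) ξ) hσ hρ hπ h0 hR
      (b1 1 m1) (b2 1 m1) (b1 0 m0) (b2 0 m0)
    have hfl := hw.flux
    obtain ⟨⟨P, hP, hPw⟩, hm, -⟩ := hw
    have hE : ∀ j, pf (P j - T j) = fun ξ => 1 * (g j ξ - pf (T j) ξ) + (-1) * w j ξ := by
      intro j
      ext ξ
      rw [hPw, pf_sub]
      ring
    have hmom : ∀ i < k - 1, ∀ j, mom i (pf (P j - T j)) = mom i fun ξ => g j ξ - pf (T j) ξ := by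
      intro i hi j
      rw [hE, mom_add ((hed j).continuous.const_mul 1) ((hwd j).continuous.const_mul (-1)),
        mom_const_mul, mom_const_mul]
      have := hm j (S i) (by have := hSd i; omega)
      rw [hS2] at this
      rw [mom.eq_1 i (w j), this]
      simp
    have hmul : B * R ≤ (B + fluxK F σ) * R := by
      rw [add_mul]
      exact le_add_of_nonneg_right (mul_nonneg hf hR)
    have hmul' : fluxK F σ * R ≤ (B + fluxK F σ) * R := by
      rw [add_mul]
      exact le_add_of_nonneg_left (mul_nonneg (by linarith) hR)
    have hsol := hsolve ρ s π h p e h0 hρ hπ hS (fun j => P j - T j) ((B + fluxK F σ) * R)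
      (mul_nonneg (by linarith) hR)
      (fun j => (natDegree_sub_le _ _).trans (max_le (hP j) (hT j)))
      (fun i hi => by
        simp only [hmom i hi]
        exact (Bd.integral (fun j => (hed j).continuous) (continuous_pf (leg i))
          (fun t ht => (hB i (by omega) t ht).1) b1).mono h0 hmul)
      (by
        have : (fl1 F ρ s fun j => pf (P j - T j)) = fl1 F ρ s fun j ξ => g j ξ - pf (T j) ξ := by
          funext j
          simp only [hE]
          rw [fl1_add F ρ s hed hwd (fun _ => 1) (fun _ => -1) (fun _ => rfl) (fun _ => rfl),
            (hfl j).1]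
          simp
        rw [this]
        exact f1.mono h0 hmul')
      (by
        have : (fl2 F ρ s fun j => pf (P j - T j)) = fl2 F ρ s fun j ξ => g j ξ - pf (T j) ξ := by
          funext j
          simp only [hE]
          rw [fl2_add F ρ s hed hwd (fun _ => 1) (fun _ => -1) (fun _ => rfl) (fun _ => rfl),
            (hfl j).2]
          simp
        rw [this]
        exact f2.mono h0 hmul')
      ξ hξ
    have := ((b1 ξ hξ).of_le (Nat.le_add_left e p)).sub hsol
    have e1 : (1 + K₁ * (B + fluxK F σ)) * R = R + K₁ * ((B + fluxK F σ) * R) := by ring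
    rw [e1]
    convert this using 2 with j
    rw [hPw, pf_sub]
    ring
  | succ q ih =>
    obtain ⟨K₂, hK₂, ih⟩ := ih
    obtain ⟨BS, hBS0, hBS⟩ := exists_common_bound S (k - 1)
    refine ⟨K₁ * (BS * K₂), by positivity, ?_⟩
    intro ι ρ s π h p h0 hρ hπ hS e g w R hR hg hw hb ξ hξ
    have hfl := hw.flux
    obtain ⟨⟨P, hP, hPw⟩, ⟨w', hw', hm⟩, -⟩ := hw
    have hw_eq : w = fun j => pf (P j) := funext hPw
    have hg2 : ∀ j, ContDiff ℝ (k + 1 + 2 * q : ℕ) (deriv (deriv (g j))) := fun j =>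
      contDiff_deriv_deriv (by
        have := hg j
        rwa [show k + 1 + 2 * (q + 1) = k + 1 + 2 * q + 2 by ring] at this)
    have hw1 := hw'.contDiff fun j => contDiff_one_of (hg2 j) (by omega)
    -- The solve at this stage consumes `p` differences, so the previous correction is needed with
    -- `p + e` of them left. This accounts for p (q + 1) + e altogether.
    have hb' := ih ρ s π h p h0 hρ hπ hS (p + e) _ w' R hR hg2 hw' (fun ξ hξ => by
      have := hb ξ hξ
      rw [show p * (q + 1 + 1) + e = p * (q + 1) + (p + e) by ring] at this
      simpa only [show k + 1 + 2 * (q + 1) = k + 1 + 2 * q + 1 + 1 by ring,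
        iteratedDeriv_succ'] using this)
    have hKR : 0 ≤ BS * (K₂ * R) := by positivity
    have := hsolve ρ s π h p e h0 hρ hπ hS P (BS * (K₂ * R)) hKR hP
      (fun i hi => by
        have e1 : ∀ j, mom i (pf (P j)) = ∫ ξ in (0 : ℝ)..1, w' j ξ * pf (S i) ξ := by
          intro j
          rw [← hm j (S i) (by have := hSd i; omega), hS2, hPw, mom]
        simp only [e1]
        exact Bd.integral (fun j => (hw1 j).continuous) (continuous_pf (S i)) (hBS i hi) hb')
      (by
        rw [← hw_eq, show fl1 F ρ s w = fun _ => 0 from funext fun j => (hfl j).1]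
        exact Bd.zero h0 hKR)
      (by
        rw [← hw_eq, show fl2 F ρ s w = fun _ => 0 from funext fun j => (hfl j).2]
        exact Bd.zero h0 hKR) ξ hξ
    rw [hw_eq, show K₁ * (BS * K₂) * R = K₁ * (BS * (K₂ * R)) by ring]
    exact this

/-- Bound for the corrections by low order derivatives. -/
lemma exists_isW_crude_bound (hk : 2 ≤ k) {σ : ℝ} (hσ : 0 ≤ σ) {K : ℝ} (hK : 0 ≤ K)
    (hρ : ∀ j, |ρ j| ≤ σ) (hS : Stable k F ρ s id 1 0 K) (q : ℕ) :
    ∃ K' : ℝ, 0 ≤ K' ∧ ∀ (g w : ι → ℝ → ℂ) (R : ℝ), 0 ≤ R →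
        (∀ j, ContDiff ℝ (2 * q + 1 : ℕ) (g j)) → IsW k F ρ s q g w →
        (∀ i ≤ 2 * q + 1, ∀ ξ ∈ Set.Icc (0 : ℝ) 1, ∀ j, ‖iteratedDeriv i (g j) ξ‖ ≤ R) →
        ∀ ξ ∈ Set.Icc (0 : ℝ) 1, ∀ j, ‖w j ξ‖ ≤ K' * R := by
  obtain ⟨B, hB1, hB, -⟩ := exists_leg_bound k
  obtain ⟨K₁, hK₁, hsolve⟩ := exists_solve_bound hk F hσ hK
  have hπ : Compat id s ρ := ⟨fun _ => rfl, fun _ => rfl⟩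
  replace hsolve := hsolve ρ s id 1 0 0 zero_le_one hρ hπ hS
  choose S hS2 hSd using fun i => exists_derivative_derivative_eq (leg i)
  simp only [natDegree_leg] at hSd
  have hf := fluxK_nonneg F hσ
  have m0 : (0 : ℝ) ∈ Set.Icc (0 : ℝ) 1 := by simp
  have m1 : (1 : ℝ) ∈ Set.Icc (0 : ℝ) 1 := by simp
  induction q with
  | zero =>
    refine ⟨1 + K₁ * (B + fluxK F σ), by positivity, ?_⟩
    intro g w R hR hg hw hb ξ hξ j
    have hg1 : ∀ j, ContDiff ℝ 1 (g j) := fun j => contDiff_one_of (hg j) (by omega)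
    have hgd : ∀ j, Differentiable ℝ (g j) := fun j => (hg1 j).differentiable (by simp)
    have hw1 := hw.contDiff hg1
    have hwd : ∀ j, Differentiable ℝ (w j) := fun j => (hw1 j).differentiable (by simp)
    have b1 : ∀ ξ ∈ Set.Icc (0 : ℝ) 1, Bd id 1 (0 + 0) R fun j => g j ξ := fun ξ hξ j => by
      simpa using hb 0 (by omega) ξ hξ j
    have b2 : ∀ ξ ∈ Set.Icc (0 : ℝ) 1, Bd id 1 (0 + 0) R fun j => deriv (g j) ξ :=
      fun ξ hξ j => by simpa [iteratedDeriv_one] using hb 1 (by omega) ξ hξ j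
    obtain ⟨f1, f2⟩ := Bd.flux (F := F) (φ := g) hσ hρ hπ zero_le_one hR
      (b1 1 m1) (b2 1 m1) (b1 0 m0) (b2 0 m0)
    have hfl := hw.flux
    obtain ⟨⟨P, hP, hPw⟩, hm, -⟩ := hw
    have hE : ∀ j, pf (P j) = fun ξ => 1 * g j ξ + (-1) * w j ξ := by
      intro j
      ext ξ
      rw [hPw]
      ring
    have hmom : ∀ i < k - 1, ∀ j, mom i (pf (P j)) = mom i (g j) := by
      intro i hi j
      rw [hE, mom_add ((hgd j).continuous.const_mul 1) ((hwd j).continuous.const_mul (-1)),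
        mom_const_mul, mom_const_mul]
      have := hm j (S i) (by have := hSd i; omega)
      rw [hS2] at this
      rw [mom.eq_1 i (w j), this]
      simp
    have hmul : B * R ≤ (B + fluxK F σ) * R := by
      rw [add_mul]
      exact le_add_of_nonneg_right (mul_nonneg hf hR)
    have hmul' : fluxK F σ * R ≤ (B + fluxK F σ) * R := by
      rw [add_mul]
      exact le_add_of_nonneg_left (mul_nonneg (by linarith) hR)
    have hsol := hsolve P ((B + fluxK F σ) * R) (mul_nonneg (by linarith) hR) hP
      (fun i hi => by
        simp only [hmom i hi]
        exact (Bd.integral (fun j => (hgd j).continuous) (continuous_pf (leg i))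
          (fun t ht => (hB i (by omega) t ht).1) b1).mono zero_le_one hmul)
      (by
        have : (fl1 F ρ s fun j => pf (P j)) = fl1 F ρ s g := by
          funext j
          simp only [hE]
          rw [fl1_add F ρ s hgd hwd (fun _ => 1) (fun _ => -1) (fun _ => rfl) (fun _ => rfl),
            (hfl j).1]
          simp
        rw [this]
        exact f1.mono zero_le_one hmul')
      (by
        have : (fl2 F ρ s fun j => pf (P j)) = fl2 F ρ s g := by
          funext j
          simp only [hE]
          rw [fl2_add F ρ s hgd hwd (fun _ => 1) (fun _ => -1) (fun _ => rfl) (fun _ => rfl),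
            (hfl j).2]
          simp
        rw [this]
        exact f2.mono zero_le_one hmul')
      ξ hξ
    rw [hPw]
    calc ‖g j ξ - pf (P j) ξ‖ ≤ R + K₁ * ((B + fluxK F σ) * R) :=
          (norm_sub_le _ _).trans (add_le_add (b1 ξ hξ j) (hsol j))
      _ = _ := by ring
  | succ q ih =>
    obtain ⟨K₂, hK₂, ih⟩ := ih
    obtain ⟨BS, hBS0, hBS⟩ := exists_common_bound S (k - 1)
    refine ⟨K₁ * (BS * K₂), by positivity, ?_⟩
    intro g w R hR hg hw hb ξ hξ j
    have hfl := hw.flux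
    obtain ⟨⟨P, hP, hPw⟩, ⟨w', hw', hm⟩, -⟩ := hw
    have hw_eq : w = fun j => pf (P j) := funext hPw
    have hg2 : ∀ j, ContDiff ℝ (2 * q + 1 : ℕ) (deriv (deriv (g j))) := fun j =>
      contDiff_deriv_deriv (by
        have := hg j
        rwa [show 2 * (q + 1) + 1 = 2 * q + 1 + 2 by ring] at this)
    have hw1 := hw'.contDiff fun j => contDiff_one_of (hg2 j) (by omega)
    have hb' := ih _ w' R hR hg2 hw' (fun i hi ξ hξ j => by
      have := hb (i + 2) (by omega) ξ hξ j
      simpa only [iteratedDeriv_succ'] using this)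
    have hKR : 0 ≤ BS * (K₂ * R) := by positivity
    have := hsolve P (BS * (K₂ * R)) hKR hP
      (fun i hi => by
        have e1 : ∀ j, mom i (pf (P j)) = ∫ ξ in (0 : ℝ)..1, w' j ξ * pf (S i) ξ := by
          intro j
          rw [← hm j (S i) (by have := hSd i; omega), hS2, hPw, mom]
        simp only [e1]
        exact Bd.integral (fun j => (hw1 j).continuous) (continuous_pf (S i)) (hBS i hi) hb')
      (by
        rw [← hw_eq, show fl1 F ρ s w = fun _ => 0 from funext fun j => (hfl j).1]
        exact Bd.zero zero_le_one hKR)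
      (by
        rw [← hw_eq, show fl2 F ρ s w = fun _ => 0 from funext fun j => (hfl j).2]
        exact Bd.zero zero_le_one hKR) ξ hξ
    rw [hw_eq, show K₁ * (BS * K₂) * R = K₁ * (BS * (K₂ * R)) by ring]
    exact this j

end IsW

/-! ### Stability of the top modes: cell-local systems and cyclic recurrences. -/

variable {ι : Type}

lemma topMode_one {k : ℕ} (hk : 2 ≤ k) (x y : ι → ℂ) (j : ι) :
    topMode k x y j 1 = (-1) ^ k * (y j - x j) ∧
    deriv (topMode k x y j) 1 = (-1) ^ k * (k * (k + 1) * y j - k * (k - 1) * x j) := by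
  obtain ⟨m, rfl⟩ : ∃ m, k = m + 1 := ⟨k - 1, by omega⟩
  simp only [topMode, deriv_pf]
  simp only [Nat.add_sub_cancel, derivative_add, derivative_C_mul, pf_add, pf_mul, pf_C,
    pf_leg_one, pf_derivative_leg_one, pow_succ]
  push_cast
  constructor <;> ring

lemma topMode_zero {k : ℕ} (hk : 2 ≤ k) (x y : ι → ℂ) (j : ι) :
    topMode k x y j 0 = x j + y j ∧
    deriv (topMode k x y j) 0 = -(k * (k + 1) * y j + k * (k - 1) * x j) := by
  obtain ⟨m, rfl⟩ : ∃ m, k = m + 1 := ⟨k - 1, by omega⟩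
  simp only [topMode, deriv_pf]
  simp only [Nat.add_sub_cancel, derivative_add, derivative_C_mul, pf_add, pf_mul, pf_C,
    pf_leg_zero, pf_derivative_leg_zero]
  push_cast
  constructor <;> ring

set_option maxHeartbeats 400000 in
/-- Stability of the local projection. -/
lemma exists_stable_local {k : ℕ} (hk : 2 ≤ k) {F : Flux}
    (hF : F.α₁ ^ 2 + F.β₁ * F.β₂ = 1 / 4) (σ : ℝ) {δ : ℝ} (hδ : 0 < δ) :
    ∃ K : ℝ, 0 ≤ K ∧ ∀ {ι : Type} (ρ : ι → ℝ), (∀ j, 1 ≤ ρ j ∧ ρ j ≤ σ) →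
      (∀ j, δ ≤ |F.β₁ / ρ j + F.β₂ * ρ j * ((k : ℝ) ^ 2 * ((k : ℝ) ^ 2 - 1)) - (k : ℝ) ^ 2|) →
      ∀ (π : ι → ι) (h : ℝ), Stable k F ρ id π h 0 K := by
  set A : ℝ := (1 + |F.α₁| + |F.β₁| + |F.β₂|) * (1 + |σ|) * (k * (k + 1) + 1) with hA
  have hA0 : 0 ≤ A := by positivity
  refine ⟨8 * A / δ, by positivity, fun {ι} ρ hρ hΓ π h x y R h1 h2 j => ?_⟩
  have hR : 0 ≤ R := (norm_nonneg _).trans (h1 j)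
  set a : ℝ := 1 / 2 + F.α₁ with ha
  set b : ℝ := 1 / 2 - F.α₁ with hb
  set κ : ℝ := k * (k - 1) with hκ
  set μ : ℝ := k * (k + 1) with hμ
  set ε : ℝ := (-1) ^ k with hε
  have hεε : ε * ε = 1 := by rw [hε, ← mul_pow]; simp
  set r := ρ j with hr
  have hr1 : 1 ≤ r := (hρ j).1
  set H11 : ℝ := ε * (-a + F.β₂ * r * κ) + (b - F.β₂ * r * κ) with hH11
  set H12 : ℝ := ε * (a - F.β₂ * r * μ) + (b - F.β₂ * r * μ) with hH12
  set H21 : ℝ := ε * (F.β₁ - b * r * κ) + (F.β₁ - a * r * κ) with hH21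
  set H22 : ℝ := ε * (-F.β₁ + b * r * μ) + (F.β₁ - a * r * μ) with hH22
  have f1 : fl1 F ρ id (topMode k x y) j = H11 * x j + H12 * y j := by
    rw [fl1, id, (topMode_one hk x y j).1, (topMode_one hk x y j).2, (topMode_zero hk x y j).1,
      (topMode_zero hk x y j).2, hH11, hH12, ha, hb, hκ, hμ, hε]
    push_cast
    ring
  have f2 : fl2 F ρ id (topMode k x y) j = H21 * x j + H22 * y j := by
    rw [fl2, id, (topMode_one hk x y j).1, (topMode_one hk x y j).2, (topMode_zero hk x y j).1,
      (topMode_zero hk x y j).2, hH21, hH22, ha, hb, hκ, hμ, hε]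
    push_cast
    ring
  -- With the coupling `id` each cell has its own 2×2 system; its determinant is h_j Γ_j, expressed
  -- through ρ_j, up to the factor -2ερ_j.
  have hdet : H11 * H22 - H12 * H21 = -2 * ε * r *
      (F.β₁ / r + F.β₂ * r * ((k : ℝ) ^ 2 * ((k : ℝ) ^ 2 - 1)) - (k : ℝ) ^ 2) := by
    have : r * (F.β₁ / r) = F.β₁ := mul_div_cancel₀ _ (by linarith)
    have e1 : -2 * ε * r *
      (F.β₁ / r + F.β₂ * r * ((k : ℝ) ^ 2 * ((k : ℝ) ^ 2 - 1)) - (k : ℝ) ^ 2)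
       = -2 * ε * (F.β₁ + r * (F.β₂ * r * ((k : ℝ) ^ 2 * ((k : ℝ) ^ 2 - 1)) - (k : ℝ) ^ 2)) := by
      linear_combination (-2 * ε) * this
    rw [e1, hH11, hH12, hH21, hH22, ha, hb, hκ, hμ]
    linear_combination (4 * ε * r * k ^ 2 + 2 * r * k * ε * ε + 2 * r * k ) * hF + 0 * hεε
  have hdetne : 2 * δ ≤ |H11 * H22 - H12 * H21| := by
    rw [hdet, abs_mul, abs_mul, abs_mul]
    have hε1 : |ε| = 1 := by rw [hε, abs_pow]; simp
    rw [hε1, abs_of_nonneg (by linarith : 0 ≤ r)]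
    have := hΓ j
    rw [← hr] at this
    rw [show |(-2 : ℝ)| = 2 by norm_num, mul_one]
    have := mul_le_mul hr1 this hδ.le (by linarith)
    linarith
  have hP : ∀ c ∈ ({a, b, F.β₁, F.β₂} : Set ℝ), |c| ≤ 1 + |F.α₁| + |F.β₁| + |F.β₂| := by
    have e1 := abs_nonneg F.α₁
    have e2 := abs_nonneg F.β₁
    have e3 := abs_nonneg F.β₂
    have e4 := le_abs_self F.α₁
    have e5 := neg_abs_le F.α₁
    rintro c (rfl | rfl | rfl | rfl)
    · rw [abs_le]; constructor <;> linarith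
    · rw [abs_le]; constructor <;> linarith
    · linarith
    · linarith
  have hk' : (2 : ℝ) ≤ k := by exact_mod_cast hk
  have hterm : ∀ c ∈ ({a, b, F.β₁, F.β₂} : Set ℝ), ∀ t, 0 ≤ t → t ≤ 1 + |σ| → ∀ m, 0 ≤ m →
      m ≤ (k : ℝ) * (k + 1) + 1 → |c * t * m| ≤ A := by
    intro c hc t ht0 ht m hm0 hm
    rw [abs_mul, abs_mul, abs_of_nonneg ht0, abs_of_nonneg hm0, hA]
    exact mul_le_mul (mul_le_mul (hP c hc) ht ht0 (by positivity)) hm hm0 (by positivity)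
  have hone : ∀ c ∈ ({a, b, F.β₁, F.β₂} : Set ℝ), |c| ≤ A := by
    intro c hc
    have := hterm c hc 1 zero_le_one (by linarith [abs_nonneg σ]) 1 zero_le_one
      (le_add_of_nonneg_left (by positivity))
    simpa using this
  have hr0 : 0 ≤ r := by linarith
  have hrσ : r ≤ 1 + |σ| := by linarith [(hρ j).2, le_abs_self σ]
  have hκ0 : 0 ≤ κ := mul_nonneg (by linarith) (by linarith)
  have hμ0 : 0 ≤ μ := mul_nonneg (by linarith) (by linarith)
  have hκ1 : κ ≤ (k : ℝ) * (k + 1) + 1 := by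
    have : κ = (k : ℝ) * (k + 1) - 2 * k := by rw [hκ]; ring
    linarith
  have hμ1 : μ ≤ (k : ℝ) * (k + 1) + 1 := by rw [hμ]; linarith
  have hε1 : |ε| = 1 := by rw [hε, abs_pow]; simp
  have hfour : ∀ u v u' v' : ℝ, |u| ≤ A → |v| ≤ A → |u'| ≤ A → |v'| ≤ A →
      |ε * (u + v) + (u' + v')| ≤ 4 * A := by
    intro u v u' v' h1 h2 h3 h4
    have e1 := abs_add_le (ε * (u + v)) (u' + v')
    rw [abs_mul, hε1, one_mul] at e1
    linarith [abs_add_le u v, abs_add_le u' v']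
  have neg : ∀ {u : ℝ}, |u| ≤ A → |-u| ≤ A := fun h => by rwa [abs_neg]
  have ma : a ∈ ({a, b, F.β₁, F.β₂} : Set ℝ) := by simp
  have mb : b ∈ ({a, b, F.β₁, F.β₂} : Set ℝ) := by simp
  have m1 : F.β₁ ∈ ({a, b, F.β₁, F.β₂} : Set ℝ) := by simp
  have m2 : F.β₂ ∈ ({a, b, F.β₁, F.β₂} : Set ℝ) := by simp
  have B11 : |H11| ≤ 4 * A := by
    rw [hH11, sub_eq_add_neg b]
    exact hfour _ _ _ _ (neg (hone a ma)) (hterm _ m2 r hr0 hrσ κ hκ0 hκ1) (hone b mb)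
      (neg (hterm _ m2 r hr0 hrσ κ hκ0 hκ1))
  have B12 : |H12| ≤ 4 * A := by
    rw [hH12, sub_eq_add_neg b, sub_eq_add_neg a]
    exact hfour _ _ _ _ (hone a ma) (neg (hterm _ m2 r hr0 hrσ μ hμ0 hμ1)) (hone b mb)
      (neg (hterm _ m2 r hr0 hrσ μ hμ0 hμ1))
  have B21 : |H21| ≤ 4 * A := by
    rw [hH21, sub_eq_add_neg F.β₁, sub_eq_add_neg F.β₁]
    exact hfour _ _ _ _ (hone _ m1) (neg (hterm _ mb r hr0 hrσ κ hκ0 hκ1)) (hone _ m1)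
      (neg (hterm _ ma r hr0 hrσ κ hκ0 hκ1))
  have B22 : |H22| ≤ 4 * A := by
    rw [hH22, sub_eq_add_neg F.β₁]
    exact hfour _ _ _ _ (neg (hone _ m1)) (hterm _ mb r hr0 hrσ μ hμ0 hμ1) (hone _ m1)
      (neg (hterm _ ma r hr0 hrσ μ hμ0 hμ1))
  -- Cramer's rule, with entries at most 4A and determinant at least 2δ in modulus.
  have fin : ∀ (z g₁ g₂ : ℂ) (u v : ℝ), |u| ≤ 4 * A → |v| ≤ 4 * A → ‖g₁‖ ≤ R → ‖g₂‖ ≤ R →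
      ((H11 * H22 - H12 * H21 : ℝ) : ℂ) * z = u * g₁ - v * g₂ → ‖z‖ ≤ 8 * A / δ * R := by
    intro z g₁ g₂ u v hu hv hg₁ hg₂ hz
    have e1 : |H11 * H22 - H12 * H21| * ‖z‖ ≤ 4 * A * R + 4 * A * R := by
      have := congrArg norm hz
      rw [norm_mul, Complex.norm_real, Real.norm_eq_abs] at this
      rw [this]
      refine (norm_sub_le _ _).trans (add_le_add ?_ ?_)
      · rw [norm_mul, Complex.norm_real, Real.norm_eq_abs]
        exact mul_le_mul hu hg₁ (norm_nonneg _) (by positivity)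
      · rw [norm_mul, Complex.norm_real, Real.norm_eq_abs]
        exact mul_le_mul hv hg₂ (norm_nonneg _) (by positivity)
    have e2 : 2 * δ * ‖z‖ ≤ 8 * A * R := by
      have := mul_le_mul_of_nonneg_right hdetne (norm_nonneg z)
      linarith
    have e3 : δ * ‖z‖ ≤ 8 * A * R := by
      have : 0 ≤ A * R := by positivity
      linarith
    rw [div_mul_eq_mul_div, le_div_iff₀ hδ]
    linarith
  have g1 := h1 j
  have g2 := h2 j
  constructor
  · refine fin (x j) _ _ H22 H12 B22 B12 g1 g2 ?_
    rw [f1, f2]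
    push_cast
    ring
  · refine fin (y j) _ _ H11 H21 B11 B21 g2 g1 ?_
    rw [f1, f2]
    push_cast
    ring

/-- Stability of the three term recurrence that governs uniform meshes. -/
def RecStable (s : ι → ι) (h : ℝ) (p : ℕ) (τ K : ℝ) : Prop :=
  ∀ (x : ι → ℂ) (R : ℝ), Bd s h p R (fun j => x (s (s j)) + τ * x (s j) + x j) → ∀ j, ‖x j‖ ≤ K * R

/-- The numerator of `Γ/Λ` without its dependence on the mesh. -/
def gam0 (k : ℕ) (F : Flux) : ℝ :=
  F.β₁ + F.β₂ * ((k : ℝ) ^ 2 * ((k : ℝ) ^ 2 - 1)) - 2 * (k : ℝ) ^ 2 * (F.α₁ ^ 2 + F.β₁ * F.β₂ + 1 / 4)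

/-- The denominator of `Γ/Λ` without its dependence on the mesh. -/
def lam0 (k : ℕ) (F : Flux) : ℝ := -(2 * k) * (F.α₁ ^ 2 + F.β₁ * F.β₂ - 1 / 4)

/-- The fluxes are A X_j + B X_{j+1} with X = (x, y) and det A = det B = -Λ, where Λ stands for its
mesh-free version `lam0`. Adding a row of adj A applied to the flux at j and the same row of adj B
applied to the flux at j + 1 cancels one unknown and leaves -Λ (x_{j+2} + τ x_{j+1} + x_j), and
likewise for y. -/
lemma exists_stable_uniform {k : ℕ} (hk : 2 ≤ k) {F : Flux} (hF : lam0 k F ≠ 0) {K : ℝ} :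
    ∃ c : ℝ, 0 ≤ c ∧ ∀ {ι : Type} (s : ι → ι) (h : ℝ) (p : ℕ), 0 ≤ h →
      RecStable s h p (2 * (-1) ^ k * (gam0 k F / lam0 k F)) K →
      Stable k F (fun _ => 1) s s h p (K * c) := by
  set a : ℝ := 1 / 2 + F.α₁ with ha
  set b : ℝ := 1 / 2 - F.α₁ with hb
  set κ : ℝ := k * (k - 1) with hκ
  set μ : ℝ := k * (k + 1) with hμ
  set ε : ℝ := (-1) ^ k with hε
  have hεε : ε * ε = 1 := by rw [hε, ← mul_pow]; simp
  set a11 : ℝ := ε * (-a + F.β₂ * κ) with ha11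
  set a12 : ℝ := ε * (a - F.β₂ * μ) with ha12
  set a21 : ℝ := ε * (F.β₁ - b * κ) with ha21
  set a22 : ℝ := ε * (-F.β₁ + b * μ) with ha22
  set b11 : ℝ := b - F.β₂ * κ with hb11
  set b12 : ℝ := b - F.β₂ * μ with hb12
  set b21 : ℝ := F.β₁ - a * κ with hb21
  set b22 : ℝ := F.β₁ - a * μ with hb22
  set d := lam0 k F with hd
  set A : ℝ := |a11| + |a12| + |a21| + |a22| + |b11| + |b12| + |b21| + |b22| with hA
  have hA0 : 0 ≤ A := by positivity
  refine ⟨4 * A / |d|, by positivity, fun {ι} s h p h0 hrec x y R h1 h2 j => ?_⟩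
  have f1 : ∀ j, fl1 F (fun _ => 1) s (topMode k x y) j
      = a11 * x j + a12 * y j + b11 * x (s j) + b12 * y (s j) := by
    intro j
    rw [fl1, (topMode_one hk x y j).1, (topMode_one hk x y j).2, (topMode_zero hk x y (s j)).1,
      (topMode_zero hk x y (s j)).2, ha11, ha12, hb11, hb12, ha, hb, hκ, hμ, hε]
    push_cast
    ring
  have f2 : ∀ j, fl2 F (fun _ => 1) s (topMode k x y) j
      = a21 * x j + a22 * y j + b21 * x (s j) + b22 * y (s j) := by
    intro j
    rw [fl2, (topMode_one hk x y j).1, (topMode_one hk x y j).2, (topMode_zero hk x y (s j)).1,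
      (topMode_zero hk x y (s j)).2, ha21, ha22, hb21, hb22, ha, hb, hκ, hμ, hε]
    push_cast
    ring
  have r1 : a11 * a22 - a12 * a21 = -d := by
    rw [hd, lam0, ha11, ha12, ha21, ha22, ha, hb, hκ, hμ]
    linear_combination (2 * k * (F.α₁ ^ 2 + F.β₁ * F.β₂ - 1 / 4)) * hεε
  have r2 : b11 * b22 - b12 * b21 = -d := by
    rw [hd, lam0, hb11, hb12, hb21, hb22, ha, hb, hκ, hμ]
    ring
  have r3 : a11 * b22 + b11 * a22 - a12 * b21 - b12 * a21
      = -d * (2 * ε * (gam0 k F / d)) := by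
    have : d * (gam0 k F / d) = gam0 k F := mul_div_cancel₀ _ hF
    have e2 : -d * (2 * ε * (gam0 k F / d)) = -2 * ε * gam0 k F := by
      linear_combination (-2 * ε) * this
    rw [e2, gam0, ha11, ha12, ha21, ha22, hb11, hb12, hb21, hb22, ha, hb, hκ, hμ]
    ring
  set τ : ℝ := 2 * ε * (gam0 k F / d) with hτ
  have hdC : (d : ℂ) ≠ 0 := by exact_mod_cast hF
  have c1 : (a11 * a22 - a12 * a21 : ℂ) = -d := by exact_mod_cast r1
  have c2 : (b11 * b22 - b12 * b21 : ℂ) = -d := by exact_mod_cast r2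
  have c3 : (a11 * b22 + b11 * a22 - a12 * b21 - b12 * a21 : ℂ)
      = -d * (τ : ℂ) := by exact_mod_cast r3
  have hs : ∀ j, s (s j) = s (s j) := fun _ => rfl
  have h1s := h1.comp (s := s) hs
  have h2s := h2.comp (s := s) hs
  have nb : ∀ u ∈ ({a11, a12, a21, a22, b11, b12, b21, b22} : Set ℝ),
      ‖(u : ℂ) / (d : ℂ)‖ ≤ A / |d| := by
    intro u hu
    rw [norm_div, Complex.norm_real, Complex.norm_real, Real.norm_eq_abs, Real.norm_eq_abs]
    refine div_le_div_of_nonneg_right ?_ (abs_nonneg d)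
    have n1 := abs_nonneg a11
    have n2 := abs_nonneg a12
    have n3 := abs_nonneg a21
    have n4 := abs_nonneg a22
    have n5 := abs_nonneg b11
    have n6 := abs_nonneg b12
    have n7 := abs_nonneg b21
    have n8 := abs_nonneg b22
    rcases hu with rfl | rfl | rfl | rfl | rfl | rfl | rfl | rfl <;> linarith
  have tot : A / |d| * R + A / |d| * R + A / |d| * R + A / |d| * R = 4 * A / |d| * R := by ring
  constructor
  · have := hrec x (4 * A / |d| * R) (by
      have H := (((h2.const_mul (nb a12 (by simp))).sub (h1.const_mul (nb a22 (by simp)))).add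
        (h2s.const_mul (nb b12 (by simp)))).sub (h1s.const_mul (nb b22 (by simp)))
      rw [tot] at H
      convert H using 2 with j
      rw [f1, f2, f1, f2]
      field_simp
      linear_combination x (s (s j)) * c2 + x j * c1 + x (s j) * c3) j
    rwa [← mul_assoc] at this
  · have := hrec y (4 * A / |d| * R) (by
      have H := (((h1.const_mul (nb a21 (by simp))).sub (h2.const_mul (nb a11 (by simp)))).add
        (h1s.const_mul (nb b21 (by simp)))).sub (h2s.const_mul (nb b11 (by simp)))
      rw [tot] at H
      convert H using 2 with j
      rw [f1, f2, f1, f2]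
      field_simp
      linear_combination y (s (s j)) * c2 + y j * c1 + y (s j) * c3) j
    rwa [← mul_assoc] at this

/-- Diagonal dominance: read the recurrence at an index where the modulus is maximal. Surjectivity
of `s` allows this index to be the middle one. -/
lemma recStable_of_two_lt [Finite ι] {s : ι → ι} (hs : Function.Surjective s) (h : ℝ) {τ : ℝ}
    (hτ : 2 < |τ|) : RecStable s h 0 τ (1 / (|τ| - 2)) := by
  intro x R H j
  have : Nonempty ι := ⟨j⟩
  obtain ⟨m, hm⟩ := Finite.exists_max fun j => ‖x j‖
  obtain ⟨l, rfl⟩ := hs m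
  have h1 : ‖x (s (s l)) + τ * x (s l) + x l‖ ≤ R := H l
  have h2 : |τ| * ‖x (s l)‖ ≤ R + ‖x (s (s l))‖ + ‖x l‖ := by
    have e1 : (τ : ℂ) * x (s l) = (x (s (s l)) + τ * x (s l) + x l) - x (s (s l)) - x l := by ring
    have e2 : |τ| * ‖x (s l)‖ = ‖(τ : ℂ) * x (s l)‖ := by
      rw [norm_mul, Complex.norm_real, Real.norm_eq_abs]
    rw [e2, e1]
    exact (norm_sub_le _ _).trans (add_le_add_left ((norm_sub_le _ _).trans
      (add_le_add_left h1 _)) _)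
  have h3 : (|τ| - 2) * ‖x (s l)‖ ≤ R := by linarith [hm (s (s l)), hm l]
  refine (hm j).trans ?_
  rw [div_mul_eq_mul_div, le_div_iff₀ (by linarith)]
  linarith

/-- A cyclic first order recurrence with a multiplier on the unit circle. -/
lemma norm_le_of_firstOrder {s : ι → ι} {h : ℝ} {N : ℕ} (hN : ∀ j, s^[N] j = j) {z : ℂ}
    (hz : ‖z‖ = 1) (hz1 : z ≠ 1) {δ : ℝ} (hδ : 0 < δ) (hzN : δ ≤ ‖z ^ N - 1‖) {L : ℝ}
    (hL : N * h = L) {y f : ι → ℂ} (hy : ∀ j, y (s j) = z * y j + f j) {R : ℝ}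
    (H : Bd s h 1 R f) (j : ι) : ‖y j‖ ≤ (1 + L / δ) / ‖1 - z‖ * R := by
  -- Going once around the cycle expresses (z^N - 1) y_j through N forcing terms. This loses the
  -- factor N.
  have basic : ∀ {y f : ι → ℂ} {R : ℝ}, (∀ j, y (s j) = z * y j + f j) → (∀ j, ‖f j‖ ≤ R) →
      ∀ j, ‖y j‖ ≤ N * R / δ := by
    intro y f R hy hf j
    have it : ∀ n, ‖y (s^[n] j) - z ^ n * y j‖ ≤ n * R := by
      intro n
      induction n with
      | zero => simp
      | succ n ih =>
        rw [Function.iterate_succ_apply', hy]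
        have : z * y (s^[n] j) + f (s^[n] j) - z ^ (n + 1) * y j
            = z * (y (s^[n] j) - z ^ n * y j) + f (s^[n] j) := by ring
        rw [this]
        refine (norm_add_le _ _).trans ?_
        rw [norm_mul, hz, one_mul]
        push_cast
        linarith [hf (s^[n] j)]
    have := it N
    rw [hN, show y j - z ^ N * y j = -((z ^ N - 1) * y j) by ring, norm_neg, norm_mul] at this
    rw [le_div_iff₀ hδ, mul_comm]
    exact (mul_le_mul_of_nonneg_right hzN (norm_nonneg _)).trans this
  have hz1' : (1 - z) ≠ 0 := sub_ne_zero.2 hz1.symm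
  have hpos : 0 < ‖1 - z‖ := norm_pos_iff.2 hz1'
  -- Subtracting the quasi-stationary solution f/(1 - z) replaces the forcing by a difference of f,
  -- of size hR/|1 - z|; the lost factor N is then harmless because Nh = L.
  have h2 := basic (y := fun j => y j - f j / (1 - z)) (f := fun j => -(f (s j) - f j) / (1 - z))
    (R := h * R / ‖1 - z‖) (fun j => by
      rw [hy]
      field_simp
      ring) (fun j => by
      rw [norm_div, norm_neg]
      exact div_le_div_of_nonneg_right (H.2 j) hpos.le) j
  have h3 : ‖f j / (1 - z)‖ ≤ R / ‖1 - z‖ := by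
    rw [norm_div]
    exact div_le_div_of_nonneg_right (H.1 j) hpos.le
  calc ‖y j‖ = ‖(y j - f j / (1 - z)) + f j / (1 - z)‖ := by congr 1; ring
    _ ≤ N * (h * R / ‖1 - z‖) / δ + R / ‖1 - z‖ := (norm_add_le _ _).trans (add_le_add h2 h3)
    _ = _ := by rw [← hL]; ring

/-- The shift polynomial factors as (S - z)(S - z̄). Each of x_{j+1} - z̄ x_j and x_{j+1} - z x_j
satisfies a first order recurrence with the same forcing, and their difference is (z - z̄) x_j, with
z not real. One difference of the data is enough because the roots are treated in parallel. -/
lemma recStable_of_lt_two {s : ι → ι} {h : ℝ} {N : ℕ} (hN : ∀ j, s^[N] j = j) {z : ℂ}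
    (hz : ‖z‖ = 1) {δ : ℝ} (hδ : 0 < δ) (hzN : δ ≤ ‖z ^ N - 1‖) {L : ℝ}
    (hL : N * h = L) (him : z.im ≠ 0) :
    RecStable s h 1 (-2 * z.re) ((1 + L / δ) / ‖1 - z‖ / |z.im|) := by
  intro x R H j
  set w := (starRingEnd ℂ) z with hw
  have hzw : z * w = 1 := by
    rw [hw, Complex.mul_conj, Complex.normSq_eq_norm_sq, hz]
    simp
  have hsum : z + w = 2 * z.re := by rw [hw, Complex.add_conj]; push_cast; ring
  have hdiff : z - w = 2 * z.im * Complex.I := by rw [hw, Complex.sub_conj]; push_cast; ring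
  have hz1 : z ≠ 1 := by
    rintro rfl
    simp at him
  have hw1 : w ≠ 1 := by
    intro h
    apply hz1
    rw [← map_one (starRingEnd ℂ), hw] at h
    exact (starRingEnd ℂ).injective h
  have hwn : ‖w‖ = 1 := by rw [hw, RCLike.norm_conj, hz]
  have hwN : δ ≤ ‖w ^ N - 1‖ := by
    have : w ^ N - 1 = (starRingEnd ℂ) (z ^ N - 1) := by rw [hw]; simp
    rw [this, RCLike.norm_conj]
    exact hzN
  have hw1n : ‖1 - w‖ = ‖1 - z‖ := by
    have : 1 - w = (starRingEnd ℂ) (1 - z) := by rw [hw]; simp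
    rw [this, RCLike.norm_conj]
  have e1 := norm_le_of_firstOrder hN hz hz1 hδ hzN hL (y := fun j => x (s j) - w * x j)
    (fun j => by
      push_cast
      linear_combination x j * hzw - x (s j) * hsum) H j
  have e2 := norm_le_of_firstOrder hN hwn hw1 hδ hwN hL (y := fun j => x (s j) - z * x j)
    (fun j => by
      push_cast
      linear_combination x j * hzw - x (s j) * hsum) H j
  rw [hw1n] at e2
  have e3 : 2 * |z.im| * ‖x j‖ ≤ (1 + L / δ) / ‖1 - z‖ * R + (1 + L / δ) / ‖1 - z‖ * R := by
    have : 2 * |z.im| * ‖x j‖ = ‖(x (s j) - w * x j) - (x (s j) - z * x j)‖ := by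
      rw [show (x (s j) - w * x j) - (x (s j) - z * x j) = (z - w) * x j by ring, hdiff]
      simp
    rw [this]
    exact (norm_sub_le _ _).trans (add_le_add e1 e2)
  rw [div_mul_eq_mul_div, le_div_iff₀ (abs_pos.2 him)]
  linarith

/-- Here -1 is a double root. The first order estimate is applied in succession to y_j = x_{j+1} +
x_j and to x, and the second application needs a difference of y, hence two differences of the data.
For odd N, (-1)^N - 1 = -2 supplies the margin. -/
lemma recStable_two {s : ι → ι} {h : ℝ} {N : ℕ} (hN : ∀ j, s^[N] j = j) (hodd : Odd N) {L : ℝ}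
    (hL : N * h = L) :
    RecStable s h 2 2 ((1 + L / 2) / 2 * ((1 + L / 2) / 2)) := by
  intro x R H
  have hz : ‖(-1 : ℂ)‖ = 1 := by simp
  have hz1 : (-1 : ℂ) ≠ 1 := by norm_num
  have hzN : (2 : ℝ) ≤ ‖(-1 : ℂ) ^ N - 1‖ := by
    rw [hodd.neg_one_pow]
    norm_num
  have h11 : ‖(1 : ℂ) - -1‖ = 2 := by norm_num
  set y : ι → ℂ := fun j => x (s j) + x j with hy
  set f : ι → ℂ := fun j => x (s (s j)) + ((2 : ℝ) : ℂ) * x (s j) + x j with hf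
  have yrec : ∀ j, y (s j) = -1 * y j + f j := fun j => by
    simp only [hy, hf]
    push_cast
    ring
  have b1 := norm_le_of_firstOrder hN hz hz1 two_pos hzN hL (y := y) yrec (H.of_le (by norm_num))
  have b2 := norm_le_of_firstOrder hN hz hz1 two_pos hzN hL (y := fun j => y (s j) - y j)
    (f := fun j => f (s j) - f j) (fun j => by rw [yrec (s j), yrec j]; ring) H.2
  rw [h11] at b1 b2
  have := norm_le_of_firstOrder hN hz hz1 two_pos hzN hL (y := x) (f := y)
    (R := (1 + L / 2) / 2 * R) (fun j => by simp only [hy]; ring)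
    ⟨b1, fun j => by rw [mul_left_comm]; exact b2 j⟩
  rw [h11] at this
  intro j
  rw [mul_assoc]
  exact this j

/-! ### Arithmetic of the cyclic mesh. -/

section MeshFacts

variable {a b : ℝ} {N : ℕ} (𝓜 : Mesh a b N)

lemma Mesh.len_pos (j : Fin N) : 0 < 𝓜.len j := by
  rw [Mesh.len, Mesh.xL, Mesh.xR, sub_pos]
  exact 𝓜.strictMono Fin.castSucc_lt_succ

lemma Mesh.len_le_size (j : Fin N) : 𝓜.len j ≤ 𝓜.size :=
  le_ciSup (Set.finite_range 𝓜.len).bddAbove j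

lemma Mesh.sum_len : ∑ j, 𝓜.len j = b - a := by
  have := Fin.sum_univ_eq_sum_range (fun i => if h : i < N then 𝓜.len ⟨i, h⟩ else 0) N
  have h1 : ∑ j : Fin N, 𝓜.len j = ∑ i ∈ Finset.range N, if h : i < N then 𝓜.len ⟨i, h⟩ else 0 := by
    rw [← this]
    exact Finset.sum_congr rfl fun i _ => by simp
  set f : ℕ → ℝ := fun i => if h : i < N + 1 then 𝓜.node ⟨i, h⟩ else 0 with hf
  have h2 : ∀ i ∈ Finset.range N, (if h : i < N then 𝓜.len ⟨i, h⟩ else 0) = f (i + 1) - f i := by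
    intro i hi
    have hi' := Finset.mem_range.1 hi
    simp only [hf, hi', dif_pos, Nat.add_lt_add_right hi' 1, hi'.trans (Nat.lt_succ_self N)]
    rfl
  rw [h1, Finset.sum_congr rfl h2, Finset.sum_range_sub]
  have e1 : f N = b := by
    simp only [hf, Nat.lt_succ_self, dif_pos]
    exact 𝓜.node_last
  have e2 : f 0 = a := by
    simp only [hf, Nat.succ_pos, dif_pos]
    exact 𝓜.node_zero
  rw [e1, e2]

/-- Mesh size over cell length. -/
def Mesh.rho (j : Fin N) : ℝ := 𝓜.size / 𝓜.len j

lemma Mesh.one_le_rho (j : Fin N) : 1 ≤ 𝓜.rho j :=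
  (one_le_div (𝓜.len_pos j)).2 (𝓜.len_le_size j)

lemma Mesh.Regular.card_mul_size_le {𝓜 : Mesh a b N} {σ : ℝ} (h : 𝓜.Regular σ) :
    N * 𝓜.size ≤ σ * (b - a) := by
  rw [← 𝓜.sum_len, Finset.mul_sum]
  have : ∀ j ∈ Finset.univ, 𝓜.size ≤ σ * 𝓜.len j := fun j _ => by
    have := h j
    rw [div_lt_iff₀ (𝓜.len_pos j)] at this
    exact this.le
  have := Finset.sum_le_sum this
  simpa using this

lemma Mesh.gam_eq (k : ℕ) (F : Flux) {h : ℝ} (hh : 𝓜.size = h) (hpos : 0 < h) : Gam k F 𝓜 𝓜.size = gam0 k F / h := by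
  rw [Gam, hh, gam0]
  field_simp

lemma Mesh.Uniform.card_mul_size {𝓜 : Mesh a b N} (h : 𝓜.Uniform) : N * 𝓜.size = b - a := by
  rw [← 𝓜.sum_len, Finset.sum_congr rfl fun j _ => h j]
  simp

variable [NeZero N]

lemma Mesh.size_pos : 0 < 𝓜.size := (𝓜.len_pos 0).trans_le (𝓜.len_le_size 0)

lemma Mesh.Regular.sigma_pos {𝓜 : Mesh a b N} {σ : ℝ} (h : 𝓜.Regular σ) : 0 < σ :=
  (zero_lt_one.trans_le (𝓜.one_le_rho 0)).trans (h 0)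

/-- The cell following `j`. -/
def nxt (j : Fin N) : Fin N := j + 1

lemma nxt_iterate (j : Fin N) : nxt^[N] j = j := by
  have h : ∀ n : ℕ, (nxt^[n] j).val = (j.val + n) % N := by
    intro n
    induction n with
    | zero => simp [Nat.mod_eq_of_lt j.2]
    | succ n ih =>
      rw [Function.iterate_succ_apply', nxt, Fin.val_add, ih, Fin.val_one']
      simp only [Nat.add_mod_mod, Nat.mod_add_mod, add_assoc]
  apply Fin.ext
  rw [h, Nat.add_mod_right, Nat.mod_eq_of_lt j.2]

lemma nxt_surjective : Function.Surjective (nxt : Fin N → Fin N) := fun j =>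
  ⟨j - 1, sub_add_cancel j 1⟩

lemma Mesh.xL_nxt (j : Fin N) : 𝓜.xL (j + 1) = 𝓜.xR j ∨ 𝓜.xL (j + 1) = 𝓜.xR j - (b - a) := by
  rcases Nat.lt_or_ge (j.val + 1) N with h | h
  · left
    have : (j + 1).val = j.val + 1 := by
      rw [Fin.val_add, Fin.val_one', Nat.add_mod_mod, Nat.mod_eq_of_lt h]
    rw [Mesh.xL, Mesh.xR]
    congr 1
    apply Fin.ext
    simp [this]
  · right
    have hj : j.val + 1 = N := by omega
    have : (j + 1).val = 0 := by
      rw [Fin.val_add, Fin.val_one', Nat.add_mod_mod, hj, Nat.mod_self]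
    have e1 : (j + 1).castSucc = 0 := by
      apply Fin.ext
      simp [this]
    have e2 : j.succ = Fin.last N := by
      apply Fin.ext
      simp [hj]
    rw [Mesh.xL, Mesh.xR, e1, e2, 𝓜.node_zero, 𝓜.node_last]
    ring

end MeshFacts

/-! ### Mesh independent stability under A1, A2 and A3. -/

/-- The map `π` moves cells only to neighbours of the same length. -/
def NeighborMap {a b : ℝ} {N : ℕ} [NeZero N] (𝓜 : Mesh a b N) (π : Fin N → Fin N) : Prop :=
  ∀ i, π i = i ∨ (π i = i + 1 ∧ 𝓜.len (i + 1) = 𝓜.len i) ∨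
    (i = π i + 1 ∧ 𝓜.len i = 𝓜.len (π i))

/-- What is needed of a scheme whose projection is stable at the cost of `p` differences; `s` is the
coupling of the cells. -/
structure Good {a b : ℝ} {N : ℕ} [NeZero N] (k : ℕ) (F : Flux) (𝓜 : Mesh a b N)
    (s : Fin N → Fin N) (p : ℕ) (K : ℝ) : Prop where
  len_s : ∀ j, 𝓜.len (s j) = 𝓜.len j
  stable : Stable k F 𝓜.rho s s 𝓜.size p K
  shift : p = 0 ∨ s = nxt
  flux_zero : ∀ φ : Fin N → ℝ → ℂ, (∀ j, fl1 F 𝓜.rho nxt φ j = 0 ∧ fl2 F 𝓜.rho nxt φ j = 0) →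
    ∀ j, fl1 F 𝓜.rho s φ j = 0 ∧ fl2 F 𝓜.rho s φ j = 0
  flux_lift : ∀ (r₁ r₂ : Fin N → ℂ) (R : ℝ), (∀ j, ‖r₁ j‖ ≤ R) → (∀ j, ‖r₂ j‖ ≤ R) →
    ∃ r₁' r₂' : Fin N → ℂ, (∀ j, ‖r₁' j‖ ≤ fluxK F 0 * R) ∧ (∀ j, ‖r₂' j‖ ≤ fluxK F 0 * R) ∧
      ((∀ j, r₁ j = 0 ∧ r₂ j = 0) → ∀ j, r₁' j = 0 ∧ r₂' j = 0) ∧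
      ∀ φ : Fin N → ℝ → ℂ, (∀ j, fl1 F 𝓜.rho s φ j = r₁' j ∧ fl2 F 𝓜.rho s φ j = r₂' j) →
        ∀ j, fl1 F 𝓜.rho nxt φ j = r₁ j ∧ fl2 F 𝓜.rho nxt φ j = r₂ j
  neighbor : p = 0 → ∀ j, 𝓜.len (j + 1) = 𝓜.len j →
    ∃ π : Fin N → Fin N, π j = j + 1 ∧ Compat π s 𝓜.rho ∧ NeighborMap 𝓜 π ∧
      (∀ i, 𝓜.len (π i) = 𝓜.len i) ∧ Stable k F 𝓜.rho s π 𝓜.size 0 K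

section GoodLemmas

variable {a b : ℝ} {N : ℕ} [NeZero N] {k : ℕ} {F : Flux} {𝓜 : Mesh a b N}

lemma Good.compat {s : Fin N → Fin N} {p : ℕ} {K : ℝ} (h : Good k F 𝓜 s p K) :
    Compat s s 𝓜.rho := ⟨fun _ => rfl, fun j => by rw [Mesh.rho, Mesh.rho, h.len_s]⟩

/-- The matrices A⁻, with rows (1/2 + α, -β₂) and (-β₁, 1/2 - α), and A⁺ = 1 - A⁻ satisfy A⁻A⁺ = 0
exactly when α² + β₁β₂ = 1/4. The flux A⁻x + A⁺y then determines A⁻x and A⁺y separately, so the two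
ends of one cell may be paired instead of the two sides of one interface, and the coupling becomes
`id`. Exchanging two adjacent cells of equal length is then a symmetry. -/
lemma good_local {K : ℝ} (hF : F.α₁ ^ 2 + F.β₁ * F.β₂ = 1 / 4)
    (H : Stable k F 𝓜.rho id id 𝓜.size 0 K) : Good k F 𝓜 id 0 K := by
  have hFC : (F.α₁ : ℂ) ^ 2 + F.β₁ * F.β₂ = 1 / 4 := by
    have := congrArg (Complex.ofReal) hF
    push_cast at this
    exact this
  set α : ℂ := (F.α₁ : ℂ) with hα
  set β₁ : ℂ := (F.β₁ : ℂ) with hβ₁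
  set β₂ : ℂ := (F.β₂ : ℂ) with hβ₂
  -- the rank one parts of the fluxes
  have key : ∀ (φ : Fin N → ℝ → ℂ) (i j : Fin N) (x₁ x₂ y₁ y₂ : ℂ),
      (1 / 2 + α) * φ i 1 - β₂ * (𝓜.rho i * deriv (φ i) 1)
        + (1 / 2 - α) * φ j 0 + β₂ * (𝓜.rho j * deriv (φ j) 0)
        = ((1 / 2 + α) * x₁ - β₂ * x₂) + ((1 / 2 - α) * y₁ + β₂ * y₂) →
      -β₁ * φ i 1 + (1 / 2 - α) * (𝓜.rho i * deriv (φ i) 1)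
        + β₁ * φ j 0 + (1 / 2 + α) * (𝓜.rho j * deriv (φ j) 0)
        = (-β₁ * x₁ + (1 / 2 - α) * x₂) + (β₁ * y₁ + (1 / 2 + α) * y₂) →
      ((1 / 2 + α) * φ i 1 - β₂ * (𝓜.rho i * deriv (φ i) 1) = (1 / 2 + α) * x₁ - β₂ * x₂ ∧
      -β₁ * φ i 1 + (1 / 2 - α) * (𝓜.rho i * deriv (φ i) 1) = -β₁ * x₁ + (1 / 2 - α) * x₂) ∧
      ((1 / 2 - α) * φ j 0 + β₂ * (𝓜.rho j * deriv (φ j) 0) = (1 / 2 - α) * y₁ + β₂ * y₂ ∧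
      β₁ * φ j 0 + (1 / 2 + α) * (𝓜.rho j * deriv (φ j) 0) = β₁ * y₁ + (1 / 2 + α) * y₂) := by
    intro φ i j x₁ x₂ y₁ y₂ h1 h2
    refine ⟨⟨?_, ?_⟩, ?_, ?_⟩
    · linear_combination (1 / 2 + α) * h1 - β₂ * h2 -
        (φ i 1 - x₁ - φ j 0 + y₁) * hFC
    · linear_combination -β₁ * h1 + (1 / 2 - α) * h2 -
        (𝓜.rho i * deriv (φ i) 1 - x₂ - 𝓜.rho j * deriv (φ j) 0 + y₂) * hFC
    · linear_combination (1 / 2 - α) * h1 + β₂ * h2 +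
        (φ i 1 - x₁ - φ j 0 + y₁) * hFC
    · linear_combination β₁ * h1 + (1 / 2 + α) * h2 +
        (𝓜.rho i * deriv (φ i) 1 - x₂ - 𝓜.rho j * deriv (φ j) 0 + y₂) * hFC
  refine ⟨fun j => rfl, H, Or.inl rfl, fun φ hφ => ?_, fun r₁ r₂ R h1 h2 => ?_,
    fun _ j hj => ?_⟩
  · have hL : ∀ j, ((1 / 2 + α) * φ j 1 - β₂ * (𝓜.rho j * deriv (φ j) 1) = 0 ∧
        -β₁ * φ j 1 + (1 / 2 - α) * (𝓜.rho j * deriv (φ j) 1) = 0) ∧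
        ((1 / 2 - α) * φ (j + 1) 0 + β₂ * (𝓜.rho (j + 1) * deriv (φ (j + 1)) 0) = 0 ∧
        β₁ * φ (j + 1) 0 + (1 / 2 + α) * (𝓜.rho (j + 1) * deriv (φ (j + 1)) 0) = 0) := by
      intro j
      have := key φ j (j + 1) 0 0 0 0 (by simpa [fl1, nxt] using (hφ j).1)
        (by simpa [fl2, nxt] using (hφ j).2)
      simpa using this
    intro j
    have h1 := (hL j).1
    have h2 := (hL (j - 1)).2
    rw [sub_add_cancel] at h2
    constructor
    · rw [fl1, id]
      linear_combination h1.1 + h2.1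
    · rw [fl2, id]
      linear_combination h1.2 + h2.2
  · obtain ⟨n1, n2, n3, n4⟩ := norm_flux_coef_le F
    have hR : 0 ≤ R := (norm_nonneg _).trans (h1 0)
    have hmul : ∀ {c r : ℂ}, ‖c‖ ≤ 1 + |F.α₁| + |F.β₁| + |F.β₂| → ‖r‖ ≤ R →
        ‖c * r‖ ≤ (1 + |F.α₁| + |F.β₁| + |F.β₂|) * R := fun hc hr => by
      rw [norm_mul]
      exact mul_le_mul hc hr (norm_nonneg _) (by positivity)
    have hK : fluxK F 0 * R = ((1 + |F.α₁| + |F.β₁| + |F.β₂|) * R +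
        (1 + |F.α₁| + |F.β₁| + |F.β₂|) * R) + ((1 + |F.α₁| + |F.β₁| + |F.β₂|) * R +
        (1 + |F.α₁| + |F.β₁| + |F.β₂|) * R) := by
      rw [fluxK]; ring
    -- The data on cell j are A⁻ r_j + A⁺ r_{j-1}: its right end belongs to the interface j and its
    -- left end to the interface j - 1.
    refine ⟨fun j => ((1 / 2 + α) * r₁ j - β₂ * r₂ j) + ((1 / 2 - α) * r₁ (j - 1) + β₂ * r₂ (j - 1)),
      fun j => (-β₁ * r₁ j + (1 / 2 - α) * r₂ j) + (β₁ * r₁ (j - 1) + (1 / 2 + α) * r₂ (j - 1)),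
      ?_, ?_, fun h0 j => ?_, fun φ hφ j => ?_⟩
    · intro j
      rw [hK]
      exact (norm_add_le _ _).trans (add_le_add
        ((norm_sub_le _ _).trans (add_le_add (hmul n1 (h1 _)) (hmul n4 (h2 _))))
        ((norm_add_le _ _).trans (add_le_add (hmul n2 (h1 _)) (hmul n4 (h2 _)))))
    · intro j
      rw [hK]
      exact (norm_add_le _ _).trans (add_le_add
        ((norm_add_le _ _).trans (add_le_add (hmul (by rwa [norm_neg]) (h1 _)) (hmul n2 (h2 _))))
        ((norm_add_le _ _).trans (add_le_add (hmul n3 (h1 _)) (hmul n1 (h2 _)))))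
    · simp [(h0 j).1, (h0 j).2, (h0 (j - 1)).1, (h0 (j - 1)).2]
    · have k1 := key φ j j (r₁ j) (r₂ j) (r₁ (j - 1)) (r₂ (j - 1)) (hφ j).1 (hφ j).2
      have k2 := key φ (j + 1) (j + 1) (r₁ (j + 1)) (r₂ (j + 1)) (r₁ (j + 1 - 1)) (r₂ (j + 1 - 1))
        (hφ (j + 1)).1 (hφ (j + 1)).2
      rw [add_sub_cancel_right] at k2
      constructor
      · rw [fl1, nxt]
        linear_combination k1.1.1 + k2.2.1
      · rw [fl2, nxt]
        linear_combination k1.1.2 + k2.2.2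
  · refine ⟨Equiv.swap j (j + 1), Equiv.swap_apply_left _ _, ⟨fun _ => rfl, fun i => ?_⟩,
      fun i => ?_, fun i => ?_, H⟩
    · rw [Mesh.rho, Mesh.rho]
      congr 1
      rcases eq_or_ne i j with rfl | h1
      · rw [Equiv.swap_apply_left, hj]
      rcases eq_or_ne i (j + 1) with rfl | h2
      · rw [Equiv.swap_apply_right, hj]
      rw [Equiv.swap_apply_of_ne_of_ne h1 h2]
    · rcases eq_or_ne i j with rfl | h1
      · rw [Equiv.swap_apply_left]
        exact Or.inr (Or.inl ⟨rfl, hj⟩)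
      rcases eq_or_ne i (j + 1) with rfl | h2
      · rw [Equiv.swap_apply_right]
        exact Or.inr (Or.inr ⟨rfl, hj⟩)
      exact Or.inl (Equiv.swap_apply_of_ne_of_ne h1 h2)
    · rcases eq_or_ne i j with rfl | h1
      · rw [Equiv.swap_apply_left, hj]
      rcases eq_or_ne i (j + 1) with rfl | h2
      · rw [Equiv.swap_apply_right, hj]
      rw [Equiv.swap_apply_of_ne_of_ne h1 h2]

lemma Mesh.Uniform.rho_eq (h : 𝓜.Uniform) : 𝓜.rho = fun _ => 1 := by
  funext j
  rw [Mesh.rho, h j, div_self 𝓜.size_pos.ne']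

lemma one_le_fluxK (F : Flux) : 1 ≤ fluxK F 0 := by
  have := abs_nonneg F.α₁
  have := abs_nonneg F.β₁
  have := abs_nonneg F.β₂
  rw [fluxK]
  linarith

/-- The original coupling `nxt` is kept, and on a uniform mesh the shift is itself a symmetry. -/
lemma good_uniform {p : ℕ} {K : ℝ} (hu : 𝓜.Uniform)
    (H : Stable k F (fun _ : Fin N => 1) nxt nxt 𝓜.size p K) : Good k F 𝓜 nxt p K := by
  have hl : ∀ i j, 𝓜.len i = 𝓜.len j := fun i j => by rw [hu i, hu j]
  refine ⟨fun j => hl _ _, by rwa [hu.rho_eq], Or.inr rfl, fun φ h => h,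
    fun r₁ r₂ R h1 h2 => ⟨r₁, r₂, fun j => ?_, fun j => ?_, fun h => h, fun φ h => h⟩,
    fun hp j _ => ⟨nxt, rfl, ⟨fun _ => rfl, fun j => ?_⟩, fun i => Or.inr (Or.inl ⟨rfl, hl _ _⟩),
      fun i => hl _ _, ?_⟩⟩
  · exact (h1 j).trans (le_mul_of_one_le_left ((norm_nonneg _).trans (h1 j)) (one_le_fluxK F))
  · exact (h2 j).trans (le_mul_of_one_le_left ((norm_nonneg _).trans (h1 j)) (one_le_fluxK F))
  · rw [hu.rho_eq]
  · rw [hu.rho_eq]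
    subst hp
    exact H

lemma lam_eq {h : ℝ} (hpos : 0 < h) : Lam k F h = lam0 k F / h := by
  rw [Lam, lam0]
  field_simp

/-- Both quantities scale like 1/h, so the quotient depends on the flux and k only. Hence τ and the
roots of the recurrence are the same for all uniform meshes. -/
lemma ratio_eq : ratio k F 𝓜 = gam0 k F / lam0 k F := by
  have := 𝓜.size_pos
  rw [ratio, 𝓜.gam_eq k F rfl this, lam_eq this, div_div_div_cancel_right₀ this.ne']

lemma lam0_ne_zero (hk : 2 ≤ k) (hF : F.α₁ ^ 2 + F.β₁ * F.β₂ ≠ 1 / 4) : lam0 k F ≠ 0 := by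
  have : (k : ℝ) ≠ 0 := by exact_mod_cast (by omega : k ≠ 0)
  rw [lam0]
  exact mul_ne_zero (neg_ne_zero.2 (mul_ne_zero two_ne_zero this)) (sub_ne_zero.2 hF)

end GoodLemmas

/-- Stability in all cases, with a constant that does not depend on the mesh. -/
lemma exists_good (k : ℕ) (hk : 2 ≤ k) (a b σ δ : ℝ) (hδ : 0 < δ) (F : Flux) :
    ∃ K : ℝ, 0 ≤ K ∧ ∀ (N : ℕ) [NeZero N] (𝓜 : Mesh a b N), 𝓜.Regular σ → Margin k F 𝓜 δ →
      (AssumptionA1 k F 𝓜 ∨ AssumptionA2 k F 𝓜 → ∃ s, Good k F 𝓜 s 0 K) ∧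
      (AssumptionA3lt k F 𝓜 → ∃ s, Good k F 𝓜 s 1 K) ∧
      (AssumptionA3eq k F 𝓜 → ∃ s, Good k F 𝓜 s 2 K) := by
  by_cases hF : F.α₁ ^ 2 + F.β₁ * F.β₂ = 1 / 4
  · obtain ⟨K, hK, H⟩ := exists_stable_local hk hF σ hδ
    refine ⟨K, hK, fun N _ 𝓜 hreg hmar => ⟨fun hA => ?_, fun hA => absurd hF hA.2.1,
      fun hA => absurd hF hA.2.1⟩⟩
    have hA1 : AssumptionA1 k F 𝓜 := hA.resolve_right fun h => h.2.1 hF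
    refine ⟨id, good_local hF (H 𝓜.rho (fun j => ⟨𝓜.one_le_rho j, (hreg j).le⟩) (fun j => ?_) _ _)⟩
    have h1 := hmar.1 hA1 j
    have hl := 𝓜.len_pos j
    have hs := 𝓜.size_pos
    -- Under A1 the last bracket in Γ_j equals 1/2, which turns 2k² into k².
    have e1 : 𝓜.len j * Gam k F 𝓜 (𝓜.len j) = F.β₁ / 𝓜.rho j
        + F.β₂ * 𝓜.rho j * ((k : ℝ) ^ 2 * ((k : ℝ) ^ 2 - 1)) - (k : ℝ) ^ 2 := by
      rw [Gam, hF, Mesh.rho]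
      field_simp
      ring
    rw [← e1, abs_mul, abs_of_pos hl]
    exact h1
  · have hl0 := lam0_ne_zero hk hF
    set r := gam0 k F / lam0 k F with hr
    set τ : ℝ := 2 * (-1) ^ k * r with hτ
    have hτabs : |τ| = 2 * |r| := by
      rw [hτ, abs_mul, abs_mul, abs_pow]
      simp
    set z : ℂ := (((-1) ^ (k + 1) * r : ℝ) : ℂ) + Complex.I * (Real.sqrt (1 - r ^ 2) : ℂ) with hz
    have hzre : z.re = (-1) ^ (k + 1) * r := by
      rw [hz, Complex.add_re, Complex.ofReal_re]
      simp
    have hzim : z.im = Real.sqrt (1 - r ^ 2) := by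
      rw [hz, Complex.add_im, Complex.ofReal_im]
      simp
    have hτz : τ = -2 * z.re := by rw [hzre, hτ, pow_succ]; ring
    -- Constants for the three kinds of recurrence. Outside its own case such a quotient may be
    -- negative or have a vanishing denominator, so only absolute values enter the common bound.
    set K₂ : ℝ := 1 / (|τ| - 2) with hK₂
    set K₃ : ℝ := (1 + (b - a) / δ) / ‖1 - z‖ / |z.im| with hK₃
    set K₄ : ℝ := (1 + (b - a) / 2) / 2 * ((1 + (b - a) / 2) / 2) with hK₄
    obtain ⟨c₂, hc₂, H₂⟩ := exists_stable_uniform hk hl0 (K := |K₂| + |K₃| + |K₄|)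
    refine ⟨(|K₂| + |K₃| + |K₄|) * c₂, by positivity, fun N _ 𝓜 hreg hmar => ?_⟩
    have mono : ∀ {p : ℕ} {t K K' : ℝ}, RecStable (nxt : Fin N → Fin N) 𝓜.size p t K → K ≤ K' →
        RecStable (nxt : Fin N → Fin N) 𝓜.size p t K' := fun h hle x R hb j =>
      (h x R hb j).trans (mul_le_mul_of_nonneg_right hle ((norm_nonneg _).trans (hb.norm_le j)))
    have p2 := abs_nonneg K₂
    have p3 := abs_nonneg K₃
    have p4 := abs_nonneg K₄
    have q2 := le_abs_self K₂
    have q3 := le_abs_self K₃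
    have q4 := le_abs_self K₄
    refine ⟨fun hA => ?_, fun hA => ?_, fun hA => ?_⟩
    · have hA2 : AssumptionA2 k F 𝓜 := hA.resolve_left fun h => hF h.1
      refine ⟨nxt, good_uniform hA2.1 (H₂ nxt _ 0 𝓜.size_pos.le (mono (recStable_of_two_lt
        nxt_surjective _ ?_) (by linarith)))⟩
      have := hA2.2.2
      rw [ratio_eq] at this
      rw [hτabs]
      linarith
    · have hlt := hA.2.2.1
      rw [ratio_eq, ← hr] at hlt
      have hr2 : r ^ 2 < 1 := (sq_lt_one_iff_abs_lt_one r).2 hlt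
      have hzn : ‖z‖ = 1 := by
        have : ‖z‖ ^ 2 = 1 := by
          rw [← Complex.normSq_eq_norm_sq, Complex.normSq_apply, hzre, hzim, ← sq, ← sq,
            Real.sq_sqrt (by linarith), mul_pow, ← pow_mul, mul_comm (k + 1), pow_mul]
          simp
        nlinarith [norm_nonneg z]
      have hlam : lam k F 𝓜 = z := by rw [lam, ratio_eq]
      have hm := hmar.2 hA
      rw [hlam] at hm
      have him : z.im ≠ 0 := by
        rw [hzim]
        exact (Real.sqrt_pos.2 (by linarith)).ne'
      have := recStable_of_lt_two (s := (nxt : Fin N → Fin N)) (h := 𝓜.size) nxt_iterate hzn hδ hm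
        hA.1.card_mul_size him
      rw [← hτz] at this
      exact ⟨nxt, good_uniform hA.1 (H₂ nxt _ 1 𝓜.size_pos.le (mono this (by linarith)))⟩
    · obtain ⟨hu, -, hr1, hrN, hodd⟩ := hA
      rw [ratio_eq, ← hr] at hr1 hrN
      -- The condition on the N-th power excludes the double root 1, so the double root is -1.
      have hτ2 : τ = 2 := by
        have e1 : (-1) ^ (k + 1) * r = 1 ∨ (-1) ^ (k + 1) * r = -1 := by
          rw [← abs_eq zero_le_one, abs_mul, abs_pow, hr1]
          simp
        rcases e1 with e1 | e1
        · rw [e1, one_pow] at hrN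
          exact absurd rfl hrN
        · rw [hτz, hzre, e1]
          norm_num
      have : RecStable (nxt : Fin N → Fin N) 𝓜.size 2 τ K₄ := by
        rw [hτ2]
        exact recStable_two nxt_iterate hodd hu.card_mul_size
      exact ⟨nxt, good_uniform hu (H₂ nxt _ 2 𝓜.size_pos.le (mono this (by linarith)))⟩

/-! ### Regularity in time of the spatial derivatives of u. -/

lemma hasDerivAt_iteratedDeriv {f : ℝ → ℂ} {n : ℕ} (hf : ContDiff ℝ (n + 1 : ℕ) f) (x : ℝ) :
    HasDerivAt (iteratedDeriv n f) (iteratedDeriv (n + 1) f x) x := by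
  rw [iteratedDeriv_succ]
  exact ((hf.differentiable_iteratedDeriv n (by exact_mod_cast Nat.lt_succ_self n)) x).hasDerivAt

lemma norm_iteratedDeriv_sub_le {f : ℝ → ℂ} {n : ℕ} (hf : ContDiff ℝ (n + 1 : ℕ) f) {B : ℝ}
    (hB : ∀ x, ‖iteratedDeriv (n + 1) f x‖ ≤ B) (x y : ℝ) :
    ‖iteratedDeriv n f y - iteratedDeriv n f x‖ ≤ B * |y - x| := by
  have := convex_univ.norm_image_sub_le_of_norm_hasDerivWithin_le (s := Set.univ) (x := x) (y := y)
    (fun x _ => (hasDerivAt_iteratedDeriv hf x).hasDerivWithinAt) (fun x _ => hB x)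
    (Set.mem_univ _) (Set.mem_univ _)
  simpa using this

/-- Difference quotient in space. -/
def diffQ (η : ℝ) (f : ℝ → ℂ) : ℝ → ℂ := fun x => (η⁻¹ : ℂ) * (f (x + η) - f x)

lemma ContDiff.diffQ {f : ℝ → ℂ} {n : ℕ} (hf : ContDiff ℝ n f) (η : ℝ) :
    ContDiff ℝ n (diffQ η f) :=
  contDiff_const.mul ((hf.comp (contDiff_id.add contDiff_const)).sub hf)

lemma iteratedDeriv_diffQ {f : ℝ → ℂ} {n : ℕ} (hf : ContDiff ℝ n f) (η : ℝ) :
    iteratedDeriv n (diffQ η f) = diffQ η (iteratedDeriv n f) := by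
  have h1 : ContDiff ℝ n fun x => f (x + η) := hf.comp (contDiff_id.add contDiff_const)
  funext x
  unfold diffQ
  rw [iteratedDeriv_const_mul_field, iteratedDeriv_fun_sub h1.contDiffAt hf.contDiffAt,
    iteratedDeriv_comp_add_const]

lemma norm_iteratedDeriv_diffQ_le {f : ℝ → ℂ} {n : ℕ} (hf : ContDiff ℝ (n + 1 : ℕ) f) {B : ℝ}
    (hB : ∀ x, ‖iteratedDeriv (n + 1) f x‖ ≤ B) {η : ℝ} (hη : η ≠ 0) (x : ℝ) :
    ‖iteratedDeriv n (diffQ η f) x‖ ≤ B := by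
  rw [iteratedDeriv_diffQ (hf.of_le (by exact_mod_cast Nat.le_succ n)), diffQ, norm_mul]
  have := norm_iteratedDeriv_sub_le hf hB x (x + η)
  rw [add_sub_cancel_left] at this
  rw [norm_inv, Complex.norm_real, Real.norm_eq_abs]
  have h0 : 0 < |η| := abs_pos.2 hη
  calc |η|⁻¹ * ‖iteratedDeriv n f (x + η) - iteratedDeriv n f x‖ ≤ |η|⁻¹ * (B * |η|) :=
        mul_le_mul_of_nonneg_left this (inv_nonneg.2 h0.le)
    _ = B := by field_simp

lemma tendsto_iteratedDeriv_diffQ {f : ℝ → ℂ} {n : ℕ} (hf : ContDiff ℝ (n + 1 : ℕ) f) (x : ℝ) :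
    Filter.Tendsto (fun η => iteratedDeriv n (diffQ η f) x) (nhdsWithin 0 {0}ᶜ)
      (nhds (iteratedDeriv (n + 1) f x)) := by
  have h1 := (hasDerivAt_iteratedDeriv hf x).tendsto_slope_zero
  refine h1.congr fun η => ?_
  rw [iteratedDeriv_diffQ (hf.of_le (by exact_mod_cast Nat.le_succ n)), diffQ, Complex.real_smul]
  push_cast
  rfl

/-- `u` satisfies the Schrödinger equation pointwise on `[0, T]`. -/
def Solves (T : ℝ) (u : ℝ → ℝ → ℂ) : Prop :=
  ∀ t ∈ Set.Icc 0 T, ∀ x, HasDerivWithinAt (fun τ => u τ x)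
    (Complex.I * iteratedDeriv 2 (u t) x) (Set.Icc 0 T) t

lemma IsExactSolution.solves {a b T : ℝ} {u : ℝ → ℝ → ℂ} (h : IsExactSolution a b T u) :
    Solves T u := by
  intro t ht x
  have h1 := (h.differentiable x t ht).hasDerivWithinAt
  have h2 := h.eqn t ht x
  have h3 : derivWithin (fun τ => u τ x) (Set.Icc 0 T) t = Complex.I * iteratedDeriv 2 (u t) x := by
    linear_combination (-Complex.I) * h2 + (derivWithin (fun τ => u τ x) (Set.Icc 0 T) t) * Complex.I_mul_I
  rwa [h3] at h1

/-- The equation is linear and invariant under translations in x. Difference quotients therefore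
stand in for spatial derivatives of u, whose differentiability in time is not assumed. -/
lemma Solves.diffQ {T : ℝ} {u : ℝ → ℝ → ℂ} (h : Solves T u)
    (hc : ∀ t ∈ Set.Icc 0 T, ContDiff ℝ 2 (u t)) (η : ℝ) : Solves T fun t => diffQ η (u t) := by
  intro t ht x
  have e1 : iteratedDeriv 2 (UWDG.diffQ η (u t)) x = UWDG.diffQ η (iteratedDeriv 2 (u t)) x := by
    rw [iteratedDeriv_diffQ (hc t ht)]
  rw [e1]
  have := ((h t ht (x + η)).sub (h t ht x)).const_mul (η⁻¹ : ℂ)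
  unfold UWDG.diffQ
  refine this.congr_deriv ?_
  ring

lemma ContDiff.of_nat_le {f : ℝ → ℂ} {m n : ℕ} (hf : ContDiff ℝ n f) (h : m ≤ n) :
    ContDiff ℝ m f := hf.of_le (by exact_mod_cast h)

/-- Spatial derivatives are Lipschitz in time. -/
lemma Solves.lipschitz {T : ℝ} {u : ℝ → ℝ → ℂ} (h : Solves T u) (m : ℕ)
    (hc : ∀ t ∈ Set.Icc 0 T, ContDiff ℝ (m + 2 : ℕ) (u t)) {B : ℝ}
    (hB : ∀ t ∈ Set.Icc 0 T, ∀ x, ‖iteratedDeriv (m + 2) (u t) x‖ ≤ B) :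
    ∀ t ∈ Set.Icc 0 T, ∀ t' ∈ Set.Icc 0 T, ∀ x,
      ‖iteratedDeriv m (u t') x - iteratedDeriv m (u t) x‖ ≤ B * |t' - t| := by
  induction m generalizing u with
  | zero =>
    intro t ht t' ht' x
    have := (convex_Icc 0 T).norm_image_sub_le_of_norm_hasDerivWithin_le (C := B)
      (fun τ hτ => h τ hτ x) (fun τ hτ => by simpa using hB τ hτ x) ht ht'
    simpa using this
  | succ m ih =>
    intro t ht t' ht' x
    have hc' : ∀ t ∈ Set.Icc 0 T, ContDiff ℝ (m + 1 : ℕ) (u t) := fun t ht =>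
      (hc t ht).of_nat_le (by omega)
    -- The bound of order m holds for the difference quotient with a constant independent of η, so
    -- it survives the limit η → 0.
    refine le_of_tendsto (((tendsto_iteratedDeriv_diffQ (hc' t' ht') x).sub
      (tendsto_iteratedDeriv_diffQ (hc' t ht) x)).norm) ?_
    filter_upwards [self_mem_nhdsWithin] with η hη
    refine ih (h.diffQ (fun t ht => ContDiff.of_nat_le (m := 2) (hc t ht) (by omega)) η)
      (fun t ht => ((hc t ht).of_nat_le (by omega)).diffQ η) (fun t ht x => ?_) t ht t' ht' x
    exact norm_iteratedDeriv_diffQ_le ((hc t ht).of_nat_le (by omega)) (hB t ht) hη x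

/-- First order Taylor expansion in time of spatial derivatives. -/
lemma Solves.taylor {T : ℝ} {u : ℝ → ℝ → ℂ} (h : Solves T u) (m : ℕ)
    (hc : ∀ t ∈ Set.Icc 0 T, ContDiff ℝ (m + 4 : ℕ) (u t)) {B : ℝ}
    (hB : ∀ t ∈ Set.Icc 0 T, ∀ x, ‖iteratedDeriv (m + 4) (u t) x‖ ≤ B) :
    ∀ t ∈ Set.Icc 0 T, ∀ t' ∈ Set.Icc 0 T, ∀ x,
      ‖iteratedDeriv m (u t') x - iteratedDeriv m (u t) x
        - (t' - t : ℝ) * (Complex.I * iteratedDeriv (m + 2) (u t) x)‖ ≤ B * |t' - t| ^ 2 := by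
  induction m generalizing u with
  | zero =>
    intro t ht t' ht' x
    -- Mean value inequality for u(τ) - (τ - t) i u_xx(t), whose τ-derivative is small because u_xx
    -- is Lipschitz in time.
    have hlip := h.lipschitz 2 hc hB
    have hsub : Set.uIcc t t' ⊆ Set.Icc 0 T := Set.uIcc_subset_Icc ht ht'
    have hd : ∀ τ ∈ Set.uIcc t t', HasDerivWithinAt
        (fun τ => u τ x - ((τ - t : ℝ) : ℂ) * (Complex.I * iteratedDeriv 2 (u t) x))
        (Complex.I * iteratedDeriv 2 (u τ) x - Complex.I * iteratedDeriv 2 (u t) x)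
        (Set.uIcc t t') τ := by
      intro τ hτ
      have h1 := (h τ (hsub hτ) x).mono hsub
      have h2 : HasDerivWithinAt (fun τ : ℝ => ((τ - t : ℝ) : ℂ)) 1 (Set.uIcc t t') τ := by
        have := ((hasDerivAt_id τ).sub_const t).ofReal_comp
        simpa using this.hasDerivWithinAt
      have := h1.sub (h2.mul_const (Complex.I * iteratedDeriv 2 (u t) x))
      rwa [one_mul] at this
    have := (convex_uIcc t t').norm_image_sub_le_of_norm_hasDerivWithin_le (C := B * |t' - t|) hd
      (fun τ hτ => by
        rw [← mul_sub, norm_mul, Complex.norm_I, one_mul]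
        refine (hlip t ht τ (hsub hτ) x).trans ?_
        have hB0 : 0 ≤ B := (norm_nonneg _).trans (hB t ht x)
        exact mul_le_mul_of_nonneg_left (Set.abs_sub_left_of_mem_uIcc hτ) hB0)
      Set.left_mem_uIcc Set.right_mem_uIcc
    simp only [sub_self, Complex.ofReal_zero, zero_mul, sub_zero, Real.norm_eq_abs] at this
    simp only [iteratedDeriv_zero]
    calc _ = _ := by congr 1; ring
      _ ≤ _ := this
      _ = _ := by ring
  | succ m ih =>
    intro t ht t' ht' x
    have hc' : ∀ n, n ≤ m + 5 → ∀ t ∈ Set.Icc 0 T, ContDiff ℝ n (u t) := fun n hn t ht =>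
      (hc t ht).of_nat_le (by omega)
    refine le_of_tendsto ((((tendsto_iteratedDeriv_diffQ (hc' (m + 1) (by omega) t' ht') x).sub
      (tendsto_iteratedDeriv_diffQ (hc' (m + 1) (by omega) t ht) x)).sub
      ((tendsto_iteratedDeriv_diffQ (hc' (m + 2 + 1) (by omega) t ht) x).const_mul
        (Complex.I) |>.const_mul (((t' - t : ℝ) : ℂ)))).norm) ?_
    filter_upwards [self_mem_nhdsWithin] with η hη
    refine ih (h.diffQ (hc' 2 (by omega)) η)
      (fun t ht => (hc' (m + 4) (by omega) t ht).diffQ η) (fun t ht x => ?_) t ht t' ht' x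
    exact norm_iteratedDeriv_diffQ_le (hc' (m + 4 + 1) (by omega) t ht) (hB t ht) hη x

lemma periodic_iteratedDeriv {f : ℝ → ℂ} {L : ℝ} (hf : Function.Periodic f L) (n : ℕ) :
    Function.Periodic (iteratedDeriv n f) L := by
  intro x
  have h1 : (fun x => f (x + L)) = f := funext hf
  have := congrFun (congrArg (iteratedDeriv n) h1) x
  rwa [iteratedDeriv_comp_add_const] at this

/-- Derivatives of a periodic function are controlled by higher derivatives. -/
lemma norm_iteratedDeriv_le_of_periodic {f : ℝ → ℂ} {L : ℝ} (hL : 0 < L)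
    (hf : Function.Periodic f L) {n : ℕ} (hn : 1 ≤ n) (hc : ContDiff ℝ (n + 1 : ℕ) f) {B : ℝ}
    (hB : ∀ x, ‖iteratedDeriv (n + 1) f x‖ ≤ B) (x : ℝ) : ‖iteratedDeriv n f x‖ ≤ L * B := by
  obtain ⟨m, rfl⟩ : ∃ m, n = m + 1 := ⟨n - 1, by omega⟩
  have hcont : Continuous (iteratedDeriv (m + 1) f) :=
    hc.continuous_iteratedDeriv (m + 1) (by exact_mod_cast Nat.le_succ _)
  -- A derivative of order at least one has mean zero over a period. The function itself need not,
  -- hence the restriction 1 ≤ n.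
  have h0 : ∫ y in x..x + L, iteratedDeriv (m + 1) f y = 0 := by
    rw [intervalIntegral.integral_eq_sub_of_hasDerivAt
      (fun y _ => hasDerivAt_iteratedDeriv (hc.of_nat_le (by omega)) y)
      (hcont.intervalIntegrable _ _), periodic_iteratedDeriv hf m x, sub_self]
  have h1 : ∫ y in x..x + L, (iteratedDeriv (m + 1) f x - iteratedDeriv (m + 1) f y)
      = L * iteratedDeriv (m + 1) f x := by
    rw [intervalIntegral.integral_sub (continuous_const.intervalIntegrable _ _)
      (hcont.intervalIntegrable _ _), h0, intervalIntegral.integral_const]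
    simp
  have h2 : ‖∫ y in x..x + L, (iteratedDeriv (m + 1) f x - iteratedDeriv (m + 1) f y)‖
      ≤ B * L * |x + L - x| := by
    refine intervalIntegral.norm_integral_le_of_norm_le_const fun y hy => ?_
    rw [Set.uIoc_of_le (by linarith)] at hy
    refine (norm_iteratedDeriv_sub_le hc hB y x).trans ?_
    have hB0 : 0 ≤ B := (norm_nonneg _).trans (hB 0)
    refine mul_le_mul_of_nonneg_left ?_ hB0
    rw [abs_le]
    constructor <;> linarith [hy.1, hy.2]
  rw [h1, norm_mul, Complex.norm_real, Real.norm_of_nonneg hL.le, add_sub_cancel_left,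
    abs_of_pos hL] at h2
  have : L * ‖iteratedDeriv (m + 1) f x‖ ≤ L * (L * B) := by linarith
  exact le_of_mul_le_mul_left this hL

lemma norm_iteratedDeriv_le_pow {f : ℝ → ℂ} {L : ℝ} (hL : 0 < L)
    (hf : Function.Periodic f L) {n : ℕ} (hc : ContDiff ℝ n f) {B : ℝ}
    (hB : ∀ x, ‖iteratedDeriv n f x‖ ≤ B) {i : ℕ} (hi : 1 ≤ i) (hin : i ≤ n) (x : ℝ) :
    ‖iteratedDeriv i f x‖ ≤ (1 + L) ^ n * B := by
  have hB0 : 0 ≤ B := (norm_nonneg _).trans (hB 0)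
  have key : ∀ d, ∀ i, 1 ≤ i → i + d = n → ∀ x, ‖iteratedDeriv i f x‖ ≤ (1 + L) ^ d * B := by
    intro d
    induction d with
    | zero =>
      intro i _ h x
      rw [add_zero] at h
      subst h
      simpa using hB x
    | succ d ih =>
      intro i hi h x
      have h1 := norm_iteratedDeriv_le_of_periodic hL hf hi (hc.of_nat_le (by omega))
        (ih (i + 1) (by omega) (by omega)) x
      refine h1.trans ?_
      rw [pow_succ']
      have : 0 ≤ (1 + L) ^ d * B := by positivity
      nlinarith
  refine (key (n - i) i hi (by omega) x).trans ?_
  exact mul_le_mul_of_nonneg_right (pow_le_pow_right₀ (by linarith) (by omega)) hB0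

/-! ### Passage to reference coordinates. -/

section Ref

variable {a b : ℝ} {N : ℕ}

/-- A function in the reference coordinate of the cells. -/
def Mesh.ref (𝓜 : Mesh a b N) (f : ℝ → ℂ) (j : Fin N) : ℝ → ℂ :=
  fun ξ => f (𝓜.xL j + 𝓜.len j * ξ)

variable (𝓜 : Mesh a b N)

lemma Mesh.contDiff_ref {f : ℝ → ℂ} {n : WithTop ℕ∞} (hf : ContDiff ℝ n f) (j : Fin N) :
    ContDiff ℝ n (𝓜.ref f j) :=
  hf.comp (contDiff_const.add (contDiff_const.mul contDiff_id))

lemma Mesh.iteratedDeriv_ref {f : ℝ → ℂ} {n : ℕ} (hf : ContDiff ℝ n f) (j : Fin N) :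
    iteratedDeriv n (𝓜.ref f j)
      = fun ξ => (𝓜.len j : ℂ) ^ n * 𝓜.ref (iteratedDeriv n f) j ξ := by
  have h1 : ContDiff ℝ n fun y => f (𝓜.xL j + y) := hf.comp (contDiff_const.add contDiff_id)
  have h2 := iteratedDeriv_comp_const_smul h1 (𝓜.len j)
  have h3 : 𝓜.ref f j = fun x => f (𝓜.xL j + 𝓜.len j * x) := rfl
  rw [h3, h2]
  funext ξ
  rw [iteratedDeriv_comp_const_add]
  simp [Mesh.ref]

lemma Mesh.deriv_ref {f : ℝ → ℂ} (hf : ContDiff ℝ 1 f) (j : Fin N) :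
    deriv (𝓜.ref f j) = fun ξ => (𝓜.len j : ℂ) * 𝓜.ref (deriv f) j ξ := by
  have := 𝓜.iteratedDeriv_ref (n := 1) hf j
  simpa [iteratedDeriv_one] using this

lemma Mesh.deriv_deriv_ref {f : ℝ → ℂ} (hf : ContDiff ℝ 2 f) (j : Fin N) :
    deriv (deriv (𝓜.ref f j)) = fun ξ => (𝓜.len j : ℂ) ^ 2 * 𝓜.ref (iteratedDeriv 2 f) j ξ := by
  have := 𝓜.iteratedDeriv_ref (n := 2) hf j
  rwa [iteratedDeriv_succ, iteratedDeriv_one] at this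

/-- Integrals over a cell in the reference coordinate. -/
lemma Mesh.integral_cell {E : Type*} [NormedAddCommGroup E] [NormedSpace ℝ E] (f : ℝ → E)
    (j : Fin N) : ∫ x in (𝓜.xL j)..(𝓜.xR j), f x
      = 𝓜.len j • ∫ ξ in (0 : ℝ)..1, f (𝓜.xL j + 𝓜.len j * ξ) := by
  rw [intervalIntegral.smul_integral_comp_add_mul]
  congr 1 <;> simp [Mesh.len]

variable [NeZero N]

lemma Mesh.periodic_xL {f : ℝ → ℂ} (hf : Function.Periodic f (b - a)) (j : Fin N) (y : ℝ) :
    f (𝓜.xL (j + 1) + y) = f (𝓜.xR j + y) := by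
  rcases 𝓜.xL_nxt j with h | h
  · rw [h]
  · rw [h, ← hf (𝓜.xR j - (b - a) + y)]
    congr 1
    ring

lemma Mesh.ref_nxt {f : ℝ → ℂ} (hf : Function.Periodic f (b - a)) {j : Fin N}
    (hj : 𝓜.len (j + 1) = 𝓜.len j) (ξ : ℝ) :
    𝓜.ref f (j + 1) ξ = 𝓜.ref (fun x => f (x + 𝓜.len j)) j ξ := by
  rw [Mesh.ref, Mesh.ref, 𝓜.periodic_xL hf, hj]
  congr 1
  rw [Mesh.len]
  ring

lemma norm_shift_sub_le {f : ℝ → ℂ} {n : ℕ} (hf : ContDiff ℝ (n + 1 : ℕ) f) {B h : ℝ} (h0 : 0 ≤ h)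
    (hB : ∀ x, ‖iteratedDeriv (n + 1) f x‖ ≤ B) (x : ℝ) :
    ‖iteratedDeriv n (fun x => f (x + h) - f x) x‖ ≤ h * B := by
  have h1 : ContDiff ℝ n f := hf.of_nat_le (by omega)
  have h2 : ContDiff ℝ n fun x => f (x + h) := h1.comp (contDiff_id.add contDiff_const)
  rw [iteratedDeriv_fun_sub h2.contDiffAt h1.contDiffAt, iteratedDeriv_comp_add_const]
  have := norm_iteratedDeriv_sub_le hf hB x (x + h)
  rwa [add_sub_cancel_left, abs_of_nonneg h0, mul_comm] at this

/-- By periodicity a step from cell to cell is a translation by h, so each difference yields a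
factor h at the price of one derivative. -/
lemma Mesh.Uniform.bd_ref {𝓜 : Mesh a b N} (hu : 𝓜.Uniform) {f : ℝ → ℂ}
    (hf : Function.Periodic f (b - a)) (l : ℕ) (hc : ContDiff ℝ l f) {R : ℝ}
    (hR : ∀ i ≤ l, ∀ x, ‖iteratedDeriv i f x‖ ≤ R) (ξ : ℝ) :
    Bd nxt 𝓜.size l R fun j => 𝓜.ref f j ξ := by
  have h0 := 𝓜.size_pos.le
  induction l generalizing f R with
  | zero => exact fun j => by simpa [Mesh.ref] using hR 0 le_rfl (𝓜.xL j + 𝓜.len j * ξ)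
  | succ l ih =>
    refine ⟨fun j => by simpa [Mesh.ref] using hR 0 (by omega) (𝓜.xL j + 𝓜.len j * ξ), ?_⟩
    have := ih (f := fun x => f (x + 𝓜.size) - f x) (R := 𝓜.size * R) (fun x => ?_) ?_
      (fun i hi x => norm_shift_sub_le (hc.of_nat_le (by omega)) h0 (hR (i + 1) (by omega)) x)
    · convert this using 2 with j
      change 𝓜.ref f (j + 1) ξ - 𝓜.ref f j ξ = _
      rw [𝓜.ref_nxt hf (j := j) (by rw [hu, hu]), hu]
      rfl
    · change f (x + (b - a) + 𝓜.size) - f (x + (b - a)) = f (x + 𝓜.size) - f x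
      rw [hf x, add_right_comm, hf]
    · have h1 : ContDiff ℝ l f := hc.of_nat_le (by omega)
      exact (h1.comp (contDiff_id.add contDiff_const)).sub h1

/-- Wherever `π` moves a cell, it does so onto a neighbour of equal length, and this is a
translation by that length. -/
lemma NeighborMap.bd_ref {𝓜 : Mesh a b N} {π : Fin N → Fin N} (hπ : NeighborMap 𝓜 π)
    {f : ℝ → ℂ} (hf : Function.Periodic f (b - a)) (hc : ContDiff ℝ 1 f) {R : ℝ}
    (hR : ∀ i ≤ 1, ∀ x, ‖iteratedDeriv i f x‖ ≤ R) (ξ : ℝ) :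
    Bd π 𝓜.size 1 R fun j => 𝓜.ref f j ξ := by
  have hR0 : 0 ≤ R := (norm_nonneg _).trans (hR 0 (by omega) 0)
  have key : ∀ i, 𝓜.len (i + 1) = 𝓜.len i →
      ‖𝓜.ref f (i + 1) ξ - 𝓜.ref f i ξ‖ ≤ 𝓜.size * R := by
    intro i hi
    rw [𝓜.ref_nxt hf hi]
    have := norm_shift_sub_le (n := 0) hc (𝓜.len_pos i).le (hR 1 le_rfl) (𝓜.xL i + 𝓜.len i * ξ)
    rw [iteratedDeriv_zero] at this
    exact this.trans (mul_le_mul_of_nonneg_right (𝓜.len_le_size i) hR0)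
  refine ⟨fun j => by simpa [Mesh.ref] using hR 0 (by omega) (𝓜.xL j + 𝓜.len j * ξ), fun i => ?_⟩
  change ‖𝓜.ref f (π i) ξ - 𝓜.ref f i ξ‖ ≤ _
  rcases hπ i with h | ⟨h, hl⟩ | ⟨h, hl⟩
  · rw [h, sub_self, norm_zero]
    exact mul_nonneg 𝓜.size_pos.le hR0
  · rw [h]
    exact key i hl
  · have := key (π i) (by rw [← h, hl])
    rwa [← h, norm_sub_rev] at this

end Ref

section Pull

variable {a b : ℝ} {N : ℕ} (𝓜 : Mesh a b N)

/-- A polynomial in the reference coordinate of the cell `j`. -/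
def Mesh.pull (j : Fin N) (p : ℂ[X]) : ℂ[X] :=
  p.comp (C (𝓜.xL j : ℂ) + C (𝓜.len j : ℂ) * X)

lemma Mesh.pf_pull (j : Fin N) (p : ℂ[X]) (ξ : ℝ) :
    pf (𝓜.pull j p) ξ = pf p (𝓜.xL j + 𝓜.len j * ξ) := by
  simp [pf, Mesh.pull]

lemma Mesh.len_ne_zero (j : Fin N) : (𝓜.len j : ℂ) ≠ 0 :=
  Complex.ofReal_ne_zero.2 (𝓜.len_pos j).ne'

lemma Mesh.natDegree_pull (j : Fin N) (p : ℂ[X]) : (𝓜.pull j p).natDegree = p.natDegree := by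
  rw [Mesh.pull, natDegree_comp, add_comm, natDegree_add_C, natDegree_C_mul_X _ (𝓜.len_ne_zero j),
    mul_one]

lemma Mesh.derivative_pull (j : Fin N) (p : ℂ[X]) :
    derivative (𝓜.pull j p) = C (𝓜.len j : ℂ) * 𝓜.pull j (derivative p) := by
  rw [Mesh.pull, derivative_comp, Mesh.pull]
  simp

lemma Mesh.derivative_derivative_pull (j : Fin N) (p : ℂ[X]) :
    derivative (derivative (𝓜.pull j p))
      = C ((𝓜.len j : ℂ) ^ 2) * 𝓜.pull j (derivative (derivative p)) := by
  rw [derivative_pull, derivative_C_mul, derivative_pull, ← mul_assoc, ← C_mul, pow_two]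

lemma Mesh.pull_surjective (j : Fin N) : Function.Surjective (𝓜.pull j) := by
  intro P
  refine ⟨P.comp (C (𝓜.len j : ℂ)⁻¹ * (X - C (𝓜.xL j : ℂ))), ?_⟩
  rw [Mesh.pull, comp_assoc]
  have : (C (𝓜.len j : ℂ)⁻¹ * (X - C (𝓜.xL j : ℂ))).comp (C (𝓜.xL j : ℂ) + C (𝓜.len j : ℂ) * X)
      = X := by
    simp only [mul_comp, C_comp, sub_comp, X_comp, add_sub_cancel_left]
    rw [← mul_assoc, ← C_mul, inv_mul_cancel₀ (𝓜.len_ne_zero j), C_1, one_mul]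
  rw [this, comp_X]

lemma Mesh.xL_add_len (j : Fin N) : 𝓜.xL j + 𝓜.len j = 𝓜.xR j := by
  rw [Mesh.len]; ring

/-- Integrals over a cell against a polynomial. -/
lemma Mesh.integral_cell_mul (f : ℝ → ℂ) (p : ℂ[X]) (j : Fin N) :
    ∫ x in (𝓜.xL j)..(𝓜.xR j), f x * pf p x
      = 𝓜.len j * ∫ ξ in (0 : ℝ)..1, 𝓜.ref f j ξ * pf (𝓜.pull j p) ξ := by
  rw [𝓜.integral_cell, Complex.real_smul]
  simp only [𝓜.pf_pull]
  rfl

/-- The same with a second derivative. -/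
lemma Mesh.integral_cell_mul_dd (f : ℝ → ℂ) (p : ℂ[X]) (j : Fin N) :
    (𝓜.len j : ℂ) * ∫ x in (𝓜.xL j)..(𝓜.xR j), f x * pf (derivative (derivative p)) x
      = ∫ ξ in (0 : ℝ)..1, 𝓜.ref f j ξ * pf (derivative (derivative (𝓜.pull j p))) ξ := by
  rw [𝓜.integral_cell_mul, 𝓜.derivative_derivative_pull, ← mul_assoc,
    ← intervalIntegral.integral_const_mul]
  congr 1
  ext ξ
  rw [pf_mul, pf_C]
  ring

lemma Mesh.ref_pf (p : ℂ[X]) (j : Fin N) : 𝓜.ref (pf p) j = pf (𝓜.pull j p) := by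
  ext ξ
  rw [𝓜.pf_pull, Mesh.ref]

lemma Mesh.rho_mul_len (j : Fin N) : (𝓜.rho j : ℂ) * 𝓜.len j = 𝓜.size := by
  rw [Mesh.rho, ← Complex.ofReal_mul, div_mul_cancel₀ _ (𝓜.len_pos j).ne']

variable [NeZero N]

lemma Mesh.size_ne_zero : (𝓜.size : ℂ) ≠ 0 := Complex.ofReal_ne_zero.2 𝓜.size_pos.ne'

lemma hatFlux_eq (F : Flux) (p : Fin N → ℂ[X]) (j : Fin N) :
    hatFlux F 𝓜 p j = fl1 F 𝓜.rho nxt (fun j => pf (𝓜.pull j (p j))) j := by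
  have h1 := 𝓜.rho_mul_len j
  have h2 := 𝓜.rho_mul_len (j + 1)
  simp only [hatFlux, fl1, avg, jump, vMinus, vPlus, dx, nxt, deriv_pf, 𝓜.derivative_pull, pf_mul,
    pf_C, 𝓜.pf_pull, mul_one, mul_zero, add_zero, 𝓜.xL_add_len]
  push_cast
  simp only [pf]
  linear_combination F.β₂ * (derivative (p j)).eval (𝓜.xR j : ℂ) * h1
    - F.β₂ * (derivative (p (j + 1))).eval (𝓜.xL (j + 1) : ℂ) * h2

lemma tildeFlux_eq (F : Flux) (p : Fin N → ℂ[X]) (j : Fin N) :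
    𝓜.size * tildeFlux F 𝓜 p j = fl2 F 𝓜.rho nxt (fun j => pf (𝓜.pull j (p j))) j := by
  have h1 := 𝓜.rho_mul_len j
  have h2 := 𝓜.rho_mul_len (j + 1)
  have h3 : (𝓜.size : ℂ) * (F.β₁ / 𝓜.size) = F.β₁ := mul_div_cancel₀ _ 𝓜.size_ne_zero
  simp only [tildeFlux, fl2, avg, jump, vMinus, vPlus, dx, nxt, deriv_pf, 𝓜.derivative_pull, pf_mul,
    pf_C, 𝓜.pf_pull, mul_one, mul_zero, add_zero, 𝓜.xL_add_len]
  push_cast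
  simp only [pf]
  linear_combination (-(1 / 2 - F.α₁) * (derivative (p j)).eval (𝓜.xR j : ℂ)) * h1
    - (1 / 2 + F.α₁) * (derivative (p (j + 1))).eval (𝓜.xL (j + 1) : ℂ) * h2
    + ((p (j + 1)).eval (𝓜.xL (j + 1) : ℂ) - (p j).eval (𝓜.xR j : ℂ)) * h3

lemma fl1_ref (F : Flux) {f : ℝ → ℂ} (hf : Function.Periodic f (b - a)) (hc : ContDiff ℝ 1 f)
    (j : Fin N) : fl1 F 𝓜.rho nxt (𝓜.ref f) j = f (𝓜.xR j) := by
  have h1 := 𝓜.rho_mul_len j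
  have h2 := 𝓜.rho_mul_len (j + 1)
  have h3 := 𝓜.periodic_xL hf j 0
  have hp := periodic_iteratedDeriv hf 1
  rw [iteratedDeriv_one] at hp
  have h4 := 𝓜.periodic_xL hp j 0
  rw [add_zero, add_zero] at h3 h4
  simp only [fl1, 𝓜.deriv_ref hc, nxt, Mesh.ref, mul_one, mul_zero, add_zero, 𝓜.xL_add_len, h3, h4]
  linear_combination (-F.β₂ * deriv f (𝓜.xR j)) * h1 + F.β₂ * deriv f (𝓜.xR j) * h2

lemma fl2_ref (F : Flux) {f : ℝ → ℂ} (hf : Function.Periodic f (b - a)) (hc : ContDiff ℝ 1 f)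
    (j : Fin N) : fl2 F 𝓜.rho nxt (𝓜.ref f) j = 𝓜.size * deriv f (𝓜.xR j) := by
  have h1 := 𝓜.rho_mul_len j
  have h2 := 𝓜.rho_mul_len (j + 1)
  have h3 := 𝓜.periodic_xL hf j 0
  have hp := periodic_iteratedDeriv hf 1
  rw [iteratedDeriv_one] at hp
  have h4 := 𝓜.periodic_xL hp j 0
  rw [add_zero, add_zero] at h3 h4
  simp only [fl2, 𝓜.deriv_ref hc, nxt, Mesh.ref, mul_one, mul_zero, add_zero, 𝓜.xL_add_len, h3, h4]
  linear_combination (1 / 2 - F.α₁) * deriv f (𝓜.xR j) * h1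
    + (1 / 2 + F.α₁) * deriv f (𝓜.xR j) * h2

/-- Vanishing fluxes in physical and in reference coordinates. -/
lemma flux_eq_zero_iff (F : Flux) (p : Fin N → ℂ[X]) :
    ((∀ j, hatFlux F 𝓜 p j = 0) ∧ ∀ j, tildeFlux F 𝓜 p j = 0) ↔
      ∀ j, fl1 F 𝓜.rho nxt (fun j => pf (𝓜.pull j (p j))) j = 0 ∧
        fl2 F 𝓜.rho nxt (fun j => pf (𝓜.pull j (p j))) j = 0 := by
  simp only [← hatFlux_eq, ← tildeFlux_eq, mul_eq_zero, 𝓜.size_ne_zero, false_or, forall_and]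

end Pull

/-- Moments of a correction in reference coordinates. -/
lemma correction_moment_iff {a b : ℝ} {N : ℕ} {𝓜 : Mesh a b N} {g : Fin N → ℝ → ℂ} {w : Fin N → ℝ → ℂ}
    (hg : ∀ j, ∀ ξ ∈ Set.Icc (0 : ℝ) 1, g j (𝓜.xL j + 𝓜.len j * ξ) = Complex.I * w j ξ)
    (P : Fin N → ℂ[X]) (j : Fin N) (v : ℂ[X]) :
    (∫ x in (𝓜.xL j)..(𝓜.xR j), toFun P j x * (derivative (derivative v)).eval (x : ℂ))
      = -Complex.I * ∫ x in (𝓜.xL j)..(𝓜.xR j), g j x * v.eval (x : ℂ) ↔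
    ∫ ξ in (0 : ℝ)..1, pf (𝓜.pull j (P j)) ξ * pf (derivative (derivative (𝓜.pull j v))) ξ
      = (𝓜.len j : ℂ) ^ 2 * ∫ ξ in (0 : ℝ)..1, w j ξ * pf (𝓜.pull j v) ξ := by
  have h1 := 𝓜.integral_cell_mul_dd (pf (P j)) v j
  have h2 := 𝓜.integral_cell_mul (g j) v j
  have h3 : ∫ ξ in (0 : ℝ)..1, 𝓜.ref (g j) j ξ * pf (𝓜.pull j v) ξ
      = Complex.I * ∫ ξ in (0 : ℝ)..1, w j ξ * pf (𝓜.pull j v) ξ := by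
    rw [← intervalIntegral.integral_const_mul]
    refine intervalIntegral.integral_congr fun ξ hξ => ?_
    rw [Set.uIcc_of_le zero_le_one] at hξ
    rw [Mesh.ref, hg j ξ hξ, mul_assoc]
  rw [𝓜.ref_pf] at h1
  change (∫ x in (𝓜.xL j)..(𝓜.xR j), pf (P j) x * pf (derivative (derivative v)) x)
      = -Complex.I * ∫ x in (𝓜.xL j)..(𝓜.xR j), g j x * pf v x ↔ _
  rw [← h1, h2, h3]
  set A := ∫ x in (𝓜.xL j)..(𝓜.xR j), pf (P j) x * pf (derivative (derivative v)) x
  set B := ∫ ξ in (0 : ℝ)..1, w j ξ * pf (𝓜.pull j v) ξ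
  have h4 : -Complex.I * (𝓜.len j * (Complex.I * B)) = 𝓜.len j * B := by
    linear_combination (-𝓜.len j * B) * Complex.I_mul_I
  rw [h4, pow_two, mul_assoc, mul_right_inj' (𝓜.len_ne_zero j)]

/-! ### The projection and the corrections in reference coordinates. -/

section Projection

variable {a b : ℝ} {N : ℕ} [NeZero N] {k : ℕ} {F : Flux} {𝓜 : Mesh a b N} {s : Fin N → Fin N}
  {p : ℕ} {K : ℝ}

lemma Good.flux_zero_iff (h : Good k F 𝓜 s p K) (φ : Fin N → ℝ → ℂ) :
    (∀ j, fl1 F 𝓜.rho nxt φ j = 0 ∧ fl2 F 𝓜.rho nxt φ j = 0) ↔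
      ∀ j, fl1 F 𝓜.rho s φ j = 0 ∧ fl2 F 𝓜.rho s φ j = 0 := by
  refine ⟨h.flux_zero φ, fun H => ?_⟩
  obtain ⟨r₁, r₂, -, -, h0, h1⟩ := h.flux_lift (fun _ => 0) (fun _ => 0) 0 (by simp) (by simp)
  have h0 := h0 fun _ => ⟨rfl, rfl⟩
  exact h1 φ fun j => by rw [(h0 j).1, (h0 j).2]; exact H j

lemma flux_sub_eq_zero_iff {f : ℝ → ℂ} (hf : Function.Periodic f (b - a)) (hc : ContDiff ℝ 1 f)
    (P : Fin N → ℂ[X]) :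
    ((∀ j, hatFlux F 𝓜 P j = f (𝓜.xR j)) ∧ ∀ j, tildeFlux F 𝓜 P j = deriv f (𝓜.xR j)) ↔
      ∀ j, fl1 F 𝓜.rho nxt (fun j ξ => 𝓜.ref f j ξ - pf (𝓜.pull j (P j)) ξ) j = 0 ∧
        fl2 F 𝓜.rho nxt (fun j ξ => 𝓜.ref f j ξ - pf (𝓜.pull j (P j)) ξ) j = 0 := by
  have hd : ∀ j, Differentiable ℝ (𝓜.ref f j) := fun j =>
    (𝓜.contDiff_ref hc j).differentiable (by simp)
  have e : (fun j ξ => 𝓜.ref f j ξ - pf (𝓜.pull j (P j)) ξ)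
      = fun j ξ => (fun _ => (1 : ℂ)) j * 𝓜.ref f j ξ
        + (fun _ => (-1 : ℂ)) j * (fun j => pf (𝓜.pull j (P j))) j ξ := by
    funext j ξ
    ring
  have h1 : ∀ j, fl1 F 𝓜.rho nxt (fun j ξ => 𝓜.ref f j ξ - pf (𝓜.pull j (P j)) ξ) j
      = f (𝓜.xR j) - hatFlux F 𝓜 P j := by
    intro j
    rw [e, fl1_add F 𝓜.rho nxt hd (fun j => differentiable_pf _) _ _ (fun _ => rfl)
      (fun _ => rfl), fl1_ref 𝓜 F hf hc, ← hatFlux_eq]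
    ring
  have h2 : ∀ j, fl2 F 𝓜.rho nxt (fun j ξ => 𝓜.ref f j ξ - pf (𝓜.pull j (P j)) ξ) j
      = 𝓜.size * (deriv f (𝓜.xR j) - tildeFlux F 𝓜 P j) := by
    intro j
    rw [e, fl2_add F 𝓜.rho nxt hd (fun j => differentiable_pf _) _ _ (fun _ => rfl)
      (fun _ => rfl), fl2_ref 𝓜 F hf hc, ← tildeFlux_eq]
    ring
  simp only [h1, h2, mul_eq_zero, 𝓜.size_ne_zero, false_or, sub_eq_zero]
  rw [← forall_and]
  exact forall_congr' fun j => and_congr eq_comm eq_comm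

/-- The projection in reference coordinates. -/
lemma Good.isPstar_iff (h : Good k F 𝓜 s p K) (hk : 2 ≤ k) {f : ℝ → ℂ}
    (hf : Function.Periodic f (b - a)) (hc : ContDiff ℝ 1 f) {P : Fin N → ℂ[X]} :
    IsPstar k F 𝓜 f P ↔ (∀ j, (P j).natDegree ≤ k) ∧
      IsW k F 𝓜.rho s 0 (𝓜.ref f) (fun j ξ => 𝓜.ref f j ξ - pf (𝓜.pull j (P j)) ξ) := by
  have hmom : (∀ j, ∀ q : ℂ[X], q.natDegree ≤ k - 2 →
      (∫ x in (𝓜.xL j)..(𝓜.xR j), toFun P j x * q.eval (x : ℂ))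
        = ∫ x in (𝓜.xL j)..(𝓜.xR j), f x * q.eval (x : ℂ)) ↔
      ∀ j, ∀ v : ℂ[X], v.natDegree ≤ k →
        ∫ ξ in (0 : ℝ)..1, (𝓜.ref f j ξ - pf (𝓜.pull j (P j)) ξ) * pf (derivative (derivative v)) ξ
          = 0 := by
    refine forall_congr' fun j => ?_
    have key : ∀ v : ℂ[X], ∫ ξ in (0 : ℝ)..1, (𝓜.ref f j ξ - pf (𝓜.pull j (P j)) ξ)
          * pf (derivative (derivative (𝓜.pull j v))) ξ
        = 𝓜.len j * ((∫ x in (𝓜.xL j)..(𝓜.xR j), f x * pf (derivative (derivative v)) x)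
          - ∫ x in (𝓜.xL j)..(𝓜.xR j), pf (P j) x * pf (derivative (derivative v)) x) := by
      intro v
      rw [mul_sub, 𝓜.integral_cell_mul_dd, 𝓜.integral_cell_mul_dd, 𝓜.ref_pf]
      simp only [sub_mul]
      exact intervalIntegral.integral_sub
        (intervalIntegrable_mul_pf (𝓜.contDiff_ref hc j).continuous _ _ _)
        (intervalIntegrable_mul_pf (continuous_pf _) _ _ _)
    constructor
    · intro H v hv
      obtain ⟨v, rfl⟩ := 𝓜.pull_surjective j v
      rw [𝓜.natDegree_pull] at hv
      rw [key]
      exact mul_eq_zero_of_right _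
        (sub_eq_zero.2 (H _ (natDegree_derivative_derivative_le hv)).symm)
    · intro H q hq
      obtain ⟨v, rfl, hv⟩ := exists_derivative_derivative_eq q
      have := H (𝓜.pull j v) (by rw [𝓜.natDegree_pull]; omega)
      rw [key] at this
      exact (sub_eq_zero.1 ((mul_eq_zero.1 this).resolve_left (𝓜.len_ne_zero j))).symm
  have hflux := (flux_sub_eq_zero_iff (F := F) hf hc P).trans (h.flux_zero_iff _)
  constructor
  · rintro ⟨h1, h2, h3, h4⟩
    have := hflux.1 ⟨h3, h4⟩
    exact ⟨h1, ⟨fun j => 𝓜.pull j (P j), fun j => by rw [𝓜.natDegree_pull]; exact h1 j,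
      fun j => rfl⟩, hmom.1 h2, fun j => (this j).1, fun j => (this j).2⟩
  · rintro ⟨h1, -, h2, h3, h4⟩
    have := hflux.2 fun j => ⟨h3 j, h4 j⟩
    exact ⟨h1, hmom.2 h2, this.1, this.2⟩

/-- Solvability on the reference cell supplies some projection, and this suffices because `Pstar` is
an `epsilon` choice. -/
lemma Good.isPstar (h : Good k F 𝓜 s p K) (hk : 2 ≤ k) {f : ℝ → ℂ}
    (hf : Function.Periodic f (b - a)) (hc : ContDiff ℝ 1 f) : IsPstar k F 𝓜 f (Pstar k F 𝓜 f) := by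
  refine Classical.epsilon_spec (p := IsPstar k F 𝓜 f) ?_
  obtain ⟨w, hw⟩ := exists_isW (q := 0) (g := 𝓜.ref f) hk 𝓜.size_pos.le h.stable (by omega)
    (fun j => 𝓜.contDiff_ref hc j)
  obtain ⟨P, hP, hwP⟩ := hw.1
  choose Q hQ using fun j => 𝓜.pull_surjective j (P j)
  refine ⟨Q, (h.isPstar_iff hk hf hc).2 ⟨fun j => ?_, ?_⟩⟩
  · rw [← 𝓜.natDegree_pull j, hQ]
    exact hP j
  · convert hw using 1
    funext j
    rw [hwP, hQ]

/-- The corrections in reference coordinates. -/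
lemma Good.isW_of_isCorrection (h : Good k F 𝓜 s p K) {q : ℕ} (hq : 2 * q + 3 ≤ k)
    {f : ℝ → ℂ} (hc : ContDiff ℝ (2 * q + 3 : ℕ) f) {w : Fin N → ℝ → ℂ}
    (hw : IsW k F 𝓜.rho s q (𝓜.ref (iteratedDeriv 2 f)) w) {g : Fin N → ℝ → ℂ}
    (hg : ∀ j, ∀ ξ ∈ Set.Icc (0 : ℝ) 1, g j (𝓜.xL j + 𝓜.len j * ξ) = Complex.I * w j ξ)
    {P : Fin N → ℂ[X]} (hP : IsCorrection k F 𝓜 g P) :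
      IsW k F 𝓜.rho s (q + 1) (𝓜.ref f) (fun j => pf (𝓜.pull j (P j))) := by
  obtain ⟨h1, h2, h3, h4⟩ := hP
  have hflux := (h.flux_zero_iff _).1 ((flux_eq_zero_iff 𝓜 F P).1 ⟨h3, h4⟩)
  have hc2 : ContDiff ℝ (2 * q + 1 : ℕ) (iteratedDeriv 2 f) := by
    rw [iteratedDeriv_succ, iteratedDeriv_one]
    exact contDiff_deriv_deriv hc
  refine ⟨⟨fun j => 𝓜.pull j (P j), fun j => by rw [𝓜.natDegree_pull]; exact h1 j, fun j => rfl⟩,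
    ⟨fun j ξ => (𝓜.len j : ℂ) ^ 2 * w j ξ + 0 * w j ξ, ?_, ?_⟩, fun j => (hflux j).1,
    fun j => (hflux j).2⟩
  · have := hw.add hw (fun j => 𝓜.contDiff_ref hc2 j) (fun j => 𝓜.contDiff_ref hc2 j)
      (fun j => (𝓜.len j : ℂ) ^ 2) (fun _ => 0) (fun j => by rw [h.len_s]) (fun _ => rfl)
    convert this using 1
    funext j
    rw [𝓜.deriv_deriv_ref (ContDiff.of_nat_le (m := 2) hc (by omega))]
    funext ξ
    ring
  · intro j v hv
    have e : ∫ ξ in (0 : ℝ)..1, ((𝓜.len j : ℂ) ^ 2 * w j ξ + 0 * w j ξ) * pf v ξ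
        = (𝓜.len j : ℂ) ^ 2 * ∫ ξ in (0 : ℝ)..1, w j ξ * pf v ξ := by
      rw [← intervalIntegral.integral_const_mul]
      congr 1
      ext ξ
      ring
    rw [e]
    -- The definition of w_{q+1} tests only degrees ≥ 2. For linear v both sides vanish, the right
    -- one by orthogonality of the previous correction.
    rcases Nat.lt_or_ge v.natDegree 2 with hv2 | hv2
    · rw [derivative_derivative_eq_zero (by omega), hw.orth j (by omega)]
      simp
    · obtain ⟨v, rfl⟩ := 𝓜.pull_surjective j v
      rw [𝓜.natDegree_pull] at hv hv2
      exact (correction_moment_iff hg P j v).1 (h2 j v hv hv2)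

lemma Good.exists_isCorrection (h : Good k F 𝓜 s p K) (hk : 2 ≤ k) {q : ℕ} (hq : 2 * q + 3 ≤ k)
    {f : ℝ → ℂ} (hc : ContDiff ℝ (2 * q + 3 : ℕ) f) {w : Fin N → ℝ → ℂ}
    (hw : IsW k F 𝓜.rho s q (𝓜.ref (iteratedDeriv 2 f)) w) {g : Fin N → ℝ → ℂ}
    (hg : ∀ j, ∀ ξ ∈ Set.Icc (0 : ℝ) 1, g j (𝓜.xL j + 𝓜.len j * ξ) = Complex.I * w j ξ) :
    ∃ P : Fin N → ℂ[X], IsCorrection k F 𝓜 g P := by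
  have hc2 : ContDiff ℝ (2 * q + 1 : ℕ) (iteratedDeriv 2 f) := by
    rw [iteratedDeriv_succ, iteratedDeriv_one]
    exact contDiff_deriv_deriv hc
  have hwc : ∀ j, Continuous (w j) := fun j =>
    (hw.contDiff (fun j => 𝓜.contDiff_ref (contDiff_one_of hc2 (by omega)) j) j).continuous
  obtain ⟨P, h1, h2, h3, h4⟩ := exists_solve_functional hk 𝓜.size_pos.le h.stable
    (fun j => (𝓜.len j : ℂ) ^ 2 • intL (w j) (hwc j)) (fun j v hv => by
      have := hw.orth j (v := v) (by omega)
      simp only [LinearMap.smul_apply, intL, LinearMap.coe_mk, AddHom.coe_mk, this, smul_zero])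
    (fun _ => 0) (fun _ => 0)
  choose Q hQ using fun j => 𝓜.pull_surjective j (P j)
  have hPQ : (fun j => pf (P j)) = fun j => pf (𝓜.pull j (Q j)) := by
    funext j
    rw [hQ]
  have hflux := (flux_eq_zero_iff 𝓜 F Q).2 ((h.flux_zero_iff _).2 fun j => by
    rw [← hPQ]
    exact ⟨h3 j, h4 j⟩)
  refine ⟨Q, fun j => ?_, fun j v hv _ => ?_, hflux.1, hflux.2⟩
  · rw [← 𝓜.natDegree_pull j, hQ]
    exact h1 j
  · rw [correction_moment_iff hg Q j v, hQ]
    exact h2 j (𝓜.pull j v) (by rw [𝓜.natDegree_pull]; exact hv)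

end Projection

/-! ### Time derivatives of polynomial families and Gronwall's inequality. -/

lemma hasDerivWithinAt_of_sq {f : ℝ → ℂ} {f' : ℂ} {S : Set ℝ} {t C : ℝ}
    (h : ∀ t' ∈ S, ‖f t' - f t - (t' - t : ℝ) * f'‖ ≤ C * |t' - t| ^ 2) :
    HasDerivWithinAt f f' S t := by
  rw [hasDerivWithinAt_iff_isLittleO]
  have h1 : (fun x : ℝ => ‖x - t‖ ^ 2) =o[nhdsWithin t S] fun x => x - t :=
    (Asymptotics.isLittleO_pow_sub_sub t (by norm_num)).mono nhdsWithin_le_nhds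
  refine Asymptotics.IsBigO.trans_isLittleO (Asymptotics.IsBigO.of_bound C ?_) h1
  filter_upwards [self_mem_nhdsWithin] with t' ht'
  have := h t' ht'
  rwa [Complex.real_smul, norm_pow, norm_norm, Real.norm_eq_abs]

/-- Polynomials of degree `≤ k` are determined by their values at `k + 1` points. -/
lemma exists_interpolation (k : ℕ) {α β : ℝ} (hαβ : α < β) :
    ∃ (node : ℕ → ℝ) (q : ℕ → ℂ[X]), (∀ i ∈ Finset.range (k + 1), node i ∈ Set.Icc α β) ∧
      (∀ i ∈ Finset.range (k + 1), (q i).natDegree ≤ k) ∧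
      ∀ p : ℂ[X], p.natDegree ≤ k → ∀ x,
        pf p x = ∑ i ∈ Finset.range (k + 1), pf p (node i) * pf (q i) x := by
  set node : ℕ → ℝ := fun i => α + (β - α) * (i / (k + 1)) with hnode
  have hk : (0 : ℝ) < k + 1 := by positivity
  have hinj : Set.InjOn (fun i => (node i : ℂ)) (Finset.range (k + 1)) := by
    intro i _ i' _ h
    have h1 : node i = node i' := Complex.ofReal_injective h
    simp only [hnode] at h1
    have h2 : (i : ℝ) / (k + 1) = i' / (k + 1) :=
      mul_left_cancel₀ (sub_pos.2 hαβ).ne' (add_left_cancel h1)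
    rw [div_left_inj' hk.ne'] at h2
    exact_mod_cast h2
  refine ⟨node, fun i => Lagrange.basis (Finset.range (k + 1)) (fun i => (node i : ℂ)) i,
    fun i hi => ?_, fun i hi => ?_, fun p hp x => ?_⟩
  · have hi' : (i : ℝ) ≤ k + 1 := by
      have := Finset.mem_range.1 hi
      exact_mod_cast this.le
    have h1 : (i : ℝ) / (k + 1) ≤ 1 := (div_le_one hk).2 hi'
    have h2 : (0 : ℝ) ≤ i / (k + 1) := by positivity
    simp only [hnode, Set.mem_Icc]
    constructor <;> nlinarith
  · rw [natDegree_le_iff_degree_le, Lagrange.degree_basis hinj hi, Finset.card_range]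
    simp
  · have h1 : p = Lagrange.interpolate (Finset.range (k + 1)) (fun i => (node i : ℂ))
        (fun i => p.eval (node i : ℂ)) := by
      refine Lagrange.eq_interpolate hinj ?_
      rw [Finset.card_range]
      exact degree_le_natDegree.trans_lt (by exact_mod_cast Nat.lt_succ_of_le hp)
    conv_lhs => rw [h1]
    rw [Lagrange.interpolate_apply, pf_sum]
    simp only [pf_mul, pf_C]
    rfl

/-- Time derivatives of polynomials of bounded degree are polynomials. -/
lemma exists_hasDerivWithinAt_pf {k : ℕ} {Z : ℝ → ℂ[X]} {S : Set ℝ}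
    (hZ : ∀ t ∈ S, (Z t).natDegree ≤ k) {α β : ℝ} (hαβ : α < β) {t : ℝ} (ht : t ∈ S)
    (hd : ∀ x ∈ Set.Icc α β, DifferentiableWithinAt ℝ (fun τ => pf (Z τ) x) S t) :
    ∃ Z' : ℂ[X], Z'.natDegree ≤ k ∧
      ∀ x, HasDerivWithinAt (fun τ => pf (Z τ) x) (pf Z' x) S t := by
  obtain ⟨node, q, hmem, hq, hint⟩ := exists_interpolation k hαβ
  refine ⟨∑ i ∈ Finset.range (k + 1), C (derivWithin (fun τ => pf (Z τ) (node i)) S t) * q i,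
    natDegree_sum_le_of_forall_le _ _ fun i hi => (natDegree_C_mul_le _ _).trans (hq i hi),
    fun x => ?_⟩
  have h1 : HasDerivWithinAt
      (fun τ => ∑ i ∈ Finset.range (k + 1), pf (Z τ) (node i) * pf (q i) x)
      (∑ i ∈ Finset.range (k + 1), derivWithin (fun τ => pf (Z τ) (node i)) S t * pf (q i) x) S t :=
    HasDerivWithinAt.fun_sum fun i hi => ((hd _ (hmem i hi)).hasDerivWithinAt).mul_const _
  rw [pf_sum]
  simp only [pf_mul, pf_C]
  exact h1.congr (fun τ hτ => hint _ (hZ τ hτ) x) (hint _ (hZ t ht) x)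

/-- Integrals of products of polynomials in terms of point values. -/
lemma exists_integral_pf_mul_pf (k : ℕ) (α β : ℝ) :
    ∃ (node : ℕ → ℝ) (G : ℕ → ℕ → ℂ), ∀ p q : ℂ[X], p.natDegree ≤ k → q.natDegree ≤ k →
      ∫ x in α..β, pf p x * pf q x = ∑ i ∈ Finset.range (k + 1), ∑ i' ∈ Finset.range (k + 1),
        pf p (node i) * pf q (node i') * G i i' := by
  obtain ⟨node, b, -, -, hint⟩ := exists_interpolation k zero_lt_one
  refine ⟨node, fun i i' => ∫ x in α..β, pf (b i) x * pf (b i') x, fun p q hp hq => ?_⟩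
  have e : ∀ x, pf p x * pf q x = ∑ i ∈ Finset.range (k + 1), ∑ i' ∈ Finset.range (k + 1),
      pf p (node i) * pf q (node i') * (pf (b i) x * pf (b i') x) := by
    intro x
    rw [hint p hp x, hint q hq x, Finset.sum_mul_sum]
    refine Finset.sum_congr rfl fun i _ => Finset.sum_congr rfl fun i' _ => ?_
    ring
  have hc : ∀ i i', Continuous fun x => pf p (node i) * pf q (node i') * (pf (b i) x * pf (b i') x) :=
    fun i i' => continuous_const.mul ((continuous_pf _).mul (continuous_pf _))
  simp only [e]
  rw [intervalIntegral.integral_finsetSum fun i _ =>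
    (continuous_finsetSum _ fun i' _ => hc i i').intervalIntegrable _ _]
  refine Finset.sum_congr rfl fun i _ => ?_
  rw [intervalIntegral.integral_finsetSum fun i' _ => (hc i i').intervalIntegrable _ _]
  simp only [intervalIntegral.integral_const_mul]

lemma hasDerivWithinAt_integral_pf_mul_pf {k : ℕ} {P Q : ℝ → ℂ[X]} {P' Q' : ℂ[X]} {S : Set ℝ}
    (hP : ∀ t ∈ S, (P t).natDegree ≤ k) (hQ : ∀ t ∈ S, (Q t).natDegree ≤ k)
    (hP' : P'.natDegree ≤ k) (hQ' : Q'.natDegree ≤ k) {t : ℝ} (ht : t ∈ S)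
    (hPd : ∀ x, HasDerivWithinAt (fun τ => pf (P τ) x) (pf P' x) S t)
    (hQd : ∀ x, HasDerivWithinAt (fun τ => pf (Q τ) x) (pf Q' x) S t) (α β : ℝ) :
    HasDerivWithinAt (fun τ => ∫ x in α..β, pf (P τ) x * pf (Q τ) x)
      ((∫ x in α..β, pf P' x * pf (Q t) x) + ∫ x in α..β, pf (P t) x * pf Q' x) S t := by
  obtain ⟨node, G, h⟩ := exists_integral_pf_mul_pf k α β
  rw [h _ _ hP' (hQ t ht), h _ _ (hP t ht) hQ', ← Finset.sum_add_distrib]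
  simp only [← Finset.sum_add_distrib, ← add_mul]
  have h1 : HasDerivWithinAt (fun τ => ∑ i ∈ Finset.range (k + 1), ∑ i' ∈ Finset.range (k + 1),
        pf (P τ) (node i) * pf (Q τ) (node i') * G i i') _ S t :=
    HasDerivWithinAt.fun_sum fun i _ => HasDerivWithinAt.fun_sum fun i' _ =>
      ((hPd (node i)).mul (hQd (node i'))).mul_const (G i i')
  exact h1.congr (fun τ hτ => h _ _ (hP τ hτ) (hQ τ hτ)) (h _ _ (hP t ht) (hQ t ht))

lemma tendsto_integral_pf_mul_pf {κ : Type*} {l : Filter κ} {k : ℕ} {P Q : κ → ℂ[X]} {P₀ Q₀ : ℂ[X]}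
    (hP : ∀ᶠ t in l, (P t).natDegree ≤ k) (hQ : ∀ᶠ t in l, (Q t).natDegree ≤ k)
    (hP₀ : P₀.natDegree ≤ k) (hQ₀ : Q₀.natDegree ≤ k)
    (hPt : ∀ x, Filter.Tendsto (fun τ => pf (P τ) x) l (nhds (pf P₀ x)))
    (hQt : ∀ x, Filter.Tendsto (fun τ => pf (Q τ) x) l (nhds (pf Q₀ x))) (α β : ℝ) :
    Filter.Tendsto (fun τ => ∫ x in α..β, pf (P τ) x * pf (Q τ) x) l
      (nhds (∫ x in α..β, pf P₀ x * pf Q₀ x)) := by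
  obtain ⟨node, G, h⟩ := exists_integral_pf_mul_pf k α β
  rw [h _ _ hP₀ hQ₀]
  have h1 : Filter.Tendsto (fun τ => ∑ i ∈ Finset.range (k + 1), ∑ i' ∈ Finset.range (k + 1),
        pf (P τ) (node i) * pf (Q τ) (node i') * G i i') l _ :=
    tendsto_finsetSum _ fun i _ => tendsto_finsetSum _ fun i' _ =>
      ((hPt (node i)).mul (hQt (node i'))).mul_const (G i i')
  refine h1.congr' ?_
  filter_upwards [hP, hQ] with τ h1 h2
  exact (h _ _ h1 h2).symm

/-- Gronwall's inequality. -/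
lemma le_exp_mul_of_deriv_le {y y' : ℝ → ℝ} {T A c : ℝ} (hA : 0 ≤ A) (hc : 0 ≤ c)
    (hy : ∀ t ∈ Set.Icc 0 T, HasDerivWithinAt y (y' t) (Set.Icc 0 T) t)
    (h : ∀ t ∈ Set.Ioo 0 T, y' t ≤ A + c * y t) {t : ℝ} (ht : t ∈ Set.Icc 0 T) :
    y t ≤ Real.exp (c * t) * (y 0 + A * t) := by
  have hd : ∀ t ∈ Set.Icc 0 T, HasDerivWithinAt (fun t => Real.exp (-c * t) * y t - A * t)
      (Real.exp (-c * t) * (-c) * y t + Real.exp (-c * t) * y' t - A) (Set.Icc 0 T) t := by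
    intro t ht
    have h1 : HasDerivAt (fun t => Real.exp (-c * t)) (Real.exp (-c * t) * (-c)) t := by
      have := ((hasDerivAt_id t).const_mul (-c)).exp
      simpa using this
    have h2 : HasDerivAt (fun t => A * t) A t := by
      have := (hasDerivAt_id t).const_mul A
      simpa using this
    exact (h1.hasDerivWithinAt.mul (hy t ht)).sub h2.hasDerivWithinAt
  -- The integrating factor is at most 1, so the constant source is absorbed by subtracting A t.
  have hanti : AntitoneOn (fun t => Real.exp (-c * t) * y t - A * t) (Set.Icc 0 T) := by
    refine antitoneOn_of_hasDerivWithinAt_nonpos (convex_Icc 0 T)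
      (fun t ht => (hd t ht).continuousWithinAt)
      (fun t ht => (hd t (interior_subset ht)).mono interior_subset) fun t ht => ?_
    rw [interior_Icc] at ht
    have h1 := h t ht
    have h2 : Real.exp (-c * t) ≤ 1 := Real.exp_le_one_iff.2 (by nlinarith [ht.1])
    have h3 := Real.exp_pos (-c * t)
    nlinarith
  have h0 := hanti (Set.left_mem_Icc.2 (ht.1.trans ht.2)) ht ht.1
  simp only [mul_zero, Real.exp_zero, one_mul, sub_zero] at h0
  have h1 : Real.exp (-c * t) * y t ≤ y 0 + A * t := by linarith
  calc y t = Real.exp (c * t) * (Real.exp (-c * t) * y t) := by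
        rw [← mul_assoc, ← Real.exp_add]
        simp
    _ ≤ _ := mul_le_mul_of_nonneg_left h1 (Real.exp_pos _).le

/-! ### Differentiability of the corrections in time. -/

section Time

variable {a b : ℝ} {N : ℕ} [NeZero N] {k : ℕ} {F : Flux} {𝓜 : Mesh a b N} {s : Fin N → Fin N}
  {p : ℕ} {K σ T : ℝ} {u : ℝ → ℝ → ℂ}

/-- `u(·, t)` is of class `Cⁿ` with derivatives of orders `1, …, n` bounded by `B`. -/
def DerivsLE (T : ℝ) (n : ℕ) (u : ℝ → ℝ → ℂ) (B : ℝ) : Prop :=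
  ∀ t ∈ Set.Icc 0 T, ContDiff ℝ n (u t) ∧ ∀ i, 1 ≤ i → i ≤ n → ∀ x, ‖iteratedDeriv i (u t) x‖ ≤ B

lemma DerivsLE.of_le {n m : ℕ} {B : ℝ} (h : DerivsLE T n u B) (hm : m ≤ n) : DerivsLE T m u B :=
  fun t ht => ⟨(h t ht).1.of_nat_le hm, fun i hi him => (h t ht).2 i hi (him.trans hm)⟩

lemma contDiff_iteratedDeriv {f : ℝ → ℂ} {m n : ℕ} (hf : ContDiff ℝ (m + n : ℕ) f) :
    ContDiff ℝ m (iteratedDeriv n f) := by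
  rw [iteratedDeriv_eq_iterate]
  exact ContDiff.iterate_deriv' m n (by exact_mod_cast hf)

lemma iteratedDeriv_iteratedDeriv (f : ℝ → ℂ) (m n : ℕ) :
    iteratedDeriv m (iteratedDeriv n f) = iteratedDeriv (m + n) f := by
  rw [iteratedDeriv_eq_iterate, iteratedDeriv_eq_iterate, iteratedDeriv_eq_iterate,
    ← Function.iterate_add_apply]

lemma contDiff_iteratedDeriv_two {f : ℝ → ℂ} {n : ℕ} (hf : ContDiff ℝ (n + 2 : ℕ) f) :
    ContDiff ℝ n (iteratedDeriv 2 f) := contDiff_iteratedDeriv hf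

/-- Time derivative of the corrections. -/
lemma Good.hasDerivWithinAt_isW (h : Good k F 𝓜 s p K) (hk : 2 ≤ k) (hσ : 𝓜.Regular σ)
    (hu : Solves T u) {q : ℕ} {B : ℝ} (hB : DerivsLE T (2 * q + 5) u B)
    {W W' : ℝ → Fin N → ℝ → ℂ} (hW : ∀ t ∈ Set.Icc 0 T, IsW k F 𝓜.rho s q (𝓜.ref (u t)) (W t))
    {t : ℝ} (ht : t ∈ Set.Icc 0 T)
    (hW' : IsW k F 𝓜.rho s q (𝓜.ref (iteratedDeriv 2 (u t))) (W' t))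
    {ξ : ℝ} (hξ : ξ ∈ Set.Icc (0 : ℝ) 1) (j : Fin N) :
    HasDerivWithinAt (fun τ => W τ j ξ) (Complex.I * W' t j ξ) (Set.Icc 0 T) t := by
  obtain ⟨K₀, hK₀, hS⟩ := Stable.exists_zero 𝓜.size_pos.le h.stable
  have hρ : ∀ j, |𝓜.rho j| ≤ σ := fun j => by
    rw [abs_of_nonneg (zero_le_one.trans (𝓜.one_le_rho j))]
    exact (hσ j).le
  obtain ⟨K', hK', hb⟩ := exists_isW_crude_bound hk hσ.sigma_pos.le hK₀ hρ hS q
  have hB0 : 0 ≤ B := (norm_nonneg _).trans ((hB t ht).2 1 le_rfl (by omega) 0)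
  set L : ℝ := (1 + 𝓜.size) ^ (2 * q + 1)
  have hL0 : 0 ≤ L := pow_nonneg (by linarith [𝓜.size_pos]) _
  -- By linearity W(t') - W(t) - (t' - t) i W'(t) is the correction of the Taylor remainder of u in
  -- time. The crude bound makes it quadratic in t' - t; its dependence on the mesh does not matter
  -- for differentiability. Spatial orders up to 2q + 1 and four more for the Taylor formula give 2q
  -- + 5.
  refine hasDerivWithinAt_of_sq (C := K' * (L * B)) fun t' ht' => ?_
  set c : ℂ := ((t' - t : ℝ) : ℂ) * Complex.I with hc
  have hcu : ∀ τ ∈ Set.Icc 0 T, ∀ m ≤ 2 * q + 5, ContDiff ℝ m (u τ) := fun τ hτ m hm =>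
    (hB τ hτ).1.of_nat_le hm
  have hcu2 : ContDiff ℝ (2 * q + 1 : ℕ) (iteratedDeriv 2 (u t)) :=
    contDiff_iteratedDeriv_two (hcu t ht _ (by omega))
  have hcr := fun τ hτ => 𝓜.contDiff_ref (hcu τ hτ (2 * q + 1) (by omega))
  have H := ((hW t' ht').add (hW t ht) (hcr t' ht') (hcr t ht) (fun _ => 1) (fun _ => -1)
    (fun _ => rfl) (fun _ => rfl)).add hW'
    (fun j => (contDiff_const.mul (hcr t' ht' j)).add (contDiff_const.mul (hcr t ht j)))
    (𝓜.contDiff_ref hcu2) (fun _ => 1) (fun _ => -c) (fun _ => rfl) (fun _ => rfl)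
  set f : ℝ → ℂ := fun x => u t' x - u t x - c * iteratedDeriv 2 (u t) x with hf
  have hfc : ContDiff ℝ (2 * q + 1 : ℕ) f :=
    ((hcu t' ht' _ (by omega)).sub (hcu t ht _ (by omega))).sub (contDiff_const.mul hcu2)
  have hfd : ∀ i ≤ 2 * q + 1, ∀ x, ‖iteratedDeriv i f x‖ ≤ B * |t' - t| ^ 2 := by
    intro i hi x
    have h1 := hu.taylor i (fun τ hτ => hcu τ hτ (i + 4) (by omega))
      (fun τ hτ x => (hB τ hτ).2 (i + 4) (by omega) (by omega) x) t ht t' ht' x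
    have c1 := hcu t' ht' i (by omega)
    have c2 := hcu t ht i (by omega)
    have c3 := ContDiff.of_nat_le hcu2 hi
    have e : iteratedDeriv i f x = iteratedDeriv i (u t') x - iteratedDeriv i (u t) x
        - (t' - t : ℝ) * (Complex.I * iteratedDeriv (i + 2) (u t) x) := by
      rw [hf, iteratedDeriv_fun_sub (c1.sub c2).contDiffAt (contDiff_const.mul c3).contDiffAt,
        iteratedDeriv_fun_sub c1.contDiffAt c2.contDiffAt, iteratedDeriv_const_mul_field,
        iteratedDeriv_iteratedDeriv, hc]
      ring
    rwa [e]
  have hfam : (fun j ξ => (fun _ => (1 : ℂ)) j * ((fun _ => (1 : ℂ)) j * 𝓜.ref (u t') j ξ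
      + (fun _ => (-1 : ℂ)) j * 𝓜.ref (u t) j ξ)
      + (fun _ => -c) j * 𝓜.ref (iteratedDeriv 2 (u t)) j ξ) = 𝓜.ref f := by
    funext j ξ
    simp only [Mesh.ref, hf]
    ring
  have := hb _ _ (L * (B * |t' - t| ^ 2)) (by positivity) (fun j => ?_) H (fun i hi ξ hξ j => ?_) ξ hξ j
  · calc _ = _ := by congr 1; rw [hc]; ring
      _ ≤ _ := this
      _ = _ := by ring
  · exact (contDiff_const.mul ((contDiff_const.mul (hcr t' ht' j)).add
      (contDiff_const.mul (hcr t ht j)))).add (contDiff_const.mul (𝓜.contDiff_ref hcu2 j))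
  · have e := congrFun hfam j
    dsimp only at e
    rw [e, 𝓜.iteratedDeriv_ref (hfc.of_nat_le hi), norm_mul, norm_pow, Complex.norm_real,
      Real.norm_of_nonneg (𝓜.len_pos j).le]
    refine mul_le_mul ?_ (hfd i hi _) (norm_nonneg _) hL0
    calc 𝓜.len j ^ i ≤ (1 + 𝓜.size) ^ i := by
          refine pow_le_pow_left₀ (𝓜.len_pos j).le ?_ i
          linarith [𝓜.len_le_size j]
      _ ≤ _ := pow_le_pow_right₀ (by linarith [𝓜.size_pos]) hi

end Time

lemma dt_eq_of_hasDerivWithinAt {N : ℕ} {T : ℝ} {W : ℝ → Fin N → ℝ → ℂ} (hT : 0 < T) {t : ℝ}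
    (ht : t ∈ Set.Icc 0 T) {j : Fin N} {x : ℝ} {c : ℂ}
    (h : HasDerivWithinAt (fun τ => W τ j x) c (Set.Icc 0 T) t) : dt T W t j x = c :=
  h.derivWithin (uniqueDiffOn_Icc hT t ht)

lemma Vh_sub {N k : ℕ} {v w : Fin N → ℂ[X]} (hv : v ∈ Vh N k) (hw : w ∈ Vh N k) :
    v - w ∈ Vh N k := fun j => (natDegree_sub_le _ _).trans (max_le (hv j) (hw j))

/-! ### The error equation. -/

section Error

variable {a b : ℝ} {N : ℕ} [NeZero N] {k : ℕ} {F : Flux} {𝓜 : Mesh a b N} {s : Fin N → Fin N}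
  {p : ℕ} {K σ T : ℝ} {u : ℝ → ℝ → ℂ}

/-- The function `w_q` in reference coordinates. -/
def wfun (k : ℕ) (F : Flux) (𝓜 : Mesh a b N) (T : ℝ) (u : ℝ → ℝ → ℂ) :
    ℕ → ℝ → Fin N → ℝ → ℂ
  | 0, t => fun j ξ => 𝓜.ref (u t) j ξ - pf (𝓜.pull j (Pstar k F 𝓜 (u t) j)) ξ
  | q + 1, t => fun j => pf (𝓜.pull j (correction k F 𝓜 T u q t j))

/-- The function whose time derivative determines the correction number `q`. -/
def wsrc (k : ℕ) (F : Flux) (𝓜 : Mesh a b N) (T : ℝ) (u : ℝ → ℝ → ℂ) :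
    ℕ → ℝ → Fin N → ℝ → ℂ
  | 0 => fun t j x => u t x - toFun (Pstar k F 𝓜 (u t)) j x
  | q + 1 => fun t => toFun (correction k F 𝓜 T u q t)

lemma correction_eq (q : ℕ) (t : ℝ) : correction k F 𝓜 T u q t
    = Classical.epsilon (IsCorrection k F 𝓜 (dt T (wsrc k F 𝓜 T u q) t)) := by
  cases q <;> rfl

lemma wsrc_eq (q : ℕ) (t : ℝ) (j : Fin N) (ξ : ℝ) :
    wsrc k F 𝓜 T u q t j (𝓜.xL j + 𝓜.len j * ξ) = wfun k F 𝓜 T u q t j ξ := by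
  cases q with
  | zero => simp only [wsrc, wfun, 𝓜.pf_pull]; rfl
  | succ q => simp only [wsrc, wfun, 𝓜.pf_pull]; rfl

/-- The functions `w_q` and their time derivatives in reference coordinates. -/
lemma Good.isW_wfun (h : Good k F 𝓜 s p K) (hk : 2 ≤ k) (hσ : 𝓜.Regular σ) (hT : 0 < T)
    (hu : IsExactSolution a b T u) {B : ℝ} (q : ℕ) (hq : 2 * q + 1 ≤ k)
    (hB : DerivsLE T (2 * q + 5) u B) :
    (∀ t ∈ Set.Icc 0 T, IsW k F 𝓜.rho s q (𝓜.ref (u t)) (wfun k F 𝓜 T u q t)) ∧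
    ∀ q', q = q' + 1 → ∀ t ∈ Set.Icc 0 T,
      IsCorrection k F 𝓜 (dt T (wsrc k F 𝓜 T u q') t) (correction k F 𝓜 T u q' t) := by
  induction q with
  | zero =>
    refine ⟨fun t ht => ?_, fun _ h => by omega⟩
    have hc := ContDiff.of_nat_le (m := 1) (hB t ht).1 (by omega)
    exact ((h.isPstar_iff hk (hu.periodic t ht) hc).1 (h.isPstar hk (hu.periodic t ht) hc)).2
  | succ q ih =>
    obtain ⟨ih, -⟩ := ih (by omega) (hB.of_le (by omega))
    have hc := fun t ht => (hB t ht).1.of_nat_le (show 2 * q + 3 ≤ 2 * (q + 1) + 5 by omega)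
    have hex : ∀ t ∈ Set.Icc 0 T, ∃ w, IsW k F 𝓜.rho s q (𝓜.ref (iteratedDeriv 2 (u t))) w :=
      fun t ht => exists_isW hk 𝓜.size_pos.le h.stable (by omega)
        (𝓜.contDiff_ref (contDiff_iteratedDeriv_two (hc t ht)))
    choose! W' hW' using hex
    -- Differentiating w_q in time requires that w_q be already known to satisfy its conditions at
    -- all times; only then is the source of the next `epsilon` choice identified and that
    -- correction shown to exist.
    have hg : ∀ t ∈ Set.Icc 0 T, ∀ j, ∀ ξ ∈ Set.Icc (0 : ℝ) 1,
        dt T (wsrc k F 𝓜 T u q) t j (𝓜.xL j + 𝓜.len j * ξ) = Complex.I * W' t j ξ := by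
      intro t ht j ξ hξ
      refine dt_eq_of_hasDerivWithinAt hT ht ?_
      simp only [wsrc_eq]
      exact h.hasDerivWithinAt_isW hk hσ hu.solves (hB.of_le (by omega)) ih ht (hW' t ht) hξ j
    have hcor : ∀ t ∈ Set.Icc 0 T,
        IsCorrection k F 𝓜 (dt T (wsrc k F 𝓜 T u q) t) (correction k F 𝓜 T u q t) := by
      intro t ht
      rw [correction_eq]
      exact Classical.epsilon_spec (h.exists_isCorrection hk (by omega) (hc t ht) (hW' t ht) (hg t ht))
    refine ⟨fun t ht => ?_, fun q' hq' t ht => ?_⟩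
    · exact h.isW_of_isCorrection (by omega) (hc t ht) (hW' t ht) (hg t ht) (hcor t ht)
    · obtain rfl : q' = q := by omega
      exact hcor t ht

lemma bilinA_add (w w' v : Fin N → ℂ[X]) (j : Fin N) :
    bilinA F 𝓜 (w + w') v j = bilinA F 𝓜 w v j + bilinA F 𝓜 w' v j := by
  have h : ∫ x in (𝓜.xL j)..(𝓜.xR j), toFun (w + w') j x * toFun (dx (dx v)) j x
      = (∫ x in (𝓜.xL j)..(𝓜.xR j), toFun w j x * toFun (dx (dx v)) j x)
        + ∫ x in (𝓜.xL j)..(𝓜.xR j), toFun w' j x * toFun (dx (dx v)) j x := by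
    rw [← intervalIntegral.integral_add]
    · congr 1
      ext x
      simp only [toFun, Pi.add_apply, eval_add]
      ring
    · exact intervalIntegrable_mul_pf (continuous_pf (w j)) _ _ _
    · exact intervalIntegrable_mul_pf (continuous_pf (w' j)) _ _ _
  simp only [bilinA, h, hatFlux, tildeFlux, avg, jump, vMinus, vPlus, dx, Pi.add_apply, eval_add,
    derivative_add]
  ring

lemma bilinA_smul (c : ℂ) (w v : Fin N → ℂ[X]) (j : Fin N) :
    bilinA F 𝓜 (c • w) v j = c * bilinA F 𝓜 w v j := by
  have h : ∫ x in (𝓜.xL j)..(𝓜.xR j), toFun (c • w) j x * toFun (dx (dx v)) j x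
      = c * ∫ x in (𝓜.xL j)..(𝓜.xR j), toFun w j x * toFun (dx (dx v)) j x := by
    rw [← intervalIntegral.integral_const_mul]
    congr 1
    ext x
    simp only [toFun, Pi.smul_apply, eval_smul, smul_eq_mul]
    ring
  simp only [bilinA, h, hatFlux, tildeFlux, avg, jump, vMinus, vPlus, dx, Pi.smul_apply, eval_smul,
    derivative_smul, smul_eq_mul]
  ring

/-- The scheme applied to its first argument as a linear map. -/
def bilinL (F : Flux) (𝓜 : Mesh a b N) (v : Fin N → ℂ[X]) (j : Fin N) :
    (Fin N → ℂ[X]) →ₗ[ℂ] ℂ where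
  toFun w := bilinA F 𝓜 w v j
  map_add' w w' := bilinA_add w w' v j
  map_smul' c w := bilinA_smul c w v j

lemma bilinA_sub (w w' v : Fin N → ℂ[X]) (j : Fin N) :
    bilinA F 𝓜 (w - w') v j = bilinA F 𝓜 w v j - bilinA F 𝓜 w' v j :=
  (bilinL F 𝓜 v j).map_sub w w'

lemma bilinA_sum {ι : Type*} (S : Finset ι) (w : ι → Fin N → ℂ[X]) (v : Fin N → ℂ[X]) (j : Fin N) :
    bilinA F 𝓜 (∑ i ∈ S, w i) v j = ∑ i ∈ S, bilinA F 𝓜 (w i) v j :=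
  map_sum (bilinL F 𝓜 v j) w S

/-- Consistency of the scheme on the projection. -/
lemma IsPstar.bilinA_eq {f : ℝ → ℂ} {P : Fin N → ℂ[X]} (hP : IsPstar k F 𝓜 f P)
    (hf : Function.Periodic f (b - a)) (hc : ContDiff ℝ 2 f) {v : Fin N → ℂ[X]} (hv : v ∈ Vh N k)
    (j : Fin N) : bilinA F 𝓜 P v j
      = ∫ x in (𝓜.xL j)..(𝓜.xR j), iteratedDeriv 2 f x * pf (v j) x := by
  have hL : 𝓜.xL (j - 1 + 1) = 𝓜.xL j := by rw [sub_add_cancel]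
  have h3 := 𝓜.periodic_xL hf (j - 1) 0
  have hp := periodic_iteratedDeriv hf 1
  rw [iteratedDeriv_one] at hp
  have h4 := 𝓜.periodic_xL hp (j - 1) 0
  rw [add_zero, add_zero, hL] at h3 h4
  have hd1 : ∀ x, HasDerivAt f (deriv f x) x := fun x =>
    (hc.differentiable (by simp) x).hasDerivAt
  have hd2 : ∀ x, HasDerivAt (deriv f) (iteratedDeriv 2 f x) x := fun x => by
    have := hasDerivAt_iteratedDeriv (n := 1) hc x
    rwa [iteratedDeriv_one] at this
  have hc1 : Continuous (deriv f) := hc.continuous_deriv (by norm_num)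
  have hc2 : Continuous (iteratedDeriv 2 f) := hc.continuous_iteratedDeriv 2 le_rfl
  have i1 := integral_mul_pf_derivative (a := 𝓜.xL j) (b := 𝓜.xR j) hd1 hc1 (derivative (v j))
  have i2 := integral_mul_pf_derivative (a := 𝓜.xL j) (b := 𝓜.xR j) hd2 hc2 (v j)
  have m : ∫ x in (𝓜.xL j)..(𝓜.xR j), toFun P j x * toFun (dx (dx v)) j x
      = ∫ x in (𝓜.xL j)..(𝓜.xR j), f x * pf (derivative (derivative (v j))) x :=
    hP.moments j _ (natDegree_derivative_derivative_le (hv j))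
  have e1 : vPlus 𝓜 (dx v) (j - 1) = pf (derivative (v j)) (𝓜.xL j) := by
    rw [vPlus, sub_add_cancel]; rfl
  have e2 : vPlus 𝓜 v (j - 1) = pf (v j) (𝓜.xL j) := by
    rw [vPlus, sub_add_cancel]; rfl
  have e3 : vMinus 𝓜 (dx v) j = pf (derivative (v j)) (𝓜.xR j) := rfl
  have e4 : vMinus 𝓜 v j = pf (v j) (𝓜.xR j) := rfl
  rw [bilinA, m, hP.hat_eq, hP.hat_eq, hP.tilde_eq, hP.tilde_eq, e1, e2, e3, e4, ← h3, ← h4, i1, i2]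
  ring

/-- The scheme applied to a correction. -/
lemma IsCorrection.bilinA_eq {g : Fin N → ℝ → ℂ} {P : Fin N → ℂ[X]}
    (hP : IsCorrection k F 𝓜 g P) {q : ℕ} (hq : 2 * q + 3 ≤ k)
    {f : ℝ → ℂ} {w : Fin N → ℝ → ℂ}
    (hw : IsW k F 𝓜.rho s q (𝓜.ref (iteratedDeriv 2 f)) w)
    (hg : ∀ j, ∀ ξ ∈ Set.Icc (0 : ℝ) 1, g j (𝓜.xL j + 𝓜.len j * ξ) = Complex.I * w j ξ)
    {v : Fin N → ℂ[X]} (hv : v ∈ Vh N k)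
    (j : Fin N) : bilinA F 𝓜 P v j
      = 𝓜.len j * ∫ ξ in (0 : ℝ)..1, w j ξ * pf (𝓜.pull j (v j)) ξ := by
  have e : bilinA F 𝓜 P v j
      = ∫ x in (𝓜.xL j)..(𝓜.xR j), pf (P j) x * pf (derivative (derivative (v j))) x := by
    simp only [bilinA, hP.hat_eq, hP.tilde_eq, zero_mul, sub_zero, add_zero]
    rfl
  rw [e]
  -- Linear test functions are not covered by the definition of the correction; orthogonality of `w`
  -- makes both sides zero.
  rcases Nat.lt_or_ge (v j).natDegree 2 with hv2 | hv2
  · rw [derivative_derivative_eq_zero (by omega),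
      hw.orth j (by rw [𝓜.natDegree_pull]; omega)]
    simp
  · have h1 := (correction_moment_iff hg P j (v j)).1 (hP.moments j (v j) (hv j) hv2)
    have h2 := 𝓜.integral_cell_mul_dd (pf (P j)) (v j) j
    rw [𝓜.ref_pf, h1, pow_two, mul_assoc] at h2
    exact mul_left_cancel₀ (𝓜.len_ne_zero j) h2

/-- The piecewise polynomials `z(t)`, with time derivative `z'(t)`, solve the scheme with right-hand
side `g`, given in reference coordinates. -/
structure Evol (k : ℕ) (F : Flux) (𝓜 : Mesh a b N) (T : ℝ) (z z' : ℝ → Fin N → ℂ[X])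
    (g : ℝ → Fin N → ℝ → ℂ) : Prop where
  mem : ∀ t ∈ Set.Icc 0 T, z t ∈ Vh N k
  mem' : ∀ t ∈ Set.Icc 0 T, z' t ∈ Vh N k
  deriv : ∀ t ∈ Set.Icc 0 T, ∀ j x,
    HasDerivWithinAt (fun τ => pf (z τ j) x) (pf (z' t j) x) (Set.Icc 0 T) t
  cont : ∀ t ∈ Set.Icc 0 T, ∀ j, Continuous (g t j)
  eqn : ∀ t ∈ Set.Icc 0 T, ∀ v ∈ Vh N k, ∀ j,
    ∫ x in (𝓜.xL j)..(𝓜.xR j), pf (z' t j) x * pf (v j) x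
      = Complex.I * bilinA F 𝓜 (z t) v j
        + 𝓜.len j * ∫ ξ in (0 : ℝ)..1, g t j ξ * pf (𝓜.pull j (v j)) ξ

/-- Only pointwise differentiability in time is assumed. Since the degree is bounded, interpolation
shows that the time derivative is again a polynomial on each cell. -/
lemma IsUWDGSolution.exists_deriv {uh : ℝ → Fin N → ℂ[X]} (h : IsUWDGSolution k F 𝓜 T uh)
    (hT : 0 < T) : ∃ uh' : ℝ → Fin N → ℂ[X], Evol k F 𝓜 T uh uh' fun _ _ _ => 0 := by
  have hex : ∀ t ∈ Set.Icc 0 T, ∀ j, ∃ Z' : ℂ[X], Z'.natDegree ≤ k ∧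
      ∀ x, HasDerivWithinAt (fun τ => pf (uh τ j) x) (pf Z' x) (Set.Icc 0 T) t := fun t ht j =>
    exists_hasDerivWithinAt_pf (fun τ hτ => h.mem τ hτ j) zero_lt_one ht
      (fun x _ => h.differentiable j x t ht)
  choose! Z' hZ hd using hex
  refine ⟨Z', h.mem, hZ, hd, fun _ _ _ => continuous_const, fun t ht v hv j => ?_⟩
  have := h.scheme t ht v hv j
  have e : ∀ x, dt T (fun τ => toFun (uh τ)) t j x = pf (Z' t j) x := fun x =>
    dt_eq_of_hasDerivWithinAt hT ht (hd t ht j x)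
  simp only [e] at this
  rw [sub_eq_zero] at this
  simp only [zero_mul, intervalIntegral.integral_zero, mul_zero, add_zero]
  exact this

lemma Evol.sub {z z' y y' : ℝ → Fin N → ℂ[X]} {g f : ℝ → Fin N → ℝ → ℂ}
    (hz : Evol k F 𝓜 T z z' g) (hy : Evol k F 𝓜 T y y' f) :
    Evol k F 𝓜 T (fun t => z t - y t) (fun t => z' t - y' t) (fun t j ξ => g t j ξ - f t j ξ) := by
  refine ⟨fun t ht => Vh_sub (hz.mem t ht) (hy.mem t ht),
    fun t ht => Vh_sub (hz.mem' t ht) (hy.mem' t ht), fun t ht j x => ?_,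
    fun t ht j => (hz.cont t ht j).sub (hy.cont t ht j), fun t ht v hv j => ?_⟩
  · have := (hz.deriv t ht j x).sub (hy.deriv t ht j x)
    simp only [Pi.sub_apply, pf_sub]
    exact this
  · simp only [Pi.sub_apply, pf_sub, sub_mul]
    rw [intervalIntegral.integral_sub (intervalIntegrable_mul_pf (continuous_pf _) _ _ _)
      (intervalIntegrable_mul_pf (continuous_pf _) _ _ _),
      intervalIntegral.integral_sub (intervalIntegrable_mul_pf (hz.cont t ht j) _ _ _)
      (intervalIntegrable_mul_pf (hy.cont t ht j) _ _ _), hz.eqn t ht v hv, hy.eqn t ht v hv,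
      bilinA_sub]
    ring

/-- The interpolant `u_I` solves the scheme up to the time derivative of the last correction. -/
lemma Good.evol_uI (h : Good k F 𝓜 s p K) (hk : 2 ≤ k) (hσ : 𝓜.Regular σ) (hT : 0 < T)
    (hu : IsExactSolution a b T u) {B : ℝ} (hB : DerivsLE T (2 * ((k - 1) / 2) + 5) u B) :
    ∃ W : ℝ → Fin N → ℝ → ℂ,
      (∀ t ∈ Set.Icc 0 T, IsW k F 𝓜.rho s ((k - 1) / 2) (𝓜.ref (iteratedDeriv 2 (u t))) (W t)) ∧
      ∃ z' : ℝ → Fin N → ℂ[X],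
        Evol k F 𝓜 T (uI k F 𝓜 T u) z' fun t j ξ => -Complex.I * W t j ξ := by
  set n := (k - 1) / 2 with hn
  have hc : ∀ t ∈ Set.Icc 0 T, ∀ m ≤ 2 * n + 5, ContDiff ℝ m (u t) := fun t ht m hm =>
    (hB t ht).1.of_nat_le hm
  have hex : ∀ q, q ≤ n → ∀ t ∈ Set.Icc 0 T,
      ∃ w, IsW k F 𝓜.rho s q (𝓜.ref (iteratedDeriv 2 (u t))) w :=
    fun q hq t ht => exists_isW hk 𝓜.size_pos.le h.stable (by omega)
      (𝓜.contDiff_ref (contDiff_iteratedDeriv_two (hc t ht (2 * q + 1 + 2) (by omega))))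
  choose! W hW using hex
  have hWc : ∀ q ≤ n, ∀ t ∈ Set.Icc 0 T, ∀ j, Continuous (W q t j) := fun q hq t ht j =>
    ((hW q hq t ht).contDiff (fun j => 𝓜.contDiff_ref
      (contDiff_iteratedDeriv_two (n := 1) (hc t ht 3 (by omega))) j) j).continuous
  have hwf : ∀ q ≤ n, ∀ t ∈ Set.Icc 0 T, ∀ j, ∀ ξ ∈ Set.Icc (0 : ℝ) 1,
      HasDerivWithinAt (fun τ => wfun k F 𝓜 T u q τ j ξ) (Complex.I * W q t j ξ) (Set.Icc 0 T) t :=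
    fun q hq t ht j ξ hξ => h.hasDerivWithinAt_isW hk hσ hu.solves (hB.of_le (by omega))
      (h.isW_wfun hk hσ hT hu q (by omega) (hB.of_le (by omega))).1 ht (hW q hq t ht) hξ j
  have hcor : ∀ q < n, ∀ t ∈ Set.Icc 0 T,
      IsCorrection k F 𝓜 (dt T (wsrc k F 𝓜 T u q) t) (correction k F 𝓜 T u q t) :=
    fun q hq => (h.isW_wfun hk hσ hT hu (q + 1) (by omega) (hB.of_le (by omega))).2 q rfl
  have hP : ∀ t ∈ Set.Icc 0 T, IsPstar k F 𝓜 (u t) (Pstar k F 𝓜 (u t)) := fun t ht =>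
    h.isPstar hk (hu.periodic t ht) (hc t ht 1 (by omega))
  have hmem : ∀ t ∈ Set.Icc 0 T, uI k F 𝓜 T u t ∈ Vh N k := by
    intro t ht j
    rw [uI, Pi.sub_apply, Finset.sum_apply]
    exact (natDegree_sub_le _ _).trans <| max_le ((hP t ht).mem j) (natDegree_sum_le_of_forall_le _ _
      fun q hq => (hcor q (Finset.mem_range.1 hq) t ht).mem j)
  -- Since P*u = u - w_0, the interpolant is u minus w_0 + ⋯ + w_n.
  have heq : ∀ t j ξ, pf (uI k F 𝓜 T u t j) (𝓜.xL j + 𝓜.len j * ξ)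
      = u t (𝓜.xL j + 𝓜.len j * ξ) - ∑ q ∈ Finset.range (n + 1), wfun k F 𝓜 T u q t j ξ := by
    intro t j ξ
    rw [Finset.sum_range_succ', uI, Pi.sub_apply, Finset.sum_apply, pf_sub, pf_sum]
    simp only [wfun, 𝓜.pf_pull, Mesh.ref]
    ring
  have hder : ∀ t ∈ Set.Icc 0 T, ∀ j, ∀ ξ ∈ Set.Icc (0 : ℝ) 1,
      HasDerivWithinAt (fun τ => pf (uI k F 𝓜 T u τ j) (𝓜.xL j + 𝓜.len j * ξ))
        (Complex.I * 𝓜.ref (iteratedDeriv 2 (u t)) j ξ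
          - ∑ q ∈ Finset.range (n + 1), Complex.I * W q t j ξ) (Set.Icc 0 T) t := by
    intro t ht j ξ hξ
    simp only [heq]
    exact (hu.solves t ht _).sub (HasDerivWithinAt.fun_sum fun q hq =>
      hwf q (by have := Finset.mem_range.1 hq; omega) t ht j ξ hξ)
  have hcell : ∀ j, ∀ x ∈ Set.Icc (𝓜.xL j) (𝓜.xR j), ∃ ξ ∈ Set.Icc (0 : ℝ) 1,
      x = 𝓜.xL j + 𝓜.len j * ξ := by
    intro j x hx
    have h0 := 𝓜.len_pos j
    refine ⟨(x - 𝓜.xL j) / 𝓜.len j, ⟨div_nonneg (by linarith [hx.1]) h0.le, ?_⟩, ?_⟩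
    · rw [div_le_one h0, Mesh.len]
      linarith [hx.2]
    · rw [mul_div_cancel₀ _ h0.ne']
      ring
  have hexz : ∀ t ∈ Set.Icc 0 T, ∀ j, ∃ Z' : ℂ[X], Z'.natDegree ≤ k ∧
      ∀ x, HasDerivWithinAt (fun τ => pf (uI k F 𝓜 T u τ j) x) (pf Z' x) (Set.Icc 0 T) t :=
    fun t ht j => exists_hasDerivWithinAt_pf (fun τ hτ => hmem τ hτ j)
      (sub_pos.1 (𝓜.len_pos j)) ht (fun x hx => by
        obtain ⟨ξ, hξ, rfl⟩ := hcell j x hx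
        exact (hder t ht j ξ hξ).differentiableWithinAt)
  choose! z' hz' hzd using hexz
  refine ⟨W n, hW n le_rfl, z', hmem, hz', hzd,
    fun t ht j => continuous_const.mul (hWc n le_rfl t ht j), fun t ht v hv j => ?_⟩
  -- The derivative of w_q is known only inside the cell, so the polynomial z' is compared with it
  -- there, by uniqueness of derivatives.
  have hval : ∀ ξ ∈ Set.Icc (0 : ℝ) 1, pf (𝓜.pull j (z' t j)) ξ
      = Complex.I * 𝓜.ref (iteratedDeriv 2 (u t)) j ξ
          - ∑ q ∈ Finset.range (n + 1), Complex.I * W q t j ξ := fun ξ hξ => by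
    rw [𝓜.pf_pull]
    exact (uniqueDiffOn_Icc hT t ht).eq_deriv _ (hzd t ht j _) (hder t ht j ξ hξ)
  have hint : ∫ x in (𝓜.xL j)..(𝓜.xR j), pf (z' t j) x * pf (v j) x
      = Complex.I * (∫ x in (𝓜.xL j)..(𝓜.xR j), iteratedDeriv 2 (u t) x * pf (v j) x)
        - ∑ q ∈ Finset.range (n + 1), Complex.I * (𝓜.len j *
          ∫ ξ in (0 : ℝ)..1, W q t j ξ * pf (𝓜.pull j (v j)) ξ) := by
    have hcq : ∀ q ∈ Finset.range (n + 1), Continuous (W q t j) := fun q hq =>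
      hWc q (by have := Finset.mem_range.1 hq; omega) t ht j
    have hcu : Continuous (𝓜.ref (iteratedDeriv 2 (u t)) j) :=
      (𝓜.contDiff_ref (contDiff_iteratedDeriv_two (n := 0) (hc t ht 2 (by omega))) j).continuous
    rw [𝓜.integral_cell_mul, 𝓜.integral_cell_mul, 𝓜.ref_pf]
    have e : ∫ ξ in (0 : ℝ)..1, pf (𝓜.pull j (z' t j)) ξ * pf (𝓜.pull j (v j)) ξ
        = ∫ ξ in (0 : ℝ)..1, (Complex.I * (𝓜.ref (iteratedDeriv 2 (u t)) j ξ * pf (𝓜.pull j (v j)) ξ)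
          - ∑ q ∈ Finset.range (n + 1), Complex.I * (W q t j ξ * pf (𝓜.pull j (v j)) ξ)) := by
      refine intervalIntegral.integral_congr fun ξ hξ => ?_
      rw [Set.uIcc_of_le zero_le_one] at hξ
      simp only [hval ξ hξ, sub_mul, Finset.sum_mul, mul_assoc]
    rw [e, intervalIntegral.integral_sub, intervalIntegral.integral_const_mul,
      intervalIntegral.integral_finsetSum, mul_sub, Finset.mul_sum]
    · congr 1
      · ring
      · refine Finset.sum_congr rfl fun q _ => ?_
        rw [intervalIntegral.integral_const_mul]
        ring
    · exact fun q hq => (intervalIntegrable_mul_pf (hcq q hq) _ _ _).const_mul _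
    · exact (intervalIntegrable_mul_pf hcu _ _ _).const_mul _
    · exact (continuous_finsetSum _ fun q hq => continuous_const.mul
        ((hcq q hq).mul (continuous_pf _))).intervalIntegrable _ _
  have hbil : bilinA F 𝓜 (uI k F 𝓜 T u t) v j
      = (∫ x in (𝓜.xL j)..(𝓜.xR j), iteratedDeriv 2 (u t) x * pf (v j) x)
        - ∑ q ∈ Finset.range n, (𝓜.len j *
          ∫ ξ in (0 : ℝ)..1, W q t j ξ * pf (𝓜.pull j (v j)) ξ) := by
    rw [uI, bilinA_sub, bilinA_sum, (hP t ht).bilinA_eq (hu.periodic t ht) (hc t ht 2 (by omega)) hv]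
    congr 1
    refine Finset.sum_congr rfl fun q hq => ?_
    have hq' := Finset.mem_range.1 hq
    refine (hcor q hq' t ht).bilinA_eq (by omega) (hW q hq'.le t ht) (fun j ξ hξ => ?_) hv j
    refine dt_eq_of_hasDerivWithinAt hT ht ?_
    simp only [wsrc_eq]
    exact hwf q hq'.le t ht j ξ hξ
  -- Telescoping: the form applied to w_{q+1} cancels the time derivative of w_q for q < n, and only
  -- q = n remains.
  rw [hint, hbil, Finset.sum_range_succ, mul_sub, Finset.mul_sum]
  simp only [mul_assoc]
  rw [intervalIntegral.integral_const_mul]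
  ring

end Error

/-! ### Symmetry of the form and the energy identity. -/

section Energy

variable {a b : ℝ} {N : ℕ} {k : ℕ} {F : Flux} {𝓜 : Mesh a b N} {T : ℝ}

/-- Conjugation of the coefficients on all cells. -/
def cjf (v : Fin N → ℂ[X]) : Fin N → ℂ[X] := fun j => cj (v j)

lemma cjf_cjf (v : Fin N → ℂ[X]) : cjf (cjf v) = v := funext fun j => cj_cj (v j)

lemma cjf_mem {v : Fin N → ℂ[X]} (hv : v ∈ Vh N k) : cjf v ∈ Vh N k := fun j => by
  rw [cjf, natDegree_cj]; exact hv j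

lemma dx_cjf (v : Fin N → ℂ[X]) : dx (cjf v) = cjf (dx v) := funext fun j => derivative_cj (v j)

/-- The square of the `L²` norm. -/
def nsq (𝓜 : Mesh a b N) (v : Fin N → ℂ[X]) : ℝ :=
  ∑ j, ∫ x in (𝓜.xL j)..(𝓜.xR j), ‖pf (v j) x‖ ^ 2

lemma nsq_nonneg (v : Fin N → ℂ[X]) : 0 ≤ nsq 𝓜 v :=
  Finset.sum_nonneg fun j _ => intervalIntegral.integral_nonneg
    (sub_pos.1 (𝓜.len_pos j)).le fun _ _ => by positivity

lemma nsq_eq (v : Fin N → ℂ[X]) :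
    nsq 𝓜 v = ∑ j, 𝓜.len j * ∫ ξ in (0 : ℝ)..1, ‖pf (𝓜.pull j (v j)) ξ‖ ^ 2 := by
  refine Finset.sum_congr rfl fun j _ => ?_
  rw [𝓜.integral_cell, smul_eq_mul]
  simp only [𝓜.pf_pull]

lemma nsq_eq_re (v : Fin N → ℂ[X]) : nsq 𝓜 v
    = (∑ j, ∫ x in (𝓜.xL j)..(𝓜.xR j), pf (v j) x * pf (cj (v j)) x).re := by
  rw [Complex.re_sum]
  refine Finset.sum_congr rfl fun j _ => ?_
  simp only [pf_cj, Complex.mul_conj, Complex.normSq_eq_norm_sq]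
  rw [intervalIntegral.integral_ofReal, Complex.ofReal_re]

lemma norm_pf_pull_cjf (v : Fin N → ℂ[X]) (j : Fin N) (ξ : ℝ) :
    ‖pf (𝓜.pull j (cjf v j)) ξ‖ = ‖pf (𝓜.pull j (v j)) ξ‖ := by
  rw [𝓜.pf_pull, 𝓜.pf_pull, cjf, pf_cj, RCLike.norm_conj]

/-- Young's inequality for a pairing with a bounded function. -/
lemma two_mul_norm_sum_le {g : Fin N → ℝ → ℂ} {G θ : ℝ} (hθ : 0 < θ)
    (hG : ∀ j, ∀ ξ ∈ Set.Icc (0 : ℝ) 1, ‖g j ξ‖ ≤ G) (v : Fin N → ℂ[X]) :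
    2 * ‖∑ j, (𝓜.len j : ℂ) * ∫ ξ in (0 : ℝ)..1, g j ξ * pf (𝓜.pull j (v j)) ξ‖
      ≤ θ * (b - a) * G ^ 2 + 1 / θ * nsq 𝓜 v := by
  have hcell : ∀ j, 2 * ‖∫ ξ in (0 : ℝ)..1, g j ξ * pf (𝓜.pull j (v j)) ξ‖
      ≤ θ * G ^ 2 + 1 / θ * ∫ ξ in (0 : ℝ)..1, ‖pf (𝓜.pull j (v j)) ξ‖ ^ 2 := by
    intro j
    have hc : Continuous fun ξ => ‖pf (𝓜.pull j (v j)) ξ‖ ^ 2 := ((continuous_pf _).norm).pow 2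
    have h1 : ‖∫ ξ in (0 : ℝ)..1, g j ξ * pf (𝓜.pull j (v j)) ξ‖
        ≤ ∫ ξ in (0 : ℝ)..1, (θ / 2 * G ^ 2 + 1 / (2 * θ) * ‖pf (𝓜.pull j (v j)) ξ‖ ^ 2) := by
      refine intervalIntegral.norm_integral_le_of_norm_le zero_le_one ?_
        ((continuous_const.add (continuous_const.mul hc)).intervalIntegrable _ _)
      refine Filter.Eventually.of_forall fun ξ hξ => ?_
      have h2 := hG j ξ ⟨hξ.1.le, hξ.2⟩
      rw [norm_mul]
      set A := ‖g j ξ‖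
      set B := ‖pf (𝓜.pull j (v j)) ξ‖
      have hA : 0 ≤ A := norm_nonneg _
      have h3 : A ^ 2 ≤ G ^ 2 := pow_le_pow_left₀ hA h2 2
      have h4 : A * B ≤ θ / 2 * A ^ 2 + 1 / (2 * θ) * B ^ 2 := by
        have : θ / 2 * A ^ 2 + 1 / (2 * θ) * B ^ 2 - A * B = (θ * A - B) ^ 2 / (2 * θ) := by
          field_simp
          ring
        have h5 : 0 ≤ (θ * A - B) ^ 2 / (2 * θ) := by positivity
        linarith
      have h6 : θ / 2 * A ^ 2 ≤ θ / 2 * G ^ 2 := mul_le_mul_of_nonneg_left h3 (by positivity)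
      linarith
    have hi : IntervalIntegrable (fun ξ => 1 / (2 * θ) * ‖pf (𝓜.pull j (v j)) ξ‖ ^ 2) volume 0 1 :=
      (continuous_const.mul hc).intervalIntegrable _ _
    rw [intervalIntegral.integral_add (continuous_const.intervalIntegrable _ _) hi, intervalIntegral.integral_const,
      intervalIntegral.integral_const_mul, sub_zero, one_smul] at h1
    calc _ ≤ 2 * (θ / 2 * G ^ 2 + 1 / (2 * θ) * ∫ ξ in (0 : ℝ)..1, ‖pf (𝓜.pull j (v j)) ξ‖ ^ 2) :=
          mul_le_mul_of_nonneg_left h1 (by norm_num)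
      _ = _ := by field_simp
  calc _ ≤ 2 * ∑ j, 𝓜.len j * ‖∫ ξ in (0 : ℝ)..1, g j ξ * pf (𝓜.pull j (v j)) ξ‖ := by
        refine mul_le_mul_of_nonneg_left ((norm_sum_le _ _).trans_eq ?_) (by norm_num)
        refine Finset.sum_congr rfl fun j _ => ?_
        rw [norm_mul, Complex.norm_real, Real.norm_of_nonneg (𝓜.len_pos j).le]
    _ = ∑ j, 𝓜.len j * (2 * ‖∫ ξ in (0 : ℝ)..1, g j ξ * pf (𝓜.pull j (v j)) ξ‖) := by
        rw [Finset.mul_sum]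
        exact Finset.sum_congr rfl fun j _ => by ring
    _ ≤ ∑ j, 𝓜.len j * (θ * G ^ 2 + 1 / θ * ∫ ξ in (0 : ℝ)..1, ‖pf (𝓜.pull j (v j)) ξ‖ ^ 2) :=
        Finset.sum_le_sum fun j _ => mul_le_mul_of_nonneg_left (hcell j) (𝓜.len_pos j).le
    _ = _ := by
        rw [nsq_eq, ← 𝓜.sum_len, Finset.mul_sum, Finset.mul_sum, Finset.sum_mul,
          ← Finset.sum_add_distrib]
        exact Finset.sum_congr rfl fun j _ => by ring

lemma nsq_cjf (v : Fin N → ℂ[X]) : nsq 𝓜 (cjf v) = nsq 𝓜 v := by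
  rw [nsq_eq, nsq_eq]
  simp only [norm_pf_pull_cjf]

variable [NeZero N]

lemma sum_sub_one {M : Type*} [AddCommMonoid M] (f : Fin N → M) : ∑ j, f (j - 1) = ∑ j, f j :=
  Equiv.sum_comp (Equiv.subRight 1) f

lemma sum_add_one {M : Type*} [AddCommMonoid M] (f : Fin N → M) : ∑ j, f (j + 1) = ∑ j, f j :=
  Equiv.sum_comp (Equiv.addRight 1) f

/-- The global bilinear form with the interface terms collected. -/
lemma sum_bilinA (w v : Fin N → ℂ[X]) : ∑ j, bilinA F 𝓜 w v j
    = ∑ j, ((∫ x in (𝓜.xL j)..(𝓜.xR j), toFun w j x * toFun (dx (dx v)) j x)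
      + hatFlux F 𝓜 w j * jump 𝓜 (dx v) j - tildeFlux F 𝓜 w j * jump 𝓜 v j) := by
  have h := sum_sub_one fun j => hatFlux F 𝓜 w j * vPlus 𝓜 (dx v) j - tildeFlux F 𝓜 w j * vPlus 𝓜 v j
  calc ∑ j, bilinA F 𝓜 w v j = ∑ j, ((∫ x in (𝓜.xL j)..(𝓜.xR j), toFun w j x * toFun (dx (dx v)) j x)
        - hatFlux F 𝓜 w j * vMinus 𝓜 (dx v) j + tildeFlux F 𝓜 w j * vMinus 𝓜 v j)
        + ∑ j, (hatFlux F 𝓜 w (j - 1) * vPlus 𝓜 (dx v) (j - 1)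
          - tildeFlux F 𝓜 w (j - 1) * vPlus 𝓜 v (j - 1)) := by
        rw [← Finset.sum_add_distrib]
        refine Finset.sum_congr rfl fun j _ => ?_
        rw [bilinA]
        ring
    _ = _ := by
        rw [h, ← Finset.sum_add_distrib]
        refine Finset.sum_congr rfl fun j _ => ?_
        rw [jump, jump]
        ring

/-- One integration by parts and [w v_x] = {w}[v_x] + [w]{v_x} reduce the interface terms to
-[w]{v_x} - {w_x}[v] - α₁([w][v_x] + [w_x][v]) + β₂[w_x][v_x] - β₁[w][v], which is symmetric. The
opposite signs of α₁ in the two fluxes are essential. -/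
lemma sum_bilinA_symm (w v : Fin N → ℂ[X]) :
    ∑ j, bilinA F 𝓜 w v j = ∑ j, bilinA F 𝓜 v w j := by
  have key : ∀ w v : Fin N → ℂ[X], ∑ j, bilinA F 𝓜 w v j
      = ∑ j, (-(∫ x in (𝓜.xL j)..(𝓜.xR j), toFun (dx w) j x * toFun (dx v) j x)
        + (vMinus 𝓜 w j * vMinus 𝓜 (dx v) j - vPlus 𝓜 w j * vPlus 𝓜 (dx v) j
        + hatFlux F 𝓜 w j * jump 𝓜 (dx v) j - tildeFlux F 𝓜 w j * jump 𝓜 v j)) := by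
    intro w v
    have h := sum_add_one fun j => pf (w j) (𝓜.xL j) * pf (derivative (v j)) (𝓜.xL j)
    have hi : ∀ j, ∫ x in (𝓜.xL j)..(𝓜.xR j), toFun w j x * toFun (dx (dx v)) j x
        = vMinus 𝓜 w j * vMinus 𝓜 (dx v) j - pf (w j) (𝓜.xL j) * pf (derivative (v j)) (𝓜.xL j)
          - ∫ x in (𝓜.xL j)..(𝓜.xR j), toFun (dx w) j x * toFun (dx v) j x := fun j =>
      integral_mul_pf_derivative (a := 𝓜.xL j) (b := 𝓜.xR j) (hasDerivAt_pf (w j))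
        (continuous_pf _) (derivative (v j))
    have h' : ∑ j, vPlus 𝓜 w j * vPlus 𝓜 (dx v) j
        = ∑ j, pf (w j) (𝓜.xL j) * pf (derivative (v j)) (𝓜.xL j) := h
    rw [sum_bilinA]
    simp only [hi, Finset.sum_add_distrib, Finset.sum_sub_distrib, Finset.sum_neg_distrib]
    rw [h']
    ring
  rw [key, key]
  refine Finset.sum_congr rfl fun j _ => ?_
  simp only [mul_comm (toFun (dx w) j _)]
  simp only [hatFlux, tildeFlux, avg, jump]
  ring

/-- The flux parameters and the mesh are real. Together with symmetry this makes A(z, z̄) real. -/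
lemma bilinA_cjf (w v : Fin N → ℂ[X]) (j : Fin N) :
    bilinA F 𝓜 (cjf w) (cjf v) j = (starRingEnd ℂ) (bilinA F 𝓜 w v j) := by
  have h1 : ∀ (v : Fin N → ℂ[X]) j x, toFun (cjf v) j x = (starRingEnd ℂ) (toFun v j x) :=
    fun v j x => pf_cj (v j) x
  have h2 : ∀ (v : Fin N → ℂ[X]) j, vMinus 𝓜 (cjf v) j = (starRingEnd ℂ) (vMinus 𝓜 v j) :=
    fun v j => pf_cj (v j) _
  have h3 : ∀ (v : Fin N → ℂ[X]) j, vPlus 𝓜 (cjf v) j = (starRingEnd ℂ) (vPlus 𝓜 v j) :=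
    fun v j => pf_cj (v (j + 1)) _
  simp only [bilinA, hatFlux, tildeFlux, avg, jump, dx_cjf, h1, h2, h3, ← map_mul, integral_conj']
  simp only [map_add, map_sub, map_mul, map_div₀, Complex.conj_ofReal, map_ofNat]

/-- Energy identity. -/
lemma Evol.hasDerivWithinAt_nsq {z z' : ℝ → Fin N → ℂ[X]} {g : ℝ → Fin N → ℝ → ℂ}
    (H : Evol k F 𝓜 T z z' g) {t : ℝ} (ht : t ∈ Set.Icc 0 T) :
    HasDerivWithinAt (fun τ => nsq 𝓜 (z τ)) (2 * (∑ j, (𝓜.len j : ℂ) *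
      ∫ ξ in (0 : ℝ)..1, g t j ξ * pf (𝓜.pull j (cjf (z t) j)) ξ).re) (Set.Icc 0 T) t := by
  have hcd : ∀ j x, HasDerivWithinAt (fun τ => pf (cj (z τ j)) x) (pf (cj (z' t j)) x)
      (Set.Icc 0 T) t := by
    intro j x
    have := (H.deriv t ht j x).star
    simp only [pf_cj]
    exact this
  have h1 : HasDerivWithinAt
      (fun τ => ∑ j, ∫ x in (𝓜.xL j)..(𝓜.xR j), pf (z τ j) x * pf (cj (z τ j)) x)
      (∑ j, ((∫ x in (𝓜.xL j)..(𝓜.xR j), pf (z' t j) x * pf (cj (z t j)) x)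
        + ∫ x in (𝓜.xL j)..(𝓜.xR j), pf (z t j) x * pf (cj (z' t j)) x)) (Set.Icc 0 T) t :=
    HasDerivWithinAt.fun_sum fun j _ => hasDerivWithinAt_integral_pf_mul_pf
      (fun τ hτ => H.mem τ hτ j) (fun τ hτ => by rw [natDegree_cj]; exact H.mem τ hτ j)
      (H.mem' t ht j) (by rw [natDegree_cj]; exact H.mem' t ht j) ht (H.deriv t ht j) (hcd j) _ _
  have h2 := Complex.reCLM.hasFDerivAt.comp_hasDerivWithinAt t h1
  have h3 : ∀ j, ∫ x in (𝓜.xL j)..(𝓜.xR j), pf (z t j) x * pf (cj (z' t j)) x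
      = (starRingEnd ℂ) (∫ x in (𝓜.xL j)..(𝓜.xR j), pf (z' t j) x * pf (cj (z t j)) x) := by
    intro j
    rw [← integral_conj']
    congr 1
    ext x
    rw [pf_cj, pf_cj, map_mul, Complex.conj_conj, mul_comm]
  have h4 := fun j => H.eqn t ht (cjf (z t)) (cjf_mem (H.mem t ht)) j
  -- A(z, z̄) is real, so i A(z, z̄) contributes nothing to the real part.
  have h5 : (∑ j, bilinA F 𝓜 (z t) (cjf (z t)) j).im = 0 := by
    rw [← Complex.conj_eq_iff_im, map_sum]
    simp only [← bilinA_cjf, cjf_cjf]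
    exact sum_bilinA_symm _ _
  have e : (fun τ => nsq 𝓜 (z τ)) = fun τ => Complex.reCLM
      (∑ j, ∫ x in (𝓜.xL j)..(𝓜.xR j), pf (z τ j) x * pf (cj (z τ j)) x) :=
    funext fun τ => nsq_eq_re _
  rw [e]
  refine h2.congr_deriv ?_
  simp only [h3, Finset.sum_add_distrib, ← map_sum]
  change (_ + (starRingEnd ℂ) _ : ℂ).re = _
  rw [Complex.add_re, Complex.conj_re, ← two_mul]
  congr 1
  have h6 : ∑ j, ∫ x in (𝓜.xL j)..(𝓜.xR j), pf (z' t j) x * pf (cj (z t j)) x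
      = Complex.I * (∑ j, bilinA F 𝓜 (z t) (cjf (z t)) j) + ∑ j, (𝓜.len j : ℂ) *
      ∫ ξ in (0 : ℝ)..1, g t j ξ * pf (𝓜.pull j (cjf (z t) j)) ξ := by
    rw [Finset.mul_sum, ← Finset.sum_add_distrib]
    exact Finset.sum_congr rfl fun j _ => h4 j
  rw [h6, Complex.add_re, Complex.I_mul_re, h5, neg_zero, zero_add]

/-- Stability of the scheme. -/
lemma Evol.nsq_le {z z' : ℝ → Fin N → ℂ[X]} {g : ℝ → Fin N → ℝ → ℂ} (hab : a < b) (hT : 0 < T)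
    (H : Evol k F 𝓜 T z z' g) {G : ℝ}
    (hG : ∀ t ∈ Set.Icc 0 T, ∀ j, ∀ ξ ∈ Set.Icc (0 : ℝ) 1, ‖g t j ξ‖ ≤ G) {t : ℝ}
    (ht : t ∈ Set.Icc 0 T) :
    nsq 𝓜 (z t) ≤ Real.exp 1 * (nsq 𝓜 (z 0) + (b - a) * (T * G) ^ 2) := by
  have hA : 0 ≤ T * (b - a) * G ^ 2 := by
    have := sub_pos.2 hab
    positivity
  -- Young's inequality with weight T gives the growth rate 1/T, so the exponential factor never
  -- exceeds e.
  have h1 := le_exp_mul_of_deriv_le hA (by positivity : 0 ≤ 1 / T)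
    (fun t ht => H.hasDerivWithinAt_nsq ht) (fun t ht => ?_) ht
  · refine h1.trans (mul_le_mul (Real.exp_le_exp.2 ?_) ?_ ?_ (Real.exp_pos _).le)
    · rw [one_div, inv_mul_eq_div]
      exact (div_le_one hT).2 ht.2
    · have : T * (b - a) * G ^ 2 * t ≤ T * (b - a) * G ^ 2 * T := mul_le_mul_of_nonneg_left ht.2 hA
      linarith
    · have := nsq_nonneg (𝓜 := 𝓜) (z 0)
      have := mul_nonneg hA ht.1
      linarith
  · have ht' : t ∈ Set.Icc 0 T := ⟨ht.1.le, ht.2.le⟩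
    have h2 := two_mul_norm_sum_le (𝓜 := 𝓜) hT (hG t ht') (cjf (z t))
    rw [nsq_cjf] at h2
    refine le_trans ?_ h2
    exact mul_le_mul_of_nonneg_left (Complex.re_le_norm _) (by norm_num)

end Energy

lemma Mesh.Regular.abs_rho_le {a b : ℝ} {N : ℕ} {𝓜 : Mesh a b N} {σ : ℝ} (h : 𝓜.Regular σ)
    (j : Fin N) : |𝓜.rho j| ≤ |σ| := by
  rw [abs_of_nonneg (zero_le_one.trans (𝓜.one_le_rho j))]
  exact (h j).le.trans (le_abs_self σ)

/-- Bound for the time derivatives of the corrections, with differences along `π`. -/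
lemma exists_bd_isW {k : ℕ} (hk : 2 ≤ k) (F : Flux) (σ : ℝ) {K : ℝ} (hK : 0 ≤ K) (q : ℕ) :
    ∃ K' : ℝ, 0 ≤ K' ∧ ∀ {a b : ℝ} {N : ℕ} [NeZero N] (𝓜 : Mesh a b N) (s π : Fin N → Fin N)
      (p e : ℕ), 𝓜.Regular σ → Compat π s 𝓜.rho → Stable k F 𝓜.rho s π 𝓜.size p K →
      (∀ i, 𝓜.len (π i) = 𝓜.len i) →
      ∀ (f : ℝ → ℂ) (w : Fin N → ℝ → ℂ) (M : ℝ), 0 ≤ M → ContDiff ℝ (k + 3 + 2 * q : ℕ) f →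
      (∀ ξ ∈ Set.Icc (0 : ℝ) 1, Bd π 𝓜.size (p * (q + 1) + e) M
        fun j => 𝓜.ref (iteratedDeriv (k + 3 + 2 * q) f) j ξ) →
      IsW k F 𝓜.rho s q (𝓜.ref (iteratedDeriv 2 f)) w →
      ∀ ξ ∈ Set.Icc (0 : ℝ) 1,
        Bd π 𝓜.size e (K' * (𝓜.size ^ (k + 1 + 2 * q) * M)) fun j => w j ξ := by
  obtain ⟨K', hK', hb⟩ := exists_isW_bound hk F (abs_nonneg σ) hK q
  refine ⟨K', hK', fun 𝓜 s π p e hσ hπ hS hlen f w M hM hf hbd hw => ?_⟩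
  have h0 := 𝓜.size_pos.le
  have hf2 : ContDiff ℝ (k + 1 + 2 * q : ℕ) (iteratedDeriv 2 f) :=
    contDiff_iteratedDeriv_two (hf.of_nat_le (by omega))
  refine hb 𝓜.rho s π 𝓜.size p h0 hσ.abs_rho_le hπ hS e _ w _ (by positivity)
    (𝓜.contDiff_ref hf2) hw fun ξ hξ => ?_
  have h1 := (hbd ξ hξ).mul (c := fun j => (𝓜.len j : ℂ) ^ (k + 1 + 2 * q))
    (K := 𝓜.size ^ (k + 1 + 2 * q)) (fun j => by
      rw [norm_pow, Complex.norm_real, Real.norm_of_nonneg (𝓜.len_pos j).le]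
      exact pow_le_pow_left₀ (𝓜.len_pos j).le (𝓜.len_le_size j) _) (fun j => by rw [hlen])
  convert h1 using 2 with j
  rw [𝓜.iteratedDeriv_ref hf2, iteratedDeriv_iteratedDeriv]
  rw [show k + 1 + 2 * q + 2 = k + 3 + 2 * q by ring]

/-! ### The basic estimate from the size of the residual. -/

section Basic

variable {a b : ℝ} {N : ℕ} {k : ℕ} {F : Flux} {𝓜 : Mesh a b N} {s : Fin N → Fin N}
  {p : ℕ} {K σ T : ℝ} {u : ℝ → ℝ → ℂ}

lemma l2norm_eq (v : Fin N → ℂ[X]) : l2norm 𝓜 v = Real.sqrt (nsq 𝓜 v) := rfl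

lemma nsq_zero : nsq 𝓜 (0 : Fin N → ℂ[X]) = 0 := by simp [nsq]

lemma SeminormLE.derivsLE {n : ℕ} {M : ℝ} (hab : a < b) (hu : IsExactSolution a b T u)
    (h : SeminormLE T n u M) : DerivsLE T n u ((1 + (b - a)) ^ n * M) := fun t ht =>
  ⟨(h t ht).1, fun _ hi hin x => norm_iteratedDeriv_le_pow (sub_pos.2 hab) (hu.periodic t ht)
    (h t ht).1 (h t ht).2 hi hin x⟩

lemma NormLE.derivsLE {n : ℕ} {M : ℝ} (h : NormLE T n u M) : DerivsLE T n u M := fun t ht =>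
  ⟨(h t ht).1, fun i _ hin x => (h t ht).2 i hin x⟩

/-- Regularity needed for the basic estimate of a scheme whose projection costs `p` differences. -/
def Reg (k p : ℕ) (s : Fin N → Fin N) (𝓜 : Mesh a b N) (T : ℝ) (u : ℝ → ℝ → ℂ) (M : ℝ) : Prop :=
  (∃ B, DerivsLE T (k + 3 + 2 * ((k - 1) / 2)) u B) ∧ ∀ t ∈ Set.Icc 0 T, ∀ ξ ∈ Set.Icc (0 : ℝ) 1,
    Bd s 𝓜.size (p * ((k - 1) / 2 + 1)) M
      fun j => 𝓜.ref (iteratedDeriv (k + 3 + 2 * ((k - 1) / 2)) (u t)) j ξ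

lemma SeminormLE.reg {M : ℝ} (hab : a < b) (hu : IsExactSolution a b T u)
    (h : SeminormLE T (k + 3 + 2 * ((k - 1) / 2)) u M) : Reg k 0 s 𝓜 T u M := by
  refine ⟨⟨_, h.derivsLE hab hu⟩, fun t ht ξ _ => ?_⟩
  rw [zero_mul]
  exact fun j => (h t ht).2 _

variable [NeZero N]

/-- The error equation. -/
lemma Good.exists_evol (h : Good k F 𝓜 s p K) (hk : 2 ≤ k) (hσ : 𝓜.Regular σ) (hT : 0 < T)
    (hu : IsExactSolution a b T u) {B : ℝ} (hB : DerivsLE T (2 * ((k - 1) / 2) + 5) u B)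
    {uh : ℝ → Fin N → ℂ[X]} (huh : IsUWDGSolution k F 𝓜 T uh) :
    ∃ W : ℝ → Fin N → ℝ → ℂ,
      (∀ t ∈ Set.Icc 0 T, IsW k F 𝓜.rho s ((k - 1) / 2) (𝓜.ref (iteratedDeriv 2 (u t))) (W t)) ∧
      ∃ z' : ℝ → Fin N → ℂ[X],
        Evol k F 𝓜 T (fun t => uI k F 𝓜 T u t - uh t) z' fun t j ξ => -Complex.I * W t j ξ := by
  obtain ⟨W, hW, zI, hzI⟩ := h.evol_uI hk hσ hT hu hB
  obtain ⟨uh', huh'⟩ := huh.exists_deriv hT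
  refine ⟨W, hW, fun t => zI t - uh' t, ?_⟩
  have := hzI.sub huh'
  simpa only [sub_zero] using this

/-- The energy estimate for a bounded right-hand side. -/
lemma Evol.l2norm_le {z z' : ℝ → Fin N → ℂ[X]} {g : ℝ → Fin N → ℝ → ℂ} (hab : a < b) (hT : 0 < T)
    (H : Evol k F 𝓜 T z z' g) (h0 : z 0 = 0) {G : ℝ}
    (hG : ∀ t ∈ Set.Icc 0 T, ∀ j, ∀ ξ ∈ Set.Icc (0 : ℝ) 1, ‖g t j ξ‖ ≤ G) {t : ℝ}
    (ht : t ∈ Set.Icc 0 T) :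
    l2norm 𝓜 (z t) ≤ Real.sqrt (Real.exp 1 * (b - a)) * T * G := by
  have hG0 : 0 ≤ G := (norm_nonneg _).trans (hG t ht 0 0 (by simp))
  have h1 := H.nsq_le hab hT hG ht
  rw [h0, nsq_zero, zero_add, ← mul_assoc] at h1
  rw [l2norm_eq, mul_assoc, ← Real.sqrt_sq (mul_nonneg hT.le hG0), ← Real.sqrt_mul']
  · exact Real.sqrt_le_sqrt h1
  · positivity

lemma NormLE.reg {M : ℝ} {n : ℕ} (hU : 𝓜.Uniform) (hu : IsExactSolution a b T u)
    (hn : k + 3 + 2 * ((k - 1) / 2) + p * ((k - 1) / 2 + 1) ≤ n)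
    (h : NormLE T n u M) : Reg k p nxt 𝓜 T u M := by
  refine ⟨⟨_, h.derivsLE.of_le (by omega)⟩, fun t ht ξ _ => ?_⟩
  refine hU.bd_ref (periodic_iteratedDeriv (hu.periodic t ht) _) _ ?_ (fun i hi x => ?_) ξ
  · exact contDiff_iteratedDeriv ((h t ht).1.of_nat_le (by omega))
  · rw [iteratedDeriv_iteratedDeriv]
    exact (h t ht).2 _ (by omega) x

end Basic

/-- The basic error estimate. -/
lemma exists_l2norm_le {k : ℕ} (hk : 2 ≤ k) {a b T : ℝ} (hab : a < b) (hT : 0 < T) (σ : ℝ)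
    (F : Flux) {K : ℝ} (hK : 0 ≤ K) :
    ∃ C : ℝ, 0 ≤ C ∧ ∀ (N : ℕ) [NeZero N] (𝓜 : Mesh a b N) (s : Fin N → Fin N) (p : ℕ),
      𝓜.Regular σ → Good k F 𝓜 s p K → ∀ (u : ℝ → ℝ → ℂ), IsExactSolution a b T u →
      ∀ (uh : ℝ → Fin N → ℂ[X]), IsUWDGSolution k F 𝓜 T uh → uh 0 = uI k F 𝓜 T u 0 →
      ∀ M : ℝ, Reg k p s 𝓜 T u M → ∀ t ∈ Set.Icc 0 T,
        l2norm 𝓜 (uI k F 𝓜 T u t - uh t) ≤ C * M * 𝓜.size ^ (k + 1 + 2 * ((k - 1) / 2)) := by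
  obtain ⟨K', hK', hb⟩ := exists_bd_isW hk F σ hK ((k - 1) / 2)
  refine ⟨Real.sqrt (Real.exp 1 * (b - a)) * T * K', by positivity,
    fun N _ 𝓜 s p hσ hG u hu uh huh h0 M ⟨⟨B, hB⟩, hM⟩ t ht => ?_⟩
  obtain ⟨W, hW, z', hz⟩ := hG.exists_evol hk hσ hT hu (hB.of_le (by omega)) huh
  have hM0 : 0 ≤ M := (norm_nonneg _).trans ((hM t ht 0 (by simp)).norm_le 0)
  have := hz.l2norm_le hab hT (sub_eq_zero.2 h0.symm)
    (G := K' * (𝓜.size ^ (k + 1 + 2 * ((k - 1) / 2)) * M)) (fun t ht j ξ hξ => ?_) ht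
  · refine this.trans_eq ?_
    ring
  · rw [norm_mul, norm_neg, Complex.norm_I, one_mul]
    -- All differences in `Reg` are spent on the stability of the n + 1 stages; only the supremum of
    -- the residual is needed.
    exact (hb 𝓜 s s p 0 hσ hG.compat hG.stable hG.len_s (u t) (W t) M hM0 (hB t ht).1
      (hM t ht) (hW t ht) ξ hξ).norm_le j

/-! ### Residuals with vanishing cell means. -/

/-- Trace inequality for polynomials on the reference cell. -/
lemma exists_trace_le (k : ℕ) : ∃ C : ℝ, 0 ≤ C ∧ ∀ p : ℂ[X], p.natDegree ≤ k →
    ‖pf p 1‖ ^ 2 ≤ C * ∫ ξ in (0 : ℝ)..1, ‖pf p ξ‖ ^ 2 := by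
  refine ⟨∑ i ∈ Finset.range (k + 1), (‖pf (leg i) 1‖ / Real.sqrt (nrm i)) ^ 2,
    Finset.sum_nonneg fun i _ => by positivity, fun p hp => ?_⟩
  have h1 : ‖pf p 1‖ ≤ ∑ i ∈ Finset.range (k + 1),
      (‖pf (leg i) 1‖ / Real.sqrt (nrm i)) * (Real.sqrt (nrm i) * ‖lcoef p i‖) := by
    conv_lhs => rw [eq_sum_leg hp]
    rw [pf_sum]
    refine (norm_sum_le _ _).trans (Finset.sum_le_sum fun i _ => ?_)
    rw [pf_mul, pf_C, norm_mul]
    have := Real.sqrt_pos.2 (nrm_pos i)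
    field_simp
    exact le_rfl
  calc ‖pf p 1‖ ^ 2 ≤ _ := pow_le_pow_left₀ (norm_nonneg _) h1 2
    _ ≤ _ := Finset.sum_mul_sq_le_sq_mul_sq _ _ _
    _ = _ := by
      rw [integral_norm_sq_pf hp]
      congr 1
      refine Finset.sum_congr rfl fun i _ => ?_
      rw [mul_pow, Real.sq_sqrt (nrm_pos i).le]

lemma norm_integral_one_sub_le {g : ℝ → ℂ} {G : ℝ} (hG : ∀ ξ ∈ Set.Icc (0 : ℝ) 1, ‖g ξ‖ ≤ G) :
    ‖∫ ξ in (0 : ℝ)..1, g ξ * (1 - ξ : ℂ)‖ ≤ G := by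
  have hG0 : 0 ≤ G := (norm_nonneg _).trans (hG 0 (by simp))
  have := intervalIntegral.norm_integral_le_of_norm_le_const (a := (0 : ℝ)) (b := 1)
    (f := fun ξ : ℝ => g ξ * (1 - ξ : ℂ)) (C := G) (fun ξ hξ => by
      rw [Set.uIoc_of_le zero_le_one] at hξ
      rw [norm_mul, ← Complex.ofReal_one, ← Complex.ofReal_sub, Complex.norm_real,
        Real.norm_of_nonneg (by linarith [hξ.2])]
      calc ‖g ξ‖ * (1 - ξ) ≤ G * 1 := mul_le_mul (hG ξ ⟨hξ.1.le, hξ.2⟩) (by linarith [hξ.1])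
            (by linarith [hξ.2]) hG0
        _ = G := mul_one G)
  simpa using this

/-- A function with vanishing mean is a second derivative with controlled boundary values. -/
lemma exists_second_antideriv {g : ℝ → ℂ} (hg : Continuous g) (h0 : ∫ ξ in (0 : ℝ)..1, g ξ = 0)
    {G : ℝ} (hG : ∀ ξ ∈ Set.Icc (0 : ℝ) 1, ‖g ξ‖ ≤ G) :
    ∃ H : ℝ → ℂ, Continuous H ∧ (∀ ξ ∈ Set.Icc (0 : ℝ) 1, ‖H ξ‖ ≤ 2 * G) ∧
      ∀ v : ℂ[X], ∫ ξ in (0 : ℝ)..1, g ξ * pf v ξ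
        = -(∫ ξ in (0 : ℝ)..1, g ξ * (1 - ξ : ℂ)) * (pf v 1 - pf v 0)
          + ∫ ξ in (0 : ℝ)..1, H ξ * pf (derivative (derivative v)) ξ := by
  have hG0 : 0 ≤ G := (norm_nonneg _).trans (hG 0 (by simp))
  set A : ℝ → ℂ := fun ξ => ∫ t in (0 : ℝ)..ξ, g t with hA
  -- The mean of A, the primitive of g: with this constant the second antiderivative H, normalised
  -- by H(0) = 0, vanishes at 1 as well. The boundary terms then involve only v, not v'.
  set m : ℂ := ∫ ξ in (0 : ℝ)..1, g ξ * (1 - ξ : ℂ) with hm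
  have hAd : ∀ ξ, HasDerivAt (fun ξ => A ξ - m) (g ξ) ξ := fun ξ =>
    (hg.integral_hasStrictDerivAt 0 ξ).hasDerivAt.sub_const m
  have hAc : Continuous fun ξ => A ξ - m :=
    continuous_iff_continuousAt.2 fun ξ => (hAd ξ).continuousAt
  set H : ℝ → ℂ := fun ξ => ∫ t in (0 : ℝ)..ξ, (A t - m) with hH
  have hHd : ∀ ξ, HasDerivAt H (A ξ - m) ξ := fun ξ => (hAc.integral_hasStrictDerivAt 0 ξ).hasDerivAt
  have hA0 : A 0 = 0 := by simp [hA]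
  have hA1 : A 1 = 0 := h0
  have hH0 : H 0 = 0 := by simp [hH]
  have hparts : ∀ v : ℂ[X], ∫ ξ in (0 : ℝ)..1, g ξ * pf v ξ
      = (A 1 - m) * pf v 1 - (A 0 - m) * pf v 0
        - ∫ ξ in (0 : ℝ)..1, (A ξ - m) * pf (derivative v) ξ := fun v => by
    rw [integral_mul_pf_derivative hAd hg v]
    ring
  have hH1 : H 1 = 0 := by
    have h1 := hparts (1 - X)
    simp only [pf_sub, pf_one, pf_X, derivative_sub, derivative_one, derivative_X, hA0, hA1, pf_zero,
      Complex.ofReal_one, Complex.ofReal_zero] at h1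
    have h2 : H 1 = -∫ ξ in (0 : ℝ)..1, (A ξ - m) * (0 - 1) := by
      rw [intervalIntegral.integral_mul_const]
      simp [hH]
    rw [h2]
    rw [← hm] at h1
    linear_combination -h1
  refine ⟨H, continuous_iff_continuousAt.2 fun ξ => (hHd ξ).continuousAt, fun ξ hξ => ?_, fun v => ?_⟩
  · have hmb : ‖m‖ ≤ G := norm_integral_one_sub_le hG
    have hsub : ∀ {η : ℝ}, η ∈ Set.Icc (0 : ℝ) 1 → ∀ t ∈ Set.uIoc 0 η, t ∈ Set.Icc (0 : ℝ) 1 := by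
      intro η hη t ht
      rw [Set.uIoc_of_le hη.1] at ht
      exact ⟨ht.1.le, ht.2.trans hη.2⟩
    have hAb : ∀ η ∈ Set.Icc (0 : ℝ) 1, ‖A η‖ ≤ G := fun η hη => by
      refine (intervalIntegral.norm_integral_le_of_norm_le_const
        fun t ht => hG t (hsub hη t ht)).trans ?_
      rw [sub_zero, abs_of_nonneg hη.1]
      nlinarith [hη.2]
    refine (intervalIntegral.norm_integral_le_of_norm_le_const (C := 2 * G) fun t ht => ?_).trans ?_
    · refine (norm_sub_le _ _).trans ?_
      linarith [hAb t (hsub hξ t ht)]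
    · rw [sub_zero, abs_of_nonneg hξ.1]
      nlinarith [hξ.2]
  · rw [hparts, integral_mul_pf_derivative hHd hAc (derivative v), hA0, hA1, hH0, hH1]
    ring

/-- The interface values of the first moments of `g`. -/
def firstMoment {a b : ℝ} {N : ℕ} (𝓜 : Mesh a b N) (g : Fin N → ℝ → ℂ) (j : Fin N) : ℂ :=
  𝓜.len j * ∫ ξ in (0 : ℝ)..1, g j ξ * (1 - ξ : ℂ)

lemma norm_firstMoment_le {a b : ℝ} {N : ℕ} {𝓜 : Mesh a b N} {g : Fin N → ℝ → ℂ} {G : ℝ}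
    {j : Fin N} (hG : ∀ ξ ∈ Set.Icc (0 : ℝ) 1, ‖g j ξ‖ ≤ G) :
    ‖firstMoment 𝓜 g j‖ ≤ 𝓜.size * G := by
  rw [firstMoment, norm_mul, Complex.norm_real, Real.norm_of_nonneg (𝓜.len_pos j).le]
  exact mul_le_mul (𝓜.len_le_size j) (norm_integral_one_sub_le hG) (norm_nonneg _)
    ((𝓜.len_pos j).le.trans (𝓜.len_le_size j))

/-- First moments on neighbouring cells of equal length. -/
lemma norm_firstMoment_sub_le {a b : ℝ} {N : ℕ} {𝓜 : Mesh a b N} {g : Fin N → ℝ → ℂ} {G : ℝ}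
    (hg : ∀ j, Continuous (g j)) {i j : Fin N} (hij : 𝓜.len i = 𝓜.len j)
    (hG : ∀ ξ ∈ Set.Icc (0 : ℝ) 1, ‖g i ξ - g j ξ‖ ≤ G) :
    ‖firstMoment 𝓜 g i - firstMoment 𝓜 g j‖ ≤ 𝓜.size * G := by
  have e : firstMoment 𝓜 g i - firstMoment 𝓜 g j
      = firstMoment 𝓜 (fun _ ξ => g i ξ - g j ξ) j := by
    have hc : ∀ l, IntervalIntegrable (fun ξ : ℝ => g l ξ * (1 - ξ : ℂ)) volume 0 1 := fun l =>
      ((hg l).mul (continuous_const.sub Complex.continuous_ofReal)).intervalIntegrable _ _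
    simp only [firstMoment, sub_mul]
    rw [intervalIntegral.integral_sub (hc i) (hc j), hij]
    ring
  rw [e]
  exact norm_firstMoment_le hG

/-- Functionals with vanishing means are represented by the scheme up to jumps of first moments. -/
lemma exists_representation {k : ℕ} (hk : 2 ≤ k) (F : Flux) (σ : ℝ) {K : ℝ} (hK : 0 ≤ K) :
    ∃ C : ℝ, 0 ≤ C ∧ ∀ {a b : ℝ} {N : ℕ} [NeZero N] (𝓜 : Mesh a b N) (s : Fin N → Fin N),
      𝓜.Regular σ → Good k F 𝓜 s 0 K →
      ∀ (g : Fin N → ℝ → ℂ) (G : ℝ), (∀ j, Continuous (g j)) →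
      (∀ j, ∫ ξ in (0 : ℝ)..1, g j ξ = 0) → (∀ j, ∀ ξ ∈ Set.Icc (0 : ℝ) 1, ‖g j ξ‖ ≤ G) →
      ∃ z ∈ Vh N k, (∀ j, ∀ ξ ∈ Set.Icc (0 : ℝ) 1, ‖pf (𝓜.pull j (z j)) ξ‖ ≤ C * (𝓜.size ^ 2 * G)) ∧
        ∀ v : Fin N → ℂ[X], v ∈ Vh N k →
          ∑ j, (𝓜.len j : ℂ) * ∫ ξ in (0 : ℝ)..1, g j ξ * pf (𝓜.pull j (v j)) ξ
            = ∑ j, bilinA F 𝓜 z v j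
              + ∑ j, (firstMoment 𝓜 g (j + 1) - firstMoment 𝓜 g j) * vMinus 𝓜 v j := by
  obtain ⟨B, hB1, hB, -⟩ := exists_leg_bound k
  obtain ⟨K', hK', hsolve⟩ := exists_solve_bound hk F (abs_nonneg σ) hK
  have hf0 := fluxK_nonneg F le_rfl
  refine ⟨K' * (2 * B + fluxK F 0), by positivity, fun {a b N _} 𝓜 s hσ hGood g G hg h0 hG => ?_⟩
  have hs := 𝓜.size_pos.le
  have hG0 : 0 ≤ G := (norm_nonneg _).trans (hG 0 0 (by simp))
  choose H hHc hHb hHi using fun j => exists_second_antideriv (hg j) (h0 j) (hG j)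
  -- Prescribing ẑ = 0 and z̃_x = -m_{j+1}, with m the first moments, makes -z̃_x[v] absorb
  -- m_{j+1}v⁺. What remains at the interface is (m_{j+1} - m_j) v⁻. The factor h is there because
  -- `fl2` is h times the flux.
  obtain ⟨r₁, r₂, hr₁, hr₂, -, hlift⟩ := hGood.flux_lift (fun _ => 0)
    (fun j => -(𝓜.size * firstMoment 𝓜 g (j + 1))) (𝓜.size ^ 2 * G)
    (fun j => by rw [norm_zero]; positivity) (fun j => by
      rw [norm_neg, norm_mul, Complex.norm_real, Real.norm_of_nonneg hs, pow_two, mul_assoc]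
      exact mul_le_mul_of_nonneg_left (norm_firstMoment_le (hG _)) hs)
  obtain ⟨P, hP, hPm, hP1, hP2⟩ := exists_solve_functional hk hs hGood.stable
    (fun j => (𝓜.len j : ℂ) ^ 2 • (intL (H j) (hHc j)).comp (derivative.comp derivative))
    (fun j v hv => by
      simp only [LinearMap.smul_apply, LinearMap.comp_apply]
      rw [derivative_derivative_eq_zero hv, map_zero, smul_zero]) r₁ r₂
  have hPm' : ∀ j, ∀ v : ℂ[X], v.natDegree ≤ k →
      ∫ ξ in (0 : ℝ)..1, pf (P j) ξ * pf (derivative (derivative v)) ξ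
        = (𝓜.len j : ℂ) ^ 2 * ∫ ξ in (0 : ℝ)..1, H j ξ * pf (derivative (derivative v)) ξ := hPm
  choose z hz using fun j => 𝓜.pull_surjective j (P j)
  have hfl := hlift (fun j => pf (P j)) fun j => ⟨hP1 j, hP2 j⟩
  have hPz : (fun j => pf (P j)) = fun j => pf (𝓜.pull j (z j)) := by
    funext j
    rw [hz]
  rw [hPz] at hfl
  have hhat : ∀ j, hatFlux F 𝓜 z j = 0 := fun j => by rw [hatFlux_eq]; exact (hfl j).1
  have htil : ∀ j, tildeFlux F 𝓜 z j = -firstMoment 𝓜 g (j + 1) := fun j => by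
    have := (hfl j).2
    rw [← tildeFlux_eq, ← mul_neg] at this
    exact mul_left_cancel₀ 𝓜.size_ne_zero this
  refine ⟨z, fun j => by rw [← 𝓜.natDegree_pull j, hz]; exact hP j, fun j ξ hξ => ?_, fun v hv => ?_⟩
  · have hR : 0 ≤ (2 * B + fluxK F 0) * (𝓜.size ^ 2 * G) := by positivity
    have hle : fluxK F 0 * (𝓜.size ^ 2 * G) ≤ (2 * B + fluxK F 0) * (𝓜.size ^ 2 * G) :=
      mul_le_mul_of_nonneg_right (by linarith) (by positivity)
    have := hsolve 𝓜.rho s s 𝓜.size 0 0 hs hσ.abs_rho_le hGood.compat hGood.stable P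
      ((2 * B + fluxK F 0) * (𝓜.size ^ 2 * G)) hR hP (fun i hi j => ?_)
      (fun j => by rw [hP1]; exact (hr₁ j).trans hle) (fun j => by rw [hP2]; exact (hr₂ j).trans hle)
      ξ hξ j
    · rw [hz, mul_assoc]
      exact this
    · obtain ⟨S, hS, hd⟩ := exists_derivative_derivative_eq (leg i)
      rw [natDegree_leg] at hd
      have h1 := hPm' j S (by omega)
      rw [hS] at h1
      change ‖mom i (pf (P j))‖ ≤ _
      rw [mom, h1, norm_mul, norm_pow, Complex.norm_real, Real.norm_of_nonneg (𝓜.len_pos j).le]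
      have h2 := Bd.integral (π := id) (h := 0) (l := 0) hHc (continuous_pf (leg i))
        (fun ξ hξ => (hB i (by omega) ξ hξ).1) (fun ξ hξ j => hHb j ξ hξ) j
      calc 𝓜.len j ^ 2 * ‖∫ ξ in (0 : ℝ)..1, H j ξ * pf (leg i) ξ‖
          ≤ 𝓜.size ^ 2 * (B * (2 * G)) := mul_le_mul
            (pow_le_pow_left₀ (𝓜.len_pos j).le (𝓜.len_le_size j) 2) h2 (norm_nonneg _) (by positivity)
        _ ≤ _ := by
          have : 0 ≤ fluxK F 0 * (𝓜.size ^ 2 * G) := by positivity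
          linarith
  · rw [sum_bilinA]
    have hcell : ∀ j, (𝓜.len j : ℂ) * ∫ ξ in (0 : ℝ)..1, g j ξ * pf (𝓜.pull j (v j)) ξ
        = -firstMoment 𝓜 g j * vMinus 𝓜 v j + firstMoment 𝓜 g j * pf (v j) (𝓜.xL j)
          + ∫ x in (𝓜.xL j)..(𝓜.xR j), toFun z j x * toFun (dx (dx v)) j x := by
      intro j
      have h1 := 𝓜.integral_cell_mul_dd (pf (z j)) (v j) j
      rw [𝓜.ref_pf, hz, hPm' j _ (by rw [𝓜.natDegree_pull]; exact hv j), pow_two, mul_assoc] at h1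
      have h2 := mul_left_cancel₀ (𝓜.len_ne_zero j) h1
      have e1 : pf (𝓜.pull j (v j)) 1 = vMinus 𝓜 v j := by
        rw [𝓜.pf_pull, mul_one, 𝓜.xL_add_len]; rfl
      have e2 : pf (𝓜.pull j (v j)) 0 = pf (v j) (𝓜.xL j) := by
        rw [𝓜.pf_pull, mul_zero, add_zero]
      change _ = _ + ∫ x in (𝓜.xL j)..(𝓜.xR j), pf (z j) x * pf (derivative (derivative (v j))) x
      rw [h2, hHi, e1, e2, firstMoment]
      ring
    have hre := sum_add_one fun j => firstMoment 𝓜 g j * pf (v j) (𝓜.xL j)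
    have hre' : ∑ j, firstMoment 𝓜 g j * pf (v j) (𝓜.xL j)
        = ∑ j, firstMoment 𝓜 g (j + 1) * vPlus 𝓜 v j := hre.symm
    simp only [hcell, hhat, htil, zero_mul, add_zero, Finset.sum_add_distrib, hre']
    simp only [← Finset.sum_add_distrib]
    refine Finset.sum_congr rfl fun j _ => ?_
    rw [jump]
    ring

lemma nsq_le_of_norm_le {a b : ℝ} {N : ℕ} {𝓜 : Mesh a b N} {v : Fin N → ℂ[X]} {Z : ℝ}
    (hv : ∀ j, ∀ ξ ∈ Set.Icc (0 : ℝ) 1, ‖pf (𝓜.pull j (v j)) ξ‖ ≤ Z) : nsq 𝓜 v ≤ (b - a) * Z ^ 2 := by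
  rw [nsq_eq, ← 𝓜.sum_len, Finset.sum_mul]
  refine Finset.sum_le_sum fun j _ => mul_le_mul_of_nonneg_left ?_ (𝓜.len_pos j).le
  have : ∫ ξ in (0 : ℝ)..1, ‖pf (𝓜.pull j (v j)) ξ‖ ^ 2 ≤ ∫ _ in (0 : ℝ)..1, Z ^ 2 := by
    refine intervalIntegral.integral_mono_on zero_le_one
      (((continuous_pf _).norm.pow 2).intervalIntegrable _ _)
      (continuous_const.intervalIntegrable _ _) fun ξ hξ => ?_
    exact pow_le_pow_left₀ (norm_nonneg _) (hv j ξ hξ) 2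
  simpa using this

/-! ### Bounds for the time derivative of the error. -/

section TimeDerivative

variable {a b : ℝ} {N : ℕ} [NeZero N] {k : ℕ} {F : Flux} {𝓜 : Mesh a b N} {T : ℝ}
  {z z' : ℝ → Fin N → ℂ[X]} {g : ℝ → Fin N → ℝ → ℂ}

lemma Evol.restrict (H : Evol k F 𝓜 T z z' g) {T' : ℝ} (h : T' ≤ T) : Evol k F 𝓜 T' z z' g := by
  have hs : Set.Icc 0 T' ⊆ Set.Icc 0 T := Set.Icc_subset_Icc_right h
  exact ⟨fun t ht => H.mem t (hs ht), fun t ht => H.mem' t (hs ht),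
    fun t ht j x => (H.deriv t (hs ht) j x).mono hs, fun t ht => H.cont t (hs ht),
    fun t ht => H.eqn t (hs ht)⟩

lemma Evol.shift (H : Evol k F 𝓜 T z z' g) {τ : ℝ} (hτ : 0 ≤ τ) :
    Evol k F 𝓜 (T - τ) (fun t => z (t + τ)) (fun t => z' (t + τ)) (fun t => g (t + τ)) := by
  have hs : ∀ t ∈ Set.Icc 0 (T - τ), t + τ ∈ Set.Icc 0 T := fun t ht =>
    ⟨by linarith [ht.1], by linarith [ht.2]⟩
  refine ⟨fun t ht => H.mem _ (hs t ht), fun t ht => H.mem' _ (hs t ht), fun t ht j x => ?_,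
    fun t ht => H.cont _ (hs t ht), fun t ht => H.eqn _ (hs t ht)⟩
  have h1 : HasDerivWithinAt (fun t => t + τ) 1 (Set.Icc 0 (T - τ)) t :=
    ((hasDerivAt_id t).add_const τ).hasDerivWithinAt
  have := (H.deriv _ (hs t ht) j x).scomp t h1 hs
  rwa [one_smul] at this

/-- Bound for the time derivative of a solution of the scheme. -/
lemma Evol.nsq_deriv_le (hab : a < b) (H : Evol k F 𝓜 T z z' g) (h0 : z 0 = 0) {G L : ℝ}
    (hG : ∀ t ∈ Set.Icc 0 T, ∀ j, ∀ ξ ∈ Set.Icc (0 : ℝ) 1, ‖g t j ξ‖ ≤ G)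
    (hL : ∀ t ∈ Set.Icc 0 T, ∀ t' ∈ Set.Icc 0 T, ∀ j, ∀ ξ ∈ Set.Icc (0 : ℝ) 1,
      ‖g t' j ξ - g t j ξ‖ ≤ L * |t' - t|) {t : ℝ} (ht : t ∈ Set.Ioo 0 T) :
    nsq 𝓜 (z' t) ≤ Real.exp 1 * (Real.exp 1 * ((b - a) * G ^ 2) + (b - a) * (T * L) ^ 2) := by
  have ht' : t ∈ Set.Icc 0 T := ⟨ht.1.le, ht.2.le⟩
  have hba := sub_pos.2 hab
  set R := Real.exp 1 * (Real.exp 1 * ((b - a) * G ^ 2) + (b - a) * (T * L) ^ 2)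
  have hdiff : ∀ τ ∈ Set.Ioo 0 (T - t), nsq 𝓜 (fun j => z (t + τ) j - z t j) ≤ τ ^ 2 * R := by
    intro τ hτ
    have hτT : τ ≤ T := by linarith [hτ.2, ht.1]
    have hτ0 : 0 ≤ T - τ := by linarith [hτ.2, ht.1]
    -- Stability on the short interval [0, τ] has τ in place of T, so z(τ) is of order τ.
    have h1 := (H.restrict hτT).nsq_le hab hτ.1 (G := G) (fun t ht => hG t ⟨ht.1, ht.2.trans hτT⟩)
      (Set.right_mem_Icc.2 hτ.1.le)
    rw [h0, nsq_zero, zero_add] at h1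
    -- The difference z(· + τ) - z solves the scheme with initial value z(τ) and a forcing of size
    -- Lτ.
    have h2 := ((H.shift hτ.1.le).sub (H.restrict (by linarith [hτ.1] : T - τ ≤ T))).nsq_le hab
      (by linarith [hτ.2, ht.1]) (G := L * τ) (fun t ht j ξ hξ => by
        have := hL t ⟨ht.1, by linarith [ht.2, hτ.1]⟩ (t + τ)
          ⟨by linarith [ht.1, hτ.1], by linarith [ht.2]⟩ j ξ hξ
        rwa [add_sub_cancel_left, abs_of_pos hτ.1] at this)
      (t := t) ⟨ht.1.le, by linarith [hτ.2]⟩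
    rw [zero_add, h0, sub_zero] at h2
    refine h2.trans ?_
    have h3 : ((T - τ) * (L * τ)) ^ 2 ≤ τ ^ 2 * (T * L) ^ 2 := by
      have : (T - τ) ^ 2 ≤ T ^ 2 := pow_le_pow_left₀ hτ0 (by linarith [hτ.1]) 2
      have h4 : 0 ≤ (L * τ) ^ 2 := sq_nonneg _
      nlinarith
    have h5 : Real.exp 1 * ((b - a) * (τ * G) ^ 2) = τ ^ 2 * (Real.exp 1 * ((b - a) * G ^ 2)) := by
      ring
    calc _ ≤ Real.exp 1 * (τ ^ 2 * (Real.exp 1 * ((b - a) * G ^ 2)) + (b - a) * (τ ^ 2 * (T * L) ^ 2)) := by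
          refine mul_le_mul_of_nonneg_left (add_le_add (h1.trans_eq h5) ?_) (Real.exp_pos _).le
          exact mul_le_mul_of_nonneg_left h3 hba.le
      _ = _ := by ring
  -- Forward difference quotients in time. They converge pointwise to z', and with bounded degree
  -- the L² norms converge as well, so the bound passes to z'.
  set D : ℝ → Fin N → ℂ[X] := fun τ j => C ((τ : ℂ)⁻¹) * (z (t + τ) j - z t j) with hD
  have hDle : ∀ τ ∈ Set.Ioo 0 (T - t), nsq 𝓜 (D τ) ≤ R := by
    intro τ hτ
    have e : nsq 𝓜 (D τ) = (τ ^ 2)⁻¹ * nsq 𝓜 (fun j => z (t + τ) j - z t j) := by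
      rw [nsq, nsq, Finset.mul_sum]
      refine Finset.sum_congr rfl fun j _ => ?_
      rw [← intervalIntegral.integral_const_mul]
      congr 1
      ext x
      rw [pf_mul, pf_C, norm_mul, mul_pow, norm_inv, Complex.norm_real, Real.norm_of_nonneg hτ.1.le,
        inv_pow]
    rw [e, inv_mul_le_iff₀ (by have := hτ.1; positivity)]
    exact hdiff τ hτ
  have hev : Set.Ioo 0 (T - t) ∈ nhdsWithin (0 : ℝ) (Set.Ioi 0) :=
    Ioo_mem_nhdsGT (by linarith [ht.2])
  have hDt : ∀ j x, Filter.Tendsto (fun τ => pf (D τ j) x) (nhdsWithin 0 (Set.Ioi 0))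
      (nhds (pf (z' t j) x)) := by
    intro j x
    have h1 := ((H.deriv t ht' j x).hasDerivAt (Icc_mem_nhds ht.1 ht.2)).tendsto_slope_zero_right
    refine h1.congr fun τ => ?_
    rw [hD, pf_mul, pf_C, pf_sub, Complex.real_smul, Complex.ofReal_inv]
  have hmemD : ∀ j, ∀ᶠ τ in nhdsWithin (0 : ℝ) (Set.Ioi 0), (D τ j).natDegree ≤ k := by
    intro j
    filter_upwards [hev] with τ hτ
    refine (natDegree_C_mul_le _ _).trans ((natDegree_sub_le _ _).trans (max_le ?_ (H.mem t ht' j)))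
    exact H.mem _ ⟨by linarith [ht.1, hτ.1], by linarith [hτ.2]⟩ j
  have hlim : Filter.Tendsto (fun τ => nsq 𝓜 (D τ)) (nhdsWithin 0 (Set.Ioi 0))
      (nhds (nsq 𝓜 (z' t))) := by
    simp only [nsq_eq_re]
    refine (Complex.continuous_re.tendsto _).comp (tendsto_finsetSum _ fun j _ => ?_)
    refine tendsto_integral_pf_mul_pf (k := k) (hmemD j) ?_ (H.mem' t ht' j) ?_ (hDt j) (fun x => ?_) _ _
    · filter_upwards [hmemD j] with τ hτ
      rwa [natDegree_cj]
    · rw [natDegree_cj]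
      exact H.mem' t ht' j
    · simp only [pf_cj]
      exact (Complex.continuous_conj.tendsto _).comp (hDt j x)
  exact le_of_tendsto hlim (Filter.mem_of_superset hev hDle)

/-- Bound for the global bilinear form through the evolution equation. -/
lemma Evol.norm_sum_bilinA_le (H : Evol k F 𝓜 T z z' g) {t : ℝ} (ht : t ∈ Set.Icc 0 T)
    {v : Fin N → ℂ[X]} (hv : v ∈ Vh N k) {Z G R h : ℝ} (hh : 0 < h)
    (hZ : ∀ j, ∀ ξ ∈ Set.Icc (0 : ℝ) 1, ‖pf (𝓜.pull j (v j)) ξ‖ ≤ h * Z)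
    (hG : ∀ j, ∀ ξ ∈ Set.Icc (0 : ℝ) 1, ‖g t j ξ‖ ≤ G) (hR : nsq 𝓜 (z' t) ≤ R) :
    2 * ‖∑ j, bilinA F 𝓜 (z t) v j‖
      ≤ h * ((b - a) * Z ^ 2 + R) + h * ((b - a) * G ^ 2 + (b - a) * Z ^ 2) := by
  have h1 : Complex.I * ∑ j, bilinA F 𝓜 (z t) v j
      = (∑ j, (𝓜.len j : ℂ) * ∫ ξ in (0 : ℝ)..1, pf (𝓜.pull j (v j)) ξ * pf (𝓜.pull j (z' t j)) ξ)
        - ∑ j, (𝓜.len j : ℂ) * ∫ ξ in (0 : ℝ)..1, g t j ξ * pf (𝓜.pull j (v j)) ξ := by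
    rw [Finset.mul_sum, ← Finset.sum_sub_distrib]
    refine Finset.sum_congr rfl fun j _ => ?_
    have h2 := H.eqn t ht v hv j
    rw [𝓜.integral_cell_mul, 𝓜.ref_pf] at h2
    simp only [mul_comm (pf (𝓜.pull j (v j)) _) (pf (𝓜.pull j (z' t j)) _)]
    rw [h2]
    ring
  have h2 : ‖∑ j, bilinA F 𝓜 (z t) v j‖ = ‖Complex.I * ∑ j, bilinA F 𝓜 (z t) v j‖ := by
    rw [norm_mul, Complex.norm_I, one_mul]
  rw [h2, h1]
  -- The test function is of size h Z, so the weights 1/h against z' and h against g leave a factor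
  -- h in every term.
  have h3 := two_mul_norm_sum_le (𝓜 := 𝓜) (θ := 1 / h) (by positivity) hZ (z' t)
  have h4 := two_mul_norm_sum_le (𝓜 := 𝓜) hh hG v
  have h5 := nsq_le_of_norm_le hZ
  refine (mul_le_mul_of_nonneg_left (norm_sub_le _ _) (by norm_num)).trans ?_
  rw [mul_add]
  refine add_le_add (h3.trans ?_) (h4.trans ?_)
  · have e : 1 / h * (b - a) * (h * Z) ^ 2 + 1 / (1 / h) * nsq 𝓜 (z' t)
        = h * ((b - a) * Z ^ 2 + nsq 𝓜 (z' t)) := by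
      field_simp
    rw [e]
    exact mul_le_mul_of_nonneg_left (by linarith) hh.le
  · have e : h * ((b - a) * G ^ 2 + (b - a) * Z ^ 2)
        = h * (b - a) * G ^ 2 + 1 / h * ((b - a) * (h * Z) ^ 2) := by
      field_simp
    rw [e]
    have : 1 / h * nsq 𝓜 v ≤ 1 / h * ((b - a) * (h * Z) ^ 2) :=
      mul_le_mul_of_nonneg_left h5 (by positivity)
    linarith

end TimeDerivative

/-! ### Interface contributions of the first moments. -/

section Boundary

variable {a b : ℝ} {N : ℕ} {k : ℕ} {𝓜 : Mesh a b N} {σ : ℝ}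

/-- Young's inequality with weight h_j matches the scaling of the trace inequality, so the part
quadratic in v is bounded by the L² norm without a negative power of h. -/
lemma two_mul_norm_boundary_le [NeZero N] {Ct : ℝ}
    (hCt : ∀ p : ℂ[X], p.natDegree ≤ k → ‖pf p 1‖ ^ 2 ≤ Ct * ∫ ξ in (0 : ℝ)..1, ‖pf p ξ‖ ^ 2)
    (d : Fin N → ℂ) {v : Fin N → ℂ[X]} (hv : v ∈ Vh N k) :
    2 * ‖∑ j, d j * vMinus 𝓜 v j‖ ≤ ∑ j, ‖d j‖ ^ 2 / 𝓜.len j + Ct * nsq 𝓜 v := by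
  have e : ∀ j, vMinus 𝓜 v j = pf (𝓜.pull j (v j)) 1 := fun j => by
    rw [𝓜.pf_pull, mul_one, 𝓜.xL_add_len]
    rfl
  calc 2 * ‖∑ j, d j * vMinus 𝓜 v j‖ ≤ 2 * ∑ j, ‖d j‖ * ‖vMinus 𝓜 v j‖ := by
        refine mul_le_mul_of_nonneg_left ((norm_sum_le _ _).trans_eq ?_) (by norm_num)
        exact Finset.sum_congr rfl fun j _ => norm_mul _ _
    _ ≤ ∑ j, (‖d j‖ ^ 2 / 𝓜.len j + 𝓜.len j * ‖vMinus 𝓜 v j‖ ^ 2) := by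
        rw [Finset.mul_sum]
        refine Finset.sum_le_sum fun j _ => ?_
        have h0 := 𝓜.len_pos j
        have h1 : ‖d j‖ ^ 2 / 𝓜.len j + 𝓜.len j * ‖vMinus 𝓜 v j‖ ^ 2
            - 2 * (‖d j‖ * ‖vMinus 𝓜 v j‖)
            = (‖d j‖ - 𝓜.len j * ‖vMinus 𝓜 v j‖) ^ 2 / 𝓜.len j := by
          field_simp
          ring
        have h2 : 0 ≤ (‖d j‖ - 𝓜.len j * ‖vMinus 𝓜 v j‖) ^ 2 / 𝓜.len j := by positivity
        linarith
    _ ≤ _ := by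
        rw [Finset.sum_add_distrib, nsq_eq, Finset.mul_sum]
        refine add_le_add le_rfl (Finset.sum_le_sum fun j _ => ?_)
        rw [mul_left_comm, e]
        exact mul_le_mul_of_nonneg_left (hCt _ (by rw [𝓜.natDegree_pull]; exact hv j))
          (𝓜.len_pos j).le

/-- Where the next cell has equal length, the jump carries an extra h, and the N ≤ σ(b - a)/h such
terms sum to order (hG)². Every other cell is nonuniform and enters the second sum with the weaker
bound. -/
lemma sum_boundary_le [NeZero N] (hσ : 𝓜.Regular σ) {d : Fin N → ℂ} {G G₂ : ℝ}
    (h1 : ∀ j, 𝓜.len (j + 1) = 𝓜.len j → ‖d j‖ ≤ 𝓜.size * (𝓜.size * G))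
    (h2 : ∀ j, ‖d j‖ ≤ 2 * (𝓜.size * G₂)) :
    ∑ j, ‖d j‖ ^ 2 / 𝓜.len j ≤ σ ^ 2 * (b - a) * (𝓜.size * G) ^ 2
      + ∑ _j ∈ 𝓜.nonuniformCells, 4 * σ * 𝓜.size * G₂ ^ 2 := by
  have hs := 𝓜.size_pos
  have hσ0 := hσ.sigma_pos
  have hinv : ∀ j, 1 / 𝓜.len j ≤ σ / 𝓜.size := fun j => by
    have := (hσ j).le
    rw [div_le_iff₀ (𝓜.len_pos j)] at this
    rw [div_le_div_iff₀ (𝓜.len_pos j) hs]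
    linarith
  have hcell : ∀ j, ‖d j‖ ^ 2 / 𝓜.len j ≤ σ * 𝓜.size * (𝓜.size * G) ^ 2
      + if j ∈ 𝓜.nonuniformCells then 4 * σ * 𝓜.size * G₂ ^ 2 else 0 := by
    intro j
    have key : ∀ R, ‖d j‖ ≤ 𝓜.size * R → ‖d j‖ ^ 2 / 𝓜.len j ≤ σ * 𝓜.size * R ^ 2 := by
      intro R hR
      have h3 : ‖d j‖ ^ 2 ≤ (𝓜.size * R) ^ 2 := pow_le_pow_left₀ (norm_nonneg _) hR 2
      calc ‖d j‖ ^ 2 / 𝓜.len j = ‖d j‖ ^ 2 * (1 / 𝓜.len j) := by ring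
        _ ≤ (𝓜.size * R) ^ 2 * (σ / 𝓜.size) := mul_le_mul h3 (hinv j)
            (one_div_nonneg.2 (𝓜.len_pos j).le) (by positivity)
        _ = _ := by field_simp
    by_cases hj : 𝓜.len (j + 1) = 𝓜.len j
    · refine (key _ (h1 j hj)).trans ?_
      split_ifs
      · have : 0 ≤ 4 * σ * 𝓜.size * G₂ ^ 2 := by positivity
        linarith
      · linarith
    · have hmem : j ∈ 𝓜.nonuniformCells := by
        rw [Mesh.nonuniformCells, Finset.mem_filter]
        exact ⟨Finset.mem_univ _, Or.inl (Ne.symm hj)⟩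
      rw [if_pos hmem]
      have := key (2 * G₂) ((h2 j).trans_eq (by ring))
      have h4 : 0 ≤ σ * 𝓜.size * (𝓜.size * G) ^ 2 := by positivity
      linarith
  refine (Finset.sum_le_sum fun j _ => hcell j).trans ?_
  rw [Finset.sum_add_distrib, Finset.sum_const, Finset.card_univ, Fintype.card_fin, nsmul_eq_mul,
    Finset.sum_ite_mem, Finset.univ_inter]
  refine add_le_add ?_ le_rfl
  have h5 := hσ.card_mul_size_le
  calc (N : ℝ) * (σ * 𝓜.size * (𝓜.size * G) ^ 2) = σ * (𝓜.size * G) ^ 2 * (N * 𝓜.size) := by ring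
    _ ≤ σ * (𝓜.size * G) ^ 2 * (σ * (b - a)) := mul_le_mul_of_nonneg_left h5 (by positivity)
    _ = _ := by ring

end Boundary

/-- Constant in the energy estimate for right-hand sides with vanishing means. -/
def energyConst (L T Cr σ : ℝ) : ℝ :=
  (L * Cr ^ 2 + Real.exp 1 * (Real.exp 1 * L + L * T ^ 2)) + (L + L * Cr ^ 2) + σ ^ 2 * L

lemma energyConst_nonneg {L : ℝ} (hL : 0 ≤ L) (T Cr σ : ℝ) : 0 ≤ energyConst L T Cr σ := by
  unfold energyConst
  positivity

/-- The energy estimate for right-hand sides with vanishing means. -/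
lemma Evol.nsq_le_of_mean_zero {a b : ℝ} {N : ℕ} [NeZero N] {k : ℕ} {F : Flux} {𝓜 : Mesh a b N}
    {T σ Cr Ct G G₂ : ℝ} {z z' : ℝ → Fin N → ℂ[X]} {g : ℝ → Fin N → ℝ → ℂ}
    (hz : Evol k F 𝓜 T z z' g) (hab : a < b) (hσ : 𝓜.Regular σ) (h0 : z 0 = 0)
    (hCt0 : 0 ≤ Ct)
    (hCt : ∀ p : ℂ[X], p.natDegree ≤ k → ‖pf p 1‖ ^ 2 ≤ Ct * ∫ ξ in (0 : ℝ)..1, ‖pf p ξ‖ ^ 2)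
    (hrep : ∀ t ∈ Set.Icc 0 T, ∃ v ∈ Vh N k,
      (∀ j, ∀ ξ ∈ Set.Icc (0 : ℝ) 1, ‖pf (𝓜.pull j (v j)) ξ‖ ≤ Cr * (𝓜.size ^ 2 * G)) ∧
        ∀ w : Fin N → ℂ[X], w ∈ Vh N k →
          ∑ j, (𝓜.len j : ℂ) * ∫ ξ in (0 : ℝ)..1, g t j ξ * pf (𝓜.pull j (w j)) ξ
            = ∑ j, bilinA F 𝓜 v w j
              + ∑ j, (firstMoment 𝓜 (g t) (j + 1) - firstMoment 𝓜 (g t) j) * vMinus 𝓜 w j)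
    (hG : ∀ t ∈ Set.Icc 0 T, ∀ j, ∀ ξ ∈ Set.Icc (0 : ℝ) 1, ‖g t j ξ‖ ≤ G)
    (hG₂ : ∀ t ∈ Set.Icc 0 T, ∀ j, ∀ ξ ∈ Set.Icc (0 : ℝ) 1, ‖g t j ξ‖ ≤ G₂)
    (hL : ∀ t ∈ Set.Icc 0 T, ∀ t' ∈ Set.Icc 0 T, ∀ j, ∀ ξ ∈ Set.Icc (0 : ℝ) 1,
      ‖g t' j ξ - g t j ξ‖ ≤ G * |t' - t|)
    (hN : ∀ t ∈ Set.Icc 0 T, ∀ j, 𝓜.len (j + 1) = 𝓜.len j → ∀ ξ ∈ Set.Icc (0 : ℝ) 1,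
      ‖g t (j + 1) ξ - g t j ξ‖ ≤ 𝓜.size * G) {t : ℝ} (ht : t ∈ Set.Icc 0 T) :
    nsq 𝓜 (z t) ≤ Real.exp (Ct * T) * T * (energyConst (b - a) T Cr σ * (𝓜.size * G) ^ 2
      + ∑ _j ∈ 𝓜.nonuniformCells, 4 * σ * 𝓜.size * G₂ ^ 2) := by
  have hs := 𝓜.size_pos
  set S : ℝ := ∑ _j ∈ 𝓜.nonuniformCells, 4 * σ * 𝓜.size * G₂ ^ 2 with hS
  have hS0 : 0 ≤ S := Finset.sum_nonneg fun _ _ => by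
    have := hσ.sigma_pos
    positivity
  have hE := energyConst_nonneg (sub_pos.2 hab).le T Cr σ
  have hA0 : 0 ≤ energyConst (b - a) T Cr σ * (𝓜.size * G) ^ 2 + S := by positivity
  have henergy := le_exp_mul_of_deriv_le hA0 hCt0 (fun t ht => hz.hasDerivWithinAt_nsq ht)
    (fun t ht => ?_) ht
  · rw [h0, nsq_zero, zero_add] at henergy
    refine henergy.trans ?_
    rw [mul_assoc, mul_comm T]
    exact mul_le_mul (Real.exp_le_exp.2 (mul_le_mul_of_nonneg_left ht.2 hCt0))
      (mul_le_mul_of_nonneg_left ht.2 hA0) (mul_nonneg hA0 ht.1) (Real.exp_pos _).le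
  · have ht' : t ∈ Set.Icc 0 T := ⟨ht.1.le, ht.2.le⟩
    obtain ⟨v, hv, hvb, hvi⟩ := hrep t ht'
    rw [hvi _ (cjf_mem (hz.mem t ht'))]
    -- Symmetry and conjugation put ζ into the first argument, where the evolution equation can
    -- replace the form by ζ_t.
    have e1 : ‖∑ j, bilinA F 𝓜 v (cjf (z t)) j‖ = ‖∑ j, bilinA F 𝓜 (z t) (cjf v) j‖ := by
      rw [sum_bilinA_symm, ← RCLike.norm_conj, map_sum]
      simp only [← bilinA_cjf, cjf_cjf]
    -- The representing function is of size h²·C_r·G, so this lemma is used with h² as its small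
    -- parameter.
    have e2 := hz.norm_sum_bilinA_le ht' (cjf_mem hv) (h := 𝓜.size ^ 2) (Z := Cr * G) (by positivity)
      (fun j ξ hξ => by
        rw [norm_pf_pull_cjf]
        exact (hvb j ξ hξ).trans_eq (by ring)) (hG t ht') (hz.nsq_deriv_le hab h0 hG hL ht)
    have e3 := two_mul_norm_boundary_le (𝓜 := 𝓜) hCt
      (fun j => firstMoment 𝓜 (g t) (j + 1) - firstMoment 𝓜 (g t) j) (cjf_mem (hz.mem t ht'))
    have e4 := sum_boundary_le hσ (G := G) (G₂ := G₂)
      (d := fun j => firstMoment 𝓜 (g t) (j + 1) - firstMoment 𝓜 (g t) j)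
      (fun j hj => norm_firstMoment_sub_le (hz.cont t ht') hj (hN t ht' j hj))
      (fun j => (norm_sub_le _ _).trans (by
        have := norm_firstMoment_le (𝓜 := 𝓜) (hG₂ t ht' j)
        have := norm_firstMoment_le (𝓜 := 𝓜) (hG₂ t ht' (j + 1))
        linarith))
    rw [nsq_cjf] at e3
    rw [← e1] at e2
    rw [← hS] at e4
    have e5 : energyConst (b - a) T Cr σ * (𝓜.size * G) ^ 2 = 𝓜.size ^ 2 * ((b - a) * (Cr * G) ^ 2
        + Real.exp 1 * (Real.exp 1 * ((b - a) * G ^ 2) + (b - a) * (T * G) ^ 2))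
        + 𝓜.size ^ 2 * ((b - a) * G ^ 2 + (b - a) * (Cr * G) ^ 2)
        + σ ^ 2 * (b - a) * (𝓜.size * G) ^ 2 := by
      unfold energyConst
      ring
    refine (mul_le_mul_of_nonneg_left ((Complex.re_le_norm _).trans (norm_add_le _ _))
      (by norm_num)).trans ?_
    rw [mul_add, e5]
    linarith

/-- The error estimate for even degrees and local stability. -/
lemma exists_nsq_le_of_even {k : ℕ} (hk : 2 ≤ k) (hke : Even k) {a b T : ℝ} (hab : a < b)
    (hT : 0 < T) (σ : ℝ) (F : Flux) {K : ℝ} (hK : 0 ≤ K) :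
    ∃ C : ℝ, 0 ≤ C ∧ ∀ (N : ℕ) [NeZero N] (𝓜 : Mesh a b N) (s : Fin N → Fin N),
      𝓜.Regular σ → Good k F 𝓜 s 0 K → ∀ (u : ℝ → ℝ → ℂ), IsExactSolution a b T u →
      ∀ (uh : ℝ → Fin N → ℂ[X]), IsUWDGSolution k F 𝓜 T uh → uh 0 = uI k F 𝓜 T u 0 →
      ∀ M₁ M₂ : ℝ, SeminormLE T (2 * k + 3) u M₁ → SeminormLE T (2 * k + 1) u M₂ →
      ∀ t ∈ Set.Icc 0 T, nsq 𝓜 (uI k F 𝓜 T u t - uh t) ≤ C * M₁ ^ 2 * 𝓜.size ^ (4 * k)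
        + ∑ _j ∈ 𝓜.nonuniformCells, C * M₂ ^ 2 * 𝓜.size ^ (4 * k - 1) := by
  obtain ⟨n, hkn⟩ : ∃ n, k = 2 * n + 2 := by
    obtain ⟨m, hm⟩ := hke
    exact ⟨m - 1, by omega⟩
  have hn : (k - 1) / 2 = n := by omega
  have ek : k + 3 + 2 * n = 2 * k + 1 := by omega
  have ek' : k + 1 + 2 * n = 2 * k - 1 := by omega
  obtain ⟨K', hK', hbd⟩ := exists_bd_isW hk F σ hK n
  rw [ek, ek'] at hbd
  obtain ⟨Cr, hCr, hrep⟩ := exists_representation hk F σ hK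
  obtain ⟨Ct, hCt0, hCt⟩ := exists_trace_le k
  have hE := energyConst_nonneg (sub_pos.2 hab).le T Cr σ
  obtain ⟨c₁, hc₁⟩ : ∃ c, c = K' ^ 2 * ((1 + (b - a)) ^ (2 * k + 3)) ^ 2 *
    energyConst (b - a) T Cr σ := ⟨_, rfl⟩
  obtain ⟨c₂, hc₂⟩ : ∃ c, c = 4 * |σ| * K' ^ 2 := ⟨_, rfl⟩
  have hc₁0 : 0 ≤ c₁ := by rw [hc₁]; positivity
  have hc₂0 : 0 ≤ c₂ := by rw [hc₂]; positivity
  refine ⟨Real.exp (Ct * T) * T * (c₁ + c₂), by positivity,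
    fun N _ 𝓜 s hσ hGood u hu uh huh h0 M₁ M₂ hM₁ hM₂ t ht => ?_⟩
  have hs := 𝓜.size_pos
  have hD := hM₁.derivsLE hab hu
  -- By periodicity B dominates all derivatives of orders 1 to 2k + 3. Order 2k + 1 is used for the
  -- size of the residual, 2k + 2 for differences between neighbours and 2k + 3 for the Lipschitz
  -- bound in time. `G₂` needs only order 2k + 1, which is why the nonuniform cells carry M₂.
  obtain ⟨B, hBdef⟩ : ∃ B, B = (1 + (b - a)) ^ (2 * k + 3) * M₁ := ⟨_, rfl⟩
  rw [← hBdef] at hD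
  have hB0 : 0 ≤ B := (norm_nonneg _).trans ((hD t ht).2 1 le_rfl (by omega) 0)
  have hM₂0 : 0 ≤ M₂ := (norm_nonneg _).trans ((hM₂ t ht).2 0)
  obtain ⟨W, hW, z', hz⟩ := hGood.exists_evol hk hσ hT hu (hD.of_le (by omega)) huh
  rw [hn] at hW
  obtain ⟨G, hGdef⟩ : ∃ G, G = K' * (𝓜.size ^ (2 * k - 1) * B) := ⟨_, rfl⟩
  obtain ⟨G₂, hG₂def⟩ : ∃ G, G = K' * (𝓜.size ^ (2 * k - 1) * M₂) := ⟨_, rfl⟩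
  have hWG : ∀ t ∈ Set.Icc 0 T, ∀ j, ∀ ξ ∈ Set.Icc (0 : ℝ) 1, ‖-Complex.I * W t j ξ‖ ≤ G := by
    intro t ht j ξ hξ
    rw [norm_mul, norm_neg, Complex.norm_I, one_mul, hGdef]
    exact hbd 𝓜 s s 0 0 hσ hGood.compat hGood.stable hGood.len_s (u t) (W t) B hB0
      ((hD t ht).1.of_nat_le (by omega)) (fun ξ _ => by
        rw [zero_mul]
        exact fun j => (hD t ht).2 _ (by omega) (by omega) _) (hW t ht) ξ hξ j
  have hWG₂ : ∀ t ∈ Set.Icc 0 T, ∀ j, ∀ ξ ∈ Set.Icc (0 : ℝ) 1, ‖-Complex.I * W t j ξ‖ ≤ G₂ := by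
    intro t ht j ξ hξ
    rw [norm_mul, norm_neg, Complex.norm_I, one_mul, hG₂def]
    exact hbd 𝓜 s s 0 0 hσ hGood.compat hGood.stable hGood.len_s (u t) (W t) M₂ hM₂0
      (hM₂ t ht).1 (fun ξ _ => by
        rw [zero_mul]
        exact fun j => (hM₂ t ht).2 _) (hW t ht) ξ hξ j
  -- By linearity W(t') - W(t) is the correction of u_xx(t') - u_xx(t), whose top derivative is
  -- Lipschitz in time.
  have hWL : ∀ t ∈ Set.Icc 0 T, ∀ t' ∈ Set.Icc 0 T, ∀ j, ∀ ξ ∈ Set.Icc (0 : ℝ) 1,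
      ‖-Complex.I * W t' j ξ - -Complex.I * W t j ξ‖ ≤ G * |t' - t| := by
    intro t ht t' ht' j ξ hξ
    have hc : ∀ t ∈ Set.Icc 0 T, ∀ m ≤ 2 * k + 3, ContDiff ℝ m (u t) := fun t ht m hm =>
      (hD t ht).1.of_nat_le hm
    have hc2 : ∀ t ∈ Set.Icc 0 T, ∀ j, ContDiff ℝ (2 * n + 1 : ℕ) (𝓜.ref (iteratedDeriv 2 (u t)) j) :=
      fun t ht => 𝓜.contDiff_ref (contDiff_iteratedDeriv_two (hc t ht _ (by omega)))
    have hsub : ∀ m ≤ 2 * k + 3, iteratedDeriv m (fun x => u t' x - u t x)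
        = fun x => iteratedDeriv m (u t') x - iteratedDeriv m (u t) x := fun m hm => funext fun x =>
      iteratedDeriv_fun_sub (hc t' ht' m hm).contDiffAt (hc t ht m hm).contDiffAt
    have hadd := (hW t' ht').add (hW t ht) (hc2 t' ht') (hc2 t ht) (fun _ => 1) (fun _ => -1)
      (fun _ => rfl) (fun _ => rfl)
    have hfam : (fun j ξ => (fun _ => (1 : ℂ)) j * 𝓜.ref (iteratedDeriv 2 (u t')) j ξ
        + (fun _ => (-1 : ℂ)) j * 𝓜.ref (iteratedDeriv 2 (u t)) j ξ)
        = 𝓜.ref (iteratedDeriv 2 fun x => u t' x - u t x) := by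
      funext j ξ
      rw [hsub 2 (by omega)]
      simp only [Mesh.ref]
      ring
    rw [hfam] at hadd
    have h1 := hbd 𝓜 s s 0 0 hσ hGood.compat hGood.stable hGood.len_s _ _ (B * |t' - t|)
      (by positivity) ((hc t' ht' _ (by omega)).sub (hc t ht _ (by omega))) (fun ξ _ => by
        rw [zero_mul, hsub _ (by omega)]
        exact fun j => hu.solves.lipschitz (2 * k + 1) (fun t ht => (hD t ht).1)
          (fun t ht => (hD t ht).2 _ (by omega) (by omega)) t ht t' ht' _) hadd ξ hξ j
    rw [← mul_sub, norm_mul, norm_neg, Complex.norm_I, one_mul]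
    calc ‖W t' j ξ - W t j ξ‖ = ‖1 * W t' j ξ + -1 * W t j ξ‖ := by congr 1; ring
      _ ≤ _ := h1
      _ = _ := by rw [hGdef]; ring
  have hWN : ∀ t ∈ Set.Icc 0 T, ∀ j, 𝓜.len (j + 1) = 𝓜.len j → ∀ ξ ∈ Set.Icc (0 : ℝ) 1,
      ‖-Complex.I * W t (j + 1) ξ - -Complex.I * W t j ξ‖ ≤ 𝓜.size * G := by
    intro t ht j hj ξ hξ
    -- A symmetry of the scheme carrying j to j + 1 turns the comparison of the two cells into one
    -- difference in `Bd`.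
    obtain ⟨π, hπj, hπ, hπn, hπl, hπS⟩ := hGood.neighbor rfl j hj
    rw [← mul_sub, norm_mul, norm_neg, Complex.norm_I, one_mul, ← hπj, hGdef]
    exact (hbd 𝓜 s π 0 1 hσ hπ hπS hπl (u t) (W t) B hB0
      ((hD t ht).1.of_nat_le (by omega)) (fun ξ _ => by
        rw [zero_mul, zero_add]
        refine hπn.bd_ref (periodic_iteratedDeriv (hu.periodic t ht) _) ?_ (fun i hi x => ?_) ξ
        · exact contDiff_iteratedDeriv (m := 1) ((hD t ht).1.of_nat_le (by omega))
        · rw [iteratedDeriv_iteratedDeriv]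
          exact (hD t ht).2 _ (by omega) (by omega) x) (hW t ht) ξ hξ).2 j
  -- Since 2n + 2 = k, orthogonality reaches exactly the constants: the residual has mean zero on
  -- each cell.
  have hfin := hz.nsq_le_of_mean_zero hab hσ (sub_eq_zero.2 h0.symm) hCt0 hCt (fun t ht =>
    hrep 𝓜 s hσ hGood (fun j ξ => -Complex.I * W t j ξ) G (hz.cont t ht) (fun j => by
      have := (hW t ht).orth j (v := 1) (by rw [natDegree_one]; omega)
      rw [intervalIntegral.integral_const_mul]
      simpa using this) (hWG t ht)) hWG hWG₂ hWL hWN ht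
  have p1 : 𝓜.size ^ (4 * k) = 𝓜.size ^ 2 * (𝓜.size ^ (2 * k - 1)) ^ 2 := by
    rw [← pow_mul, ← pow_add]
    congr 1
    omega
  have p2 : 𝓜.size ^ (4 * k - 1) = 𝓜.size * (𝓜.size ^ (2 * k - 1)) ^ 2 := by
    rw [← pow_mul, ← pow_succ']
    congr 1
    omega
  have q1 : energyConst (b - a) T Cr σ * (𝓜.size * G) ^ 2 = c₁ * M₁ ^ 2 * 𝓜.size ^ (4 * k) := by
    rw [p1, hGdef, hBdef, hc₁]
    ring
  have q2 : 4 * σ * 𝓜.size * G₂ ^ 2 = c₂ * M₂ ^ 2 * 𝓜.size ^ (4 * k - 1) := by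
    rw [p2, hG₂def, hc₂, abs_of_pos hσ.sigma_pos]
    ring
  rw [q1, q2, mul_add, Finset.mul_sum] at hfin
  refine hfin.trans (add_le_add ?_ (Finset.sum_le_sum fun _ _ => ?_))
  · rw [← mul_assoc, ← mul_assoc]
    gcongr
    linarith
  · rw [← mul_assoc, ← mul_assoc]
    gcongr
    linarith

/-! ### Matching the regularity assumptions with the estimates. -/

section Final

variable {a b : ℝ} {N : ℕ} {k : ℕ} {F : Flux} {𝓜 : Mesh a b N} {K T M : ℝ}
  {u : ℝ → ℝ → ℂ}

/-- A1 and A2 both exclude A3, so only the seminorm alternative remains. -/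
lemma RegularityLE.seminormLE {m n : ℕ} (h : RegularityLE k F 𝓜 T m n u M)
    (hA : AssumptionA1 k F 𝓜 ∨ AssumptionA2 k F 𝓜) : SeminormLE T (k + 1 + m + 2 * n) u M := by
  rcases h with ⟨-, hM⟩ | ⟨hA3, -⟩ | ⟨hA3, -⟩
  · exact hM
  · rcases hA with hA | hA
    · exact absurd hA.1 hA3.2.1
    · exact absurd hA.2.2 hA3.2.2.1.not_gt
  · rcases hA with hA | hA
    · exact absurd hA.1 hA3.2.1
    · exact absurd hA.2.2 hA3.2.2.1.le.not_gt

variable [NeZero N]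

/-- The regularity assumptions cover what the basic estimate needs. -/
lemma RegularityLE.exists_reg (hab : a < b) (hu : IsExactSolution a b T u)
    (hgood : (AssumptionA1 k F 𝓜 ∨ AssumptionA2 k F 𝓜 → ∃ s, Good k F 𝓜 s 0 K) ∧
      (AssumptionA3lt k F 𝓜 → ∃ s, Good k F 𝓜 s 1 K) ∧
      (AssumptionA3eq k F 𝓜 → ∃ s, Good k F 𝓜 s 2 K))
    (h : RegularityLE k F 𝓜 T 2 ((k - 1) / 2) u M) :
    ∃ s p, Good k F 𝓜 s p K ∧ Reg k p s 𝓜 T u M := by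
  obtain ⟨h12, h3, h4⟩ := hgood
  rcases h with ⟨hA, hM⟩ | ⟨hA, hM⟩ | ⟨hA, hM⟩
  · obtain ⟨s, hs⟩ := h12 hA
    exact ⟨s, 0, hs, hM.reg hab hu⟩
  · obtain ⟨s, hs⟩ := h3 hA
    obtain rfl : s = nxt := hs.shift.resolve_left one_ne_zero
    -- The available order exceeds the required one, k + 3 + 2n + p(n + 1), by one, both here and
    -- for p = 2.
    exact ⟨nxt, 1, hs, hM.reg hA.1 hu (by omega)⟩
  · obtain ⟨s, hs⟩ := h4 hA
    obtain rfl : s = nxt := hs.shift.resolve_left two_ne_zero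
    exact ⟨nxt, 2, hs, hM.reg hA.1 hu (by omega)⟩

lemma Reg.nonneg {p : ℕ} {s : Fin N → Fin N} (hT : 0 < T) (h : Reg k p s 𝓜 T u M) : 0 ≤ M :=
  (norm_nonneg _).trans ((h.2 0 ⟨le_rfl, hT.le⟩ 0 (by simp)).norm_le 0)

end Final

end UWDG

end

theorem theorem4p2 (k : ℕ) (hk : 2 ≤ k) (a b T : ℝ) (hab : a < b) (hT : 0 < T)
    (σ δ : ℝ) (hδ : 0 < δ) (F : Flux) :
    ∃ C : ℝ, 0 < C ∧
      ∀ (N : ℕ) [NeZero N] (𝓜 : Mesh a b N), 𝓜.Regular σ → Margin k F 𝓜 δ →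
      ∀ (u : ℝ → ℝ → ℂ), IsExactSolution a b T u →
      ∀ (uh : ℝ → Fin N → Polynomial ℂ), IsUWDGSolution k F 𝓜 T uh →
        uh 0 = uI k F 𝓜 T u 0 →
      ∀ t ∈ Set.Ioc 0 T,
        (Odd k → AssumptionA1 k F 𝓜 ∨ AssumptionA2 k F 𝓜 ∨ AssumptionA3 k F 𝓜 →
          ∀ M : ℝ, RegularityLE k F 𝓜 T 2 ((k - 1) / 2) u M →
            l2norm 𝓜 (uI k F 𝓜 T u t - uh t) ≤ C * M * 𝓜.size ^ (2 * k)) ∧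
        (Even k → AssumptionA1 k F 𝓜 ∨ AssumptionA2 k F 𝓜 →
          ∀ M₁ M₂ : ℝ, RegularityLE k F 𝓜 T (k + 2) 0 u M₁ → RegularityLE k F 𝓜 T k 0 u M₂ →
            l2norm 𝓜 (uI k F 𝓜 T u t - uh t) ≤
              Real.sqrt (C * M₁ ^ 2 * 𝓜.size ^ (4 * k) +
                ∑ _j ∈ 𝓜.nonuniformCells, C * M₂ ^ 2 * 𝓜.size ^ (4 * k - 1))) ∧
        (Even k → AssumptionA3 k F 𝓜 →
          ∀ M : ℝ, RegularityLE k F 𝓜 T 2 ((k - 2) / 2) u M →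
            l2norm 𝓜 (uI k F 𝓜 T u t - uh t) ≤ C * M * 𝓜.size ^ (2 * k - 1)) := by
  obtain ⟨K, hK, hgood⟩ := exists_good k hk a b σ δ hδ F
  obtain ⟨C₁, hC₁, hbasic⟩ := exists_l2norm_le hk hab hT σ F hK
  obtain ⟨C₂, hC₂, heven⟩ : ∃ C : ℝ, 0 ≤ C ∧ (Even k → ∀ (N : ℕ) [NeZero N] (𝓜 : Mesh a b N)
      (s : Fin N → Fin N), 𝓜.Regular σ → Good k F 𝓜 s 0 K →
      ∀ (u : ℝ → ℝ → ℂ), IsExactSolution a b T u →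
      ∀ (uh : ℝ → Fin N → Polynomial ℂ), IsUWDGSolution k F 𝓜 T uh → uh 0 = uI k F 𝓜 T u 0 →
      ∀ M₁ M₂ : ℝ, SeminormLE T (2 * k + 3) u M₁ → SeminormLE T (2 * k + 1) u M₂ →
      ∀ t ∈ Set.Icc 0 T, nsq 𝓜 (uI k F 𝓜 T u t - uh t) ≤ C * M₁ ^ 2 * 𝓜.size ^ (4 * k)
        + ∑ _j ∈ 𝓜.nonuniformCells, C * M₂ ^ 2 * 𝓜.size ^ (4 * k - 1)) := by
    by_cases hke : Even k
    · obtain ⟨C, hC, h⟩ := exists_nsq_le_of_even hk hke hab hT σ F hK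
      exact ⟨C, hC, fun _ => h⟩
    · exact ⟨0, le_rfl, fun h => absurd h hke⟩
  -- The summand 1 only makes the constant positive.
  refine ⟨C₁ + C₂ + 1, by positivity, fun N _ 𝓜 hσ hδ' u hu uh huh h0 t ht => ?_⟩
  have ht' : t ∈ Set.Icc 0 T := ⟨ht.1.le, ht.2⟩
  have hs := 𝓜.size_pos
  have hG := hgood N 𝓜 hσ hδ'
  have basic : ∀ M, RegularityLE k F 𝓜 T 2 ((k - 1) / 2) u M →
      l2norm 𝓜 (uI k F 𝓜 T u t - uh t)
        ≤ (C₁ + C₂ + 1) * M * 𝓜.size ^ (k + 1 + 2 * ((k - 1) / 2)) := by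
    intro M hM
    obtain ⟨s, p, hsp, hreg⟩ := hM.exists_reg hab hu hG
    have hM0 := hreg.nonneg hT
    refine (hbasic N 𝓜 s p hσ hsp u hu uh huh h0 M hreg t ht').trans ?_
    gcongr
    linarith
  refine ⟨fun hodd _ M hM => ?_, fun hev hA M₁ M₂ hM₁ hM₂ => ?_, fun hev _ M hM => ?_⟩
  · have e : 2 * k = k + 1 + 2 * ((k - 1) / 2) := by
      obtain ⟨m, rfl⟩ := hodd
      omega
    rw [e]
    exact basic M hM
  · obtain ⟨s, hs0⟩ := hG.1 hA
    have h₁ := hM₁.seminormLE hA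
    have h₂ := hM₂.seminormLE hA
    rw [show k + 1 + (k + 2) + 2 * 0 = 2 * k + 3 by ring] at h₁
    rw [show k + 1 + k + 2 * 0 = 2 * k + 1 by ring] at h₂
    rw [l2norm_eq]
    refine Real.sqrt_le_sqrt ((heven hev N 𝓜 s hσ hs0 u hu uh huh h0 M₁ M₂ h₁ h₂ t ht').trans ?_)
    refine add_le_add ?_ (Finset.sum_le_sum fun _ _ => ?_)
    · gcongr
      linarith
    · gcongr
      linarith
  · have e : (k - 2) / 2 = (k - 1) / 2 ∧ 2 * k - 1 = k + 1 + 2 * ((k - 1) / 2) := by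
      obtain ⟨m, rfl⟩ := hev
      omega
    rw [e.1] at hM
    rw [e.2]
    exact basic M hM
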